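/- **Setting.** Let $\alpha\ge 0$ and $c>0$ be real numbers, $\omega_\alpha(x)=(1-x^2)^\alpha$ on $[-1,1]$, and $$\mathcal L_c\varphi(x)=(1-x^2)\varphi''(x)-(2\alpha+2)x\varphi'(x)-c^2x^2\varphi(x),\qquad \varphi\in C^2([-1,1]).$$ Let $\chi_0(c)<\chi_1(c)<\cdots$ be the eigenvalues of $-\mathcal L_c$ on $C^2([-1,1])$, and let $\psi_{n,c}$ (the generalized prolate spheroidal wave function, GPSWF) be the real eigenfunction for $\chi_n(c)$ with $\int_{-1}^1\psi_{n,c}^2\,\omega_\alpha\,dx=1$; it is unique up to its sign. Let $\widetilde P_k$ be the Jacobi polynomial $P_k^{(\alpha,\alpha)}$ divided by its norm in $L^2([-1,1],\omega_\alpha)$, and let $\beta_k^n=\int_{-1}^1\widetilde P_k\,\psi_{n,c}\,\omega_\alpha\,dx$. Put $$M_\alpha=\max\Big(\tfrac14,\sqrt{\tfrac{2(2\alpha+2)}{(2\alpha+5)(2\alpha+3)^2}}\Big),\quad N_\alpha=\max\Big(\tfrac{3}{2\alpha+5},\ \tfrac12+\tfrac{|4\alpha^2-1|}{(2\alpha+3)(2\alpha+7)}\Big),\quad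 C_\alpha=2M_\alpha+N_\alpha,$$ $$C'_\alpha=\frac{2^\alpha(3/2)^{3/4}(3/2+2\alpha)^{3/4+\alpha}}{e^{2\alpha+3/2}}\sqrt{1+\alpha}.$$ **Theorem.** Let $n\ge 1$ be an integer such that $q=c^2/\chi_n(c)\le 1$. There is a number $\mu=\mu_n^{(\alpha)}(c)\in\mathbb C$, the eigenvalue of the weighted finite Fourier transform that belongs to $\psi_{n,c}$, with $$\int_{-1}^1e^{icxy}\psi_{n,c}(y)\,\omega_\alpha(y)\,dy=\mu\,\psi_{n,c}(x)\qquad(|x|\le1),$$ and the following hold. 1. For every integer $k\ge1$ with $k(k+2\alpha+1)+C_\alpha c^2\le\chi_n(c)$, $$|\beta_0^n|\le\sqrt{\frac{\Gamma(\alpha+3/2)}{\sqrt\pi\,\Gamma(\alpha+1)}}\,\sqrt{1+\alpha}\;|\mu|\qquad\text{and}\qquad|\beta_k^n|\le C'_\alpha\Big(\frac2q\Big)^k|\mu|.$$ 2. For a suitable choice of the sign of $\psi_{n,c}$: $\beta_j^n\ge0$ for every integer $j\ge0$ with $j(j+2\alpha+1)+C_\alpha c^2\le\chi_n(c)$, and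 $$0\le\int_{-1}^1y^j\psi_{n,c}(y)\,\omega_\alpha(y)\,dy\le\sqrt{1+\alpha}\,\Big(\frac1q\Big)^j|\mu|$$ for every integer $j\ge0$ with $j(j+2\alpha+1)\le\chi_n(c)$. -/

import Mathlib

noncomputable section

namespace GPSWF

/-- The weight `ω_α(x) = (1 - x²)^α` on `[-1, 1]`. -/
def weight (α x : ℝ) : ℝ := (1 - x ^ 2) ^ α

/-- The Jacobi polynomials `P_k^{(α,α)}`, through their three term recursion
`P_{k+1} = A_k x P_k - C_k P_{k-1}`, here written with `k = m + 1`. -/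
def jacobi (α : ℝ) : ℕ → ℝ → ℝ
  | 0, _ => 1
  | 1, x => (α + 1) * x
  | m + 2, x =>
      (2 * (m + 1 : ℝ) + 2 * α + 1) * (2 * (m + 1 : ℝ) + 2 * α + 2) /
          (2 * ((m + 1 : ℝ) + 1) * ((m + 1 : ℝ) + 2 * α + 1)) * x * jacobi α (m + 1) x -
        ((m + 1 : ℝ) + α) ^ 2 * (2 * (m + 1 : ℝ) + 2 * α + 2) /
          (((m + 1 : ℝ) + 1) * ((m + 1 : ℝ) + 2 * α + 1) * (2 * (m + 1 : ℝ) + 2 * α)) *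
          jacobi α m x

/-- The Jacobi polynomials normalized in `L²([-1, 1], ω_α)`. -/
def jacobiNormalized (α : ℝ) (k : ℕ) (x : ℝ) : ℝ :=
  jacobi α k x / Real.sqrt (∫ y in (-1 : ℝ)..1, jacobi α k y ^ 2 * weight α y)

/-- `φ` is of class `C²` on `[-1, 1]` and `- L_c φ = χ φ`, where
`L_c φ = (1 - x²) φ'' - (2 α + 2) x φ' - c² x² φ`. At the end points the equation follows
by continuity. -/
def SolvesSturmLiouville (α c χ : ℝ) (φ : ℝ → ℝ) : Prop :=
  ContDiffOn ℝ 2 φ (Set.Icc (-1) 1) ∧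
    ∀ x ∈ Set.Ioo (-1 : ℝ) 1,
      -((1 - x ^ 2) * deriv (deriv φ) x - (2 * α + 2) * x * deriv φ x - c ^ 2 * x ^ 2 * φ x) =
        χ * φ x

/-- The eigenvalues of `- L_c` on `C²([-1, 1])`. -/
def eigenvalues (α c : ℝ) : Set ℝ :=
  {χ | ∃ φ : ℝ → ℝ, SolvesSturmLiouville α c χ φ ∧ ∃ x ∈ Set.Icc (-1 : ℝ) 1, φ x ≠ 0}

/-- `ψ` is the generalized prolate spheroidal wave function `ψ_{n,c}^{(α)}` (which is determined
up to its sign) and `χ` is `χ_n(c)`: `ψ` is an eigenfunction of `- L_c`, normalized in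
`L²([-1, 1], ω_α)`, for the eigenvalue `χ`, and exactly `n` eigenvalues are smaller than `χ`. -/
def IsGPSWF (α c : ℝ) (n : ℕ) (χ : ℝ) (ψ : ℝ → ℝ) : Prop :=
  SolvesSturmLiouville α c χ ψ ∧
    (∫ x in (-1 : ℝ)..1, ψ x ^ 2 * weight α x) = 1 ∧
    {χ' ∈ eigenvalues α c | χ' < χ}.encard = (n : ℕ∞)

/-- The weighted finite Fourier transform `F_c^{(α)}`. -/
def finiteFourier (α c : ℝ) (ψ : ℝ → ℝ) (x : ℝ) : ℂ :=
  ∫ y in (-1 : ℝ)..1,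
    Complex.exp (Complex.I * (c : ℂ) * (x : ℂ) * (y : ℂ)) * (ψ y : ℂ) * (weight α y : ℂ)

/-- `μ` is the eigenvalue of `F_c^{(α)}` that belongs to `ψ`. -/
def IsFourierEigenvalue (α c : ℝ) (ψ : ℝ → ℝ) (μ : ℂ) : Prop :=
  ∀ x ∈ Set.Icc (-1 : ℝ) 1, finiteFourier α c ψ x = μ * (ψ x : ℂ)

/-- The expansion coefficients `β_k` of `ψ` in the normalized Jacobi polynomials. -/
def coeff (α : ℝ) (ψ : ℝ → ℝ) (k : ℕ) : ℝ :=
  ∫ x in (-1 : ℝ)..1, jacobiNormalized α k x * ψ x * weight α x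

/-- The moments of `ψ`. -/
def moment (α : ℝ) (ψ : ℝ → ℝ) (j : ℕ) : ℝ :=
  ∫ x in (-1 : ℝ)..1, x ^ j * ψ x * weight α x

/-- The constant `M_α`. -/
def constM (α : ℝ) : ℝ :=
  max (1 / 4) (Real.sqrt (2 * (2 * α + 2) / ((2 * α + 5) * (2 * α + 3) ^ 2)))

/-- The constant `N_α`. -/
def constN (α : ℝ) : ℝ :=
  max (3 / (2 * α + 5)) (1 / 2 + |4 * α ^ 2 - 1| / ((2 * α + 3) * (2 * α + 7)))

/-- The constant `C_α = 2 M_α + N_α`. -/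
def constC (α : ℝ) : ℝ := 2 * constM α + constN α

/-- The constant `C'_α`. -/
def constC' (α : ℝ) : ℝ :=
  (2 : ℝ) ^ α * (3 / 2 : ℝ) ^ (3 / 4 : ℝ) * (3 / 2 + 2 * α) ^ (3 / 4 + α) /
    Real.exp (2 * α + 3 / 2) * Real.sqrt (1 + α)

end GPSWF

end

/-!
Throughout, `q = c² / χ ≤ 1` and `Z = ψ(0)² + ψ'(0)² / χ`.

The operator `L_c` is formally self-adjoint for the weight `ω_α`, and its action on the kernel
`exp (i c x y)` is the same in `x` as in `y`. The finite Fourier transform of `ψ` therefore solves the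
same equation as `ψ`. Solutions that are `C¹` up to the end points are determined up to a factor
(constancy of the Wronskian, and uniqueness for the initial value problem at the origin), so the
transform equals `μ ψ`. The values of this identity and of its derivative at the origin express the
first two moments through `ψ(0)`, `ψ'(0)` and `μ`; as `ψ` is even or odd, one of them vanishes
(`IsSolution.exists_eigenvalue`).

Testing the equation against `x ^ j` gives a recursion for the moments, which propagates both the
sign and the bound `q ^ (j / 2) |m_j| ≤ √Z |μ|` as long as `j (j + 2 α + 1) ≤ χ` (`moment_bounds`).
Testing it against the orthonormal Jacobi polynomials gives a five-diagonal recursion for the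
coefficients `β_k`. The constants `M_α` and `N_α` bound the entries of its matrix, and under the
condition with `C_α = 2 M_α + N_α` the sequences `β_{2k}` and `β_{2k+1}` increase from their
nonnegative first terms (`coeff_nonneg`). As multiplication by `x` has nonnegative entries in the
Jacobi basis, nonnegative coefficients are dominated by moments: `β_k ≤ κ_k m_k`, where `κ_k` is the
leading coefficient of the `k`-th orthonormal polynomial (`coeff_sq_le`).

It remains to control `Z` and `κ_k`. The energy
`(1 - x²)^(2α+1) ((1 - q x²) ψ² + (1 - x²) ψ'² / χ)` has a derivative without `ψ'`, and its decay from
the origin to the end points gives `Z ≤ 1 + α` (`IsSolution.initial_le`). This suffices for the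
moments and for `β_0`. The bound with the constant `C'_α` requires `4 ^ (-k) κ_k² q Z ≤ C'_α²`
(`IsSolution.leadingSq_mul_le`). Here `4 ^ (-k) κ_k²` is an explicit quotient of values of the Gamma
function; it is at most its limit `4 ^ α / π` for `α ≥ 1 / 2` (`leadingSq_le`) and at most its value
at `k = 1` for `α ≤ 1 / 2` (`leadingSq_le_small`). For `α ≥ 2` the bound `Z ≤ 1 + α` is then still
enough. For `α < 2` it is not, and `q Z` is bounded by an energy identity with a multiplier
(`IsSolution.initial_le_of_multiplier`). The multiplier is constant for `1 ≤ α ≤ 2` and for small `q`,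
and a polynomial of degree six in the other cases. The latter leave ten polynomial inequalities on
the unit square, which are proved by evaluating a verified nonnegativity test for integer
polynomials (`BiPoly.eval_nonneg`).
-/

namespace GPSWF

open Set Filter Topology MeasureTheory intervalIntegral

/-! ### The weight and the differential equation -/

theorem continuous_weight {α : ℝ} (hα : 0 ≤ α) : Continuous (weight α) := by
  unfold weight
  exact (by fun_prop : Continuous fun x : ℝ => 1 - x ^ 2).rpow_const fun _ => Or.inr hα

theorem one_sub_sq_pos {x : ℝ} (hx : x ∈ Ioo (-1 : ℝ) 1) : 0 < 1 - x ^ 2 := by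
  nlinarith [hx.1, hx.2]

theorem one_sub_sq_nonneg {x : ℝ} (hx : x ∈ Icc (-1 : ℝ) 1) : 0 ≤ 1 - x ^ 2 := by
  nlinarith [hx.1, hx.2]

theorem weight_pos (α : ℝ) {x : ℝ} (hx : x ∈ Ioo (-1 : ℝ) 1) : 0 < weight α x :=
  Real.rpow_pos_of_pos (one_sub_sq_pos hx) _

theorem weight_nonneg (α : ℝ) {x : ℝ} (hx : x ∈ Icc (-1 : ℝ) 1) : 0 ≤ weight α x :=
  Real.rpow_nonneg (one_sub_sq_nonneg hx) _

theorem weight_add_one (α : ℝ) {x : ℝ} (hx : x ∈ Ioo (-1 : ℝ) 1) :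
    weight (α + 1) x = weight α x * (1 - x ^ 2) :=
  Real.rpow_add_one (one_sub_sq_pos hx).ne' α

theorem weight_neg (α x : ℝ) : weight α (-x) = weight α x := by simp [weight]

theorem weight_zero (α : ℝ) : weight α 0 = 1 := by simp [weight]

theorem weight_one {p : ℝ} (hp : p ≠ 0) : weight p 1 = 0 := by
  simp [weight, Real.zero_rpow hp]

theorem weight_neg_one {p : ℝ} (hp : p ≠ 0) : weight p (-1) = 0 := by
  simp [weight, Real.zero_rpow hp]

theorem hasDerivAt_weight_add_one (α : ℝ) {x : ℝ} (hx : x ∈ Ioo (-1 : ℝ) 1) :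
    HasDerivAt (weight (α + 1)) (-(2 * (α + 1)) * x * weight α x) x := by
  have h1 : HasDerivAt (fun x : ℝ => 1 - x ^ 2) (-(2 * x)) x := by
    simpa using (hasDerivAt_pow 2 x).const_sub 1
  have h2 := h1.rpow_const (p := α + 1) (Or.inl (one_sub_sq_pos hx).ne')
  refine h2.congr_deriv ?_
  simp only [weight, add_sub_cancel_right]
  ring

/-- A solution on `[-1, 1]` of `L_c φ = -χ φ`, together with its derivative. The equation is solved
for the second derivative, so it is imposed only in the open interval. -/
structure IsSolution (α c χ : ℝ) (φ φ' : ℝ → ℝ) : Prop where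
  cont : ContinuousOn φ (Icc (-1) 1)
  cont' : ContinuousOn φ' (Icc (-1) 1)
  deriv : ∀ x ∈ Ioo (-1 : ℝ) 1, HasDerivAt φ (φ' x) x
  deriv' : ∀ x ∈ Ioo (-1 : ℝ) 1,
    HasDerivAt φ' (((2 * α + 2) * x * φ' x - (χ - c ^ 2 * x ^ 2) * φ x) / (1 - x ^ 2)) x

/-- At the end points, where `deriv φ` may be a junk value, the derivative within `[-1, 1]` is the
continuous extension of `φ'`. -/
theorem SolvesSturmLiouville.isSolution {α c χ : ℝ} {φ : ℝ → ℝ}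
    (h : SolvesSturmLiouville α c χ φ) :
    IsSolution α c χ φ (derivWithin φ (Icc (-1) 1)) := by
  obtain ⟨hC, heq⟩ := h
  have hmem : ∀ x ∈ Ioo (-1 : ℝ) 1, Icc (-1 : ℝ) 1 ∈ 𝓝 x := fun x hx => Icc_mem_nhds hx.1 hx.2
  have hU : UniqueDiffOn ℝ (Icc (-1 : ℝ) 1) := uniqueDiffOn_Icc (by norm_num)
  have h1 : ContDiffOn ℝ 1 (derivWithin φ (Icc (-1) 1)) (Icc (-1) 1) :=
    ((contDiffOn_succ_iff_derivWithin (n := 1) hU).1 (by simpa [one_add_one_eq_two] using hC)).2.2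
  have hd : ∀ x ∈ Ioo (-1 : ℝ) 1, HasDerivAt φ (derivWithin φ (Icc (-1) 1) x) x := by
    intro x hx
    have := (hC.differentiableOn (by norm_num) x (Ioo_subset_Icc_self hx)).hasDerivWithinAt
    exact this.hasDerivAt (hmem x hx)
  refine ⟨hC.continuousOn, h1.continuousOn, hd, fun x hx => ?_⟩
  have hd1 : HasDerivAt (derivWithin φ (Icc (-1) 1))
      (derivWithin (derivWithin φ (Icc (-1) 1)) (Icc (-1) 1) x) x :=
    (h1.differentiableOn (by norm_num) x (Ioo_subset_Icc_self hx)).hasDerivWithinAt.hasDerivAt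
      (hmem x hx)
  have hev : deriv φ =ᶠ[𝓝 x] derivWithin φ (Icc (-1) 1) := by
    filter_upwards [Ioo_mem_nhds hx.1 hx.2] with y hy using (hd y hy).deriv
  have e2 : deriv (deriv φ) x = derivWithin (derivWithin φ (Icc (-1) 1)) (Icc (-1) 1) x := by
    rw [hev.deriv_eq, hd1.deriv]
  have e := heq x hx
  rw [e2, (hd x hx).deriv] at e
  convert hd1 using 1
  rw [div_eq_iff (one_sub_sq_pos hx).ne']
  linarith

theorem IsSolution.comp_neg {α c χ : ℝ} {φ φ' : ℝ → ℝ} (h : IsSolution α c χ φ φ') :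
    IsSolution α c χ (fun x => φ (-x)) (fun x => -φ' (-x)) := by
  have hI : MapsTo (fun x : ℝ => -x) (Icc (-1) 1) (Icc (-1) 1) := fun x hx =>
    ⟨by linarith [hx.2], by linarith [hx.1]⟩
  have hO : ∀ x ∈ Ioo (-1 : ℝ) 1, -x ∈ Ioo (-1 : ℝ) 1 := fun x hx =>
    ⟨by linarith [hx.2], by linarith [hx.1]⟩
  refine ⟨h.cont.comp continuousOn_neg hI, (h.cont'.comp continuousOn_neg hI).neg, ?_, ?_⟩
  · intro x hx
    exact ((h.deriv _ (hO x hx)).comp x (hasDerivAt_neg x)).congr_deriv (by ring)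
  · intro x hx
    refine ((h.deriv' _ (hO x hx)).comp x (hasDerivAt_neg x)).neg.congr_deriv ?_
    simp only [neg_sq]
    ring

theorem IsSolution.sub_const_mul {α c χ : ℝ} {φ φ' u u' : ℝ → ℝ} (h : IsSolution α c χ φ φ')
    (hu : IsSolution α c χ u u') (m : ℝ) :
    IsSolution α c χ (fun x => u x - m * φ x) (fun x => u' x - m * φ' x) := by
  refine ⟨hu.cont.sub (h.cont.const_smul m), hu.cont'.sub (h.cont'.const_smul m), ?_, ?_⟩
  · intro x hx
    exact (hu.deriv x hx).sub ((h.deriv x hx).const_mul m)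
  · intro x hx
    refine ((hu.deriv' x hx).sub ((h.deriv' x hx).const_mul m)).congr_deriv ?_
    ring

/-- The formal self-adjointness of `L_c` for the weight `ω_α`, tested against a `C²` function. -/
theorem IsSolution.integral_adjoint {α c χ : ℝ} (hα : 0 ≤ α) {φ φ' : ℝ → ℝ}
    (h : IsSolution α c χ φ φ') {f f1 f2 : ℝ → ℝ} (hf : ∀ x, HasDerivAt f (f1 x) x)
    (hf1 : ∀ x, HasDerivAt f1 (f2 x) x) (hf2 : Continuous f2) :
    ∫ x in (-1 : ℝ)..1, ((1 - x ^ 2) * f2 x - (2 * α + 2) * x * f1 x - c ^ 2 * x ^ 2 * f x +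
      χ * f x) * φ x * weight α x = 0 := by
  have cf : Continuous f := continuous_iff_continuousAt.2 fun x => (hf x).continuousAt
  have cf1 : Continuous f1 := continuous_iff_continuousAt.2 fun x => (hf1 x).continuousAt
  have cw := continuous_weight hα
  have cw1 := continuous_weight (α := α + 1) (by linarith)
  have key := integral_eq_sub_of_hasDerivAt_of_le (a := -1) (b := 1)
    (f := fun x => weight (α + 1) x * (f1 x * φ x - f x * φ' x))
    (f' := fun x => ((1 - x ^ 2) * f2 x - (2 * α + 2) * x * f1 x - c ^ 2 * x ^ 2 * f x +
      χ * f x) * φ x * weight α x) (by norm_num)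
    (cw1.continuousOn.mul ((cf1.continuousOn.mul h.cont).sub (cf.continuousOn.mul h.cont')))
    (fun x hx => ?_) ?_
  · rw [key, weight_one (by linarith), weight_neg_one (by linarith)]
    ring
  · have hw := one_sub_sq_pos hx
    refine HasDerivAt.congr_deriv ((hasDerivAt_weight_add_one α hx).mul
      (((hf1 x).mul (h.deriv x hx)).sub ((hf x).mul (h.deriv' x hx)))) ?_
    rw [weight_add_one α hx]
    field_simp
    ring
  · apply ContinuousOn.intervalIntegrable
    rw [uIcc_of_le (by norm_num)]
    have : Continuous fun x => ((1 - x ^ 2) * f2 x - (2 * α + 2) * x * f1 x - c ^ 2 * x ^ 2 * f x +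
      χ * f x) := by fun_prop
    exact (this.continuousOn.mul h.cont).mul cw.continuousOn

/-- Two solutions are linearly dependent at the origin: the weighted Wronskian is constant and
vanishes at the end points. -/
theorem IsSolution.wronskian_zero {α c χ : ℝ} (hα : 0 ≤ α) {φ φ' u u' : ℝ → ℝ}
    (h : IsSolution α c χ φ φ') (hu : IsSolution α c χ u u') :
    u 0 * φ' 0 = u' 0 * φ 0 := by
  have cw1 := continuous_weight (α := α + 1) (by linarith)
  have key := integral_eq_sub_of_hasDerivAt_of_le (a := 0) (b := 1)
    (f := fun x => weight (α + 1) x * (u x * φ' x - u' x * φ x))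
    (f' := fun _ => 0) (by norm_num)
    ((cw1.continuousOn.mul ((hu.cont.mul h.cont').sub (hu.cont'.mul h.cont))).mono
      (Icc_subset_Icc (by norm_num) le_rfl))
    (fun x hx => ?_) (by simp)
  · simp only [weight_one (show α + 1 ≠ 0 by linarith), weight_zero,
      intervalIntegral.integral_zero] at key
    linarith
  · have hx' : x ∈ Ioo (-1 : ℝ) 1 := ⟨by linarith [hx.1], hx.2⟩
    have hw := one_sub_sq_pos hx'
    refine HasDerivAt.congr_deriv ((hasDerivAt_weight_add_one α hx').mul
      (((hu.deriv x hx').mul (h.deriv' x hx')).sub ((hu.deriv' x hx').mul (h.deriv x hx')))) ?_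
    rw [weight_add_one α hx']
    field_simp
    ring

/-- A solution has `φ 0 = 0` or `φ' 0 = 0`: compare it with its reflection. -/
theorem IsSolution.initial_mul_eq_zero {α c χ : ℝ} (hα : 0 ≤ α) {φ φ' : ℝ → ℝ}
    (h : IsSolution α c χ φ φ') : φ 0 * φ' 0 = 0 := by
  have := h.wronskian_zero hα h.comp_neg
  simp only [neg_zero] at this
  linarith

/-- If `χ ≤ 0`, then `(1 - x²)^(α+1) φ φ'` is monotone; it vanishes at both end points, so it is zero,
which forces `φ` to vanish. -/
theorem IsSolution.eigenvalue_pos {α c χ : ℝ} (hα : 0 ≤ α) (hc : 0 < c) {φ φ' : ℝ → ℝ}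
    (h : IsSolution α c χ φ φ') (hn : ∫ x in (-1 : ℝ)..1, φ x ^ 2 * weight α x = 1) : 0 < χ := by
  by_contra! hχ
  have cw1 := continuous_weight (α := α + 1) (by linarith)
  set T : ℝ → ℝ := fun x => weight (α + 1) x * (φ x * φ' x) with hT
  have hTc : ContinuousOn T (Icc (-1) 1) := cw1.continuousOn.mul (h.cont.mul h.cont')
  have hTd : ∀ x ∈ Ioo (-1 : ℝ) 1, HasDerivAt T
      (weight α x * ((1 - x ^ 2) * φ' x ^ 2 + (c ^ 2 * x ^ 2 - χ) * φ x ^ 2)) x := by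
    intro x hx
    have hw := one_sub_sq_pos hx
    refine HasDerivAt.congr_deriv ((hasDerivAt_weight_add_one α hx).mul ((h.deriv x hx).mul (h.deriv' x hx))) ?_
    rw [weight_add_one α hx]
    field_simp
    ring
  have hnn : ∀ x ∈ Ioo (-1 : ℝ) 1,
      0 ≤ weight α x * ((1 - x ^ 2) * φ' x ^ 2 + (c ^ 2 * x ^ 2 - χ) * φ x ^ 2) := by
    intro x hx
    have hw := one_sub_sq_pos hx
    have := weight_pos α hx
    have : 0 ≤ c ^ 2 * x ^ 2 - χ := by nlinarith [sq_nonneg (c * x)]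
    positivity
  have hmono : MonotoneOn T (Icc (-1) 1) := by
    apply monotoneOn_of_deriv_nonneg (convex_Icc _ _) hTc
    · intro x hx
      rw [interior_Icc] at hx
      exact (hTd x hx).differentiableAt.differentiableWithinAt
    · intro x hx
      rw [interior_Icc] at hx
      rw [(hTd x hx).deriv]
      exact hnn x hx
  have hT1 : T 1 = 0 := by simp [hT, weight_one (show α + 1 ≠ 0 by linarith)]
  have hT2 : T (-1) = 0 := by simp [hT, weight_neg_one (show α + 1 ≠ 0 by linarith)]
  have hT0 : ∀ x ∈ Icc (-1 : ℝ) 1, T x = 0 := fun x hx =>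
    le_antisymm (hT1 ▸ hmono hx (by simp) hx.2) (hT2 ▸ hmono (by simp) hx hx.1)
  have hφ : ∀ x ∈ Ioo (-1 : ℝ) 1, x ≠ 0 → φ x = 0 := by
    intro x hx hx0
    have e : T =ᶠ[𝓝 x] fun _ => 0 := by
      filter_upwards [Ioo_mem_nhds hx.1 hx.2] with y hy using hT0 y (Ioo_subset_Icc_self hy)
    have e1 := (hTd x hx).deriv
    rw [e.deriv_eq, deriv_const] at e1
    have hw := one_sub_sq_pos hx
    have h3 := weight_pos α hx
    have h4 : 0 < c ^ 2 * x ^ 2 - χ := by have : 0 < c ^ 2 * x ^ 2 := by positivity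
                                          linarith
    by_contra hne
    have : 0 < weight α x * ((1 - x ^ 2) * φ' x ^ 2 + (c ^ 2 * x ^ 2 - χ) * φ x ^ 2) := by
      positivity
    linarith
  have : ∫ x in (-1 : ℝ)..1, φ x ^ 2 * weight α x = 0 := by
    rw [integral_of_le (by norm_num), integral_Ioc_eq_integral_Ioo]
    have hae : ∀ᵐ x : ℝ, x ≠ 0 := by simp [ae_iff, measure_singleton]
    rw [setIntegral_congr_ae (g := fun _ => 0) measurableSet_Ioo]
    · simp
    · filter_upwards [hae] with x hx0 hx
      rw [hφ x hx hx0]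
      ring
  linarith

/-! ### Energy estimates -/

/-- If `T` decreases from `T 0` to `T 1 = 0` at a rate at most `K φ² ω_α`, then `T 0` is at most
`K` times the mass of `φ` on `[0, 1]`. -/
theorem le_mul_integral_of_hasDerivAt {α K : ℝ} (hα : 0 ≤ α) {T G φ : ℝ → ℝ}
    (hT : ContinuousOn T (Icc 0 1)) (hT1 : T 1 = 0) (hφ : ContinuousOn φ (Icc 0 1))
    (hd : ∀ x ∈ Ioo (0 : ℝ) 1, HasDerivAt T (-(G x * (φ x ^ 2 * weight α x))) x)
    (hG : ∀ x ∈ Ioo (0 : ℝ) 1, G x ≤ K) :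
    T 0 ≤ K * ∫ x in (0 : ℝ)..1, φ x ^ 2 * weight α x := by
  have hc : ContinuousOn (fun x => K * (φ x ^ 2 * weight α x)) (Icc 0 1) :=
    ((hφ.pow 2).mul (continuous_weight hα).continuousOn).const_smul K
  have := sub_le_integral_of_hasDeriv_right_of_le (a := 0) (b := 1) (g := fun x => -T x)
    (g' := fun x => G x * (φ x ^ 2 * weight α x)) (φ := fun x => K * (φ x ^ 2 * weight α x))
    (by norm_num) hT.neg (fun x hx => ?_) hc.integrableOn_Icc (fun x hx => ?_)
  · rw [intervalIntegral.integral_const_mul, hT1] at this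
    linarith
  · exact ((hd x hx).neg.congr_deriv (by ring)).hasDerivWithinAt
  · have : 0 ≤ φ x ^ 2 * weight α x :=
      mul_nonneg (sq_nonneg _) (weight_pos α ⟨by linarith [hx.1], hx.2⟩).le
    exact mul_le_mul_of_nonneg_right (hG x hx) this

/-- A bound by the mass on `[0, 1]` that is valid for all solutions gives, by reflection, a bound
by half of the total mass. -/
theorem IsSolution.initial_le_of_half {α c χ K : ℝ} (hα : 0 ≤ α) {φ φ' : ℝ → ℝ}
    (h : IsSolution α c χ φ φ') (hn : ∫ x in (-1 : ℝ)..1, φ x ^ 2 * weight α x = 1)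
    (hK : ∀ u u' : ℝ → ℝ, IsSolution α c χ u u' →
      u 0 ^ 2 + u' 0 ^ 2 / χ ≤ 2 * K * ∫ x in (0 : ℝ)..1, u x ^ 2 * weight α x) :
    φ 0 ^ 2 + φ' 0 ^ 2 / χ ≤ K := by
  have h1 := hK _ _ h
  have h2 := hK _ _ h.comp_neg
  have e : ∫ x in (0 : ℝ)..1, φ (-x) ^ 2 * weight α x =
      ∫ x in (-1 : ℝ)..0, φ x ^ 2 * weight α x := by
    have := intervalIntegral.integral_comp_neg (a := 0) (b := 1)
      (fun x => φ x ^ 2 * weight α x)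
    simp only [weight_neg, neg_zero] at this
    exact this
  have hcont : ContinuousOn (fun x => φ x ^ 2 * weight α x) (Icc (-1) 1) :=
    (h.cont.pow 2).mul (continuous_weight hα).continuousOn
  have hi : ∀ a b : ℝ, a ∈ Icc (-1 : ℝ) 1 → b ∈ Icc (-1 : ℝ) 1 →
      IntervalIntegrable (fun x => φ x ^ 2 * weight α x) volume a b := fun a b ha hb =>
    (hcont.mono (uIcc_subset_Icc ha hb)).intervalIntegrable
  have e2 := integral_add_adjacent_intervals (hi (-1) 0 (by simp) (by simp))
    (hi 0 1 (by simp) (by simp))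
  simp only [neg_zero, neg_sq, e] at h2
  rw [hn] at e2
  rw [← eq_sub_iff_add_eq'] at e2
  rw [e2, mul_sub, mul_one] at h1
  linarith

/-- The energy `(1 - x²)^(2α+1) ((1 - q x²) φ² + (1 - x²) φ'² / χ)`, `q = c² / χ`. Its derivative
contains no `φ'`. -/
theorem IsSolution.hasDerivAt_energy {α c χ q : ℝ} (hχ : 0 < χ) (hq : c ^ 2 = q * χ)
    {φ φ' : ℝ → ℝ} (h : IsSolution α c χ φ φ') {x : ℝ} (hx : x ∈ Ioo (-1 : ℝ) 1) :
    HasDerivAt (fun x => weight (2 * α + 1) x *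
      ((1 - q * x ^ 2) * φ x ^ 2 + (1 - x ^ 2) * φ' x ^ 2 / χ))
      (-(2 * x * weight α x * ((2 * α + 1) * (1 - q * x ^ 2) + q * (1 - x ^ 2)) *
        (φ x ^ 2 * weight α x))) x := by
  have hw := one_sub_sq_pos hx
  have h1 : HasDerivAt (fun x : ℝ => 1 - q * x ^ 2) (-(q * (2 * x))) x := by
    simpa using ((hasDerivAt_pow 2 x).const_mul q).const_sub 1
  have h2 : HasDerivAt (fun x : ℝ => 1 - x ^ 2) (-(2 * x)) x := by
    simpa using (hasDerivAt_pow 2 x).const_sub 1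
  have hww : weight (2 * α) x = weight α x * weight α x := by
    rw [weight, two_mul, Real.rpow_add hw]; rfl
  refine HasDerivAt.congr_deriv ((hasDerivAt_weight_add_one (2 * α) hx).mul
    ((h1.mul ((h.deriv x hx).pow 2)).add ((h2.mul ((h.deriv' x hx).pow 2)).div_const χ))) ?_
  simp only [Pi.pow_apply]
  rw [weight_add_one _ hx, hww, hq]
  field_simp
  ring

/-- By `1 - s ≤ exp (-s)` the square of `x ω_α(x)` is at most `1 / (2 α + 1)`. -/
theorem mul_weight_le {α x : ℝ} (hα : 0 ≤ α) (hx : x ∈ Ioo (0 : ℝ) 1) :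
    (2 * α + 1) * (x * weight α x) ≤ 1 + α := by
  have hw : 0 < 1 - x ^ 2 := one_sub_sq_pos ⟨by linarith [hx.1], hx.2⟩
  have hx0 := hx.1
  have h1 : weight α x ^ 2 ≤ Real.exp (-(2 * α * x ^ 2)) := by
    have h3 : Real.log (1 - x ^ 2) ≤ -x ^ 2 := by
      linarith [Real.log_le_sub_one_of_pos hw]
    rw [weight, ← Real.rpow_natCast, ← Real.rpow_mul hw.le, Real.rpow_def_of_pos hw]
    apply Real.exp_le_exp.2
    push_cast
    nlinarith
  have h2 : weight α x ^ 2 * (1 + 2 * α * x ^ 2) ≤ 1 := by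
    have h3 := Real.add_one_le_exp (2 * α * x ^ 2)
    have h4 : Real.exp (-(2 * α * x ^ 2)) * Real.exp (2 * α * x ^ 2) = 1 := by
      rw [← Real.exp_add]; simp
    have h5 := Real.exp_pos (-(2 * α * x ^ 2))
    have h6 : 0 < 1 + 2 * α * x ^ 2 := by positivity
    nlinarith
  have h3 : (x * weight α x) ^ 2 * (2 * α + 1) ≤ 1 := by
    have : x ^ 2 ≤ 1 := by linarith
    have : 0 ≤ weight α x ^ 2 := sq_nonneg _
    have : x ^ 2 * (1 + 2 * α) ≤ 1 + 2 * α * x ^ 2 := by nlinarith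
    nlinarith
  have hpos : 0 < weight α x := weight_pos α ⟨by linarith [hx.1], hx.2⟩
  apply le_of_sq_le_sq _ (by linarith)
  have : ((2 * α + 1) * (x * weight α x)) ^ 2 = (2 * α + 1) * ((x * weight α x) ^ 2 * (2 * α + 1)) := by
    ring
  rw [this]
  nlinarith [sq_nonneg α]

/-- The factor of `φ² ω_α` in the derivative of the energy is bounded uniformly in `q`. -/
theorem energy_rate_le {α q x : ℝ} (hα : 0 ≤ α) (hq0 : 0 ≤ q) (hq1 : q ≤ 1)
    (hx : x ∈ Ioo (0 : ℝ) 1) :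
    2 * x * weight α x * ((2 * α + 1) * (1 - q * x ^ 2) + q * (1 - x ^ 2)) ≤ 2 * (1 + α) := by
  have hx' : x ∈ Ioo (-1 : ℝ) 1 := ⟨by linarith [hx.1], hx.2⟩
  have hw := one_sub_sq_pos hx'
  have h1 := mul_weight_le hα hx
  have hpos := weight_pos α hx'
  have hle : weight α x ≤ 1 := Real.rpow_le_one hw.le (by nlinarith [sq_nonneg x]) hα
  have hx0 := hx.1
  have h2 : x * (1 - x ^ 2) ≤ 1 / 2 := by nlinarith [sq_nonneg (x - 1 / 2), sq_nonneg (x - 3 / 5)]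
  have h3 : (2 * α + 2) * (x * weight α x * (1 - x ^ 2)) ≤ 1 + α := by
    have : x * weight α x * (1 - x ^ 2) ≤ 1 / 2 := by
      have : 0 ≤ x * (1 - x ^ 2) := by positivity
      nlinarith
    nlinarith
  -- the expression is affine in `q`, and the two bounds above are its values at `q = 0` and `q = 1`
  have : 2 * x * weight α x * ((2 * α + 1) * (1 - q * x ^ 2) + q * (1 - x ^ 2)) =
    2 * ((1 - q) * ((2 * α + 1) * (x * weight α x)) +
      q * ((2 * α + 2) * (x * weight α x * (1 - x ^ 2)))) := by ring
  rw [this]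
  nlinarith

/-- The bound `ψ(0)² + ψ'(0)² / χ ≤ 1 + α` for a normalized solution with `q ≤ 1`. -/
theorem IsSolution.initial_le {α c χ q : ℝ} (hα : 0 ≤ α) (hχ : 0 < χ) (hq : c ^ 2 = q * χ)
    (hq0 : 0 ≤ q) (hq1 : q ≤ 1) {φ φ' : ℝ → ℝ} (h : IsSolution α c χ φ φ')
    (hn : ∫ x in (-1 : ℝ)..1, φ x ^ 2 * weight α x = 1) :
    φ 0 ^ 2 + φ' 0 ^ 2 / χ ≤ 1 + α := by
  refine h.initial_le_of_half hα hn fun u u' hu => ?_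
  have hI : Icc (0 : ℝ) 1 ⊆ Icc (-1) 1 := Icc_subset_Icc (by norm_num) le_rfl
  have cw := continuous_weight (α := 2 * α + 1) (by linarith)
  have := le_mul_integral_of_hasDerivAt hα (φ := u) (K := 2 * (1 + α))
    (T := fun x => weight (2 * α + 1) x *
      ((1 - q * x ^ 2) * u x ^ 2 + (1 - x ^ 2) * u' x ^ 2 / χ)) ?_ ?_ (hu.cont.mono hI)
    (fun x hx => hu.hasDerivAt_energy hχ hq ⟨by linarith [hx.1], hx.2⟩)
    (fun x hx => energy_rate_le hα hq0 hq1 hx)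
  · simpa [weight_zero] using this
  · have h1 := hu.cont.mono hI
    have h2 := hu.cont'.mono hI
    exact cw.continuousOn.mul (by fun_prop)
  · simp [weight_one (show 2 * α + 1 ≠ 0 by linarith)]

/-- Uniqueness for the initial value problem at the origin; the energy can only decrease on
`[0, 1]`. -/
theorem IsSolution.eq_zero {α c χ q : ℝ} (hα : 0 ≤ α) (hχ : 0 < χ) (hq : c ^ 2 = q * χ)
    (hq0 : 0 ≤ q) (hq1 : q ≤ 1) {φ φ' : ℝ → ℝ} (h : IsSolution α c χ φ φ') (h0 : φ 0 = 0)
    (h0' : φ' 0 = 0) : ∀ x ∈ Icc (-1 : ℝ) 1, φ x = 0 := by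
  have key : ∀ u u' : ℝ → ℝ, IsSolution α c χ u u' → u 0 = 0 → u' 0 = 0 →
      ∀ x ∈ Ico (0 : ℝ) 1, u x = 0 := by
    intro u u' hu hu0 hu0' b hb
    have cw := continuous_weight (α := 2 * α + 1) (by linarith)
    have hI : Icc (0 : ℝ) b ⊆ Icc (-1) 1 := Icc_subset_Icc (by norm_num) hb.2.le
    have hanti : AntitoneOn (fun x => weight (2 * α + 1) x *
      ((1 - q * x ^ 2) * u x ^ 2 + (1 - x ^ 2) * u' x ^ 2 / χ)) (Icc 0 b) := by
      apply antitoneOn_of_deriv_nonpos (convex_Icc _ _)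
      · have h1 := hu.cont.mono hI
        have h2 := hu.cont'.mono hI
        exact cw.continuousOn.mul (by fun_prop)
      · intro x hx
        rw [interior_Icc] at hx
        exact (hu.hasDerivAt_energy hχ hq ⟨by linarith [hx.1], by linarith [hx.2, hb.2]⟩
          ).differentiableAt.differentiableWithinAt
      · intro x hx
        rw [interior_Icc] at hx
        have hx' : x ∈ Ioo (-1 : ℝ) 1 := ⟨by linarith [hx.1], by linarith [hx.2, hb.2]⟩
        rw [(hu.hasDerivAt_energy hχ hq hx').deriv]
        have := weight_pos α hx'
        have := one_sub_sq_pos hx'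
        have : 0 ≤ 1 - q * x ^ 2 := by nlinarith [sq_nonneg x]
        have := hx.1
        have : 0 ≤ 2 * x * weight α x * ((2 * α + 1) * (1 - q * x ^ 2) + q * (1 - x ^ 2)) *
          (u x ^ 2 * weight α x) := by positivity
        linarith
    have hb' : b ∈ Ioo (-1 : ℝ) 1 := ⟨by linarith [hb.1], hb.2⟩
    have h2 := hanti (left_mem_Icc.2 hb.1) (right_mem_Icc.2 hb.1) hb.1
    simp only [hu0, hu0'] at h2
    norm_num at h2
    have hw := weight_pos (2 * α + 1) hb'
    have hr : 0 < 1 - q * b ^ 2 := by nlinarith [one_sub_sq_pos hb', sq_nonneg b]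
    have h3 : 0 ≤ (1 - b ^ 2) * u' b ^ 2 / χ := by
      have := one_sub_sq_pos hb'
      positivity
    by_contra hne
    have : 0 < weight (2 * α + 1) b * ((1 - q * b ^ 2) * u b ^ 2 + (1 - b ^ 2) * u' b ^ 2 / χ) := by
      have : 0 < (1 - q * b ^ 2) * u b ^ 2 := by positivity
      positivity
    linarith
  have hO : EqOn φ (fun _ => 0) (Ioo (-1) 1) := by
    intro x hx
    rcases le_total 0 x with h1 | h1
    · exact key _ _ h h0 h0' x ⟨h1, hx.2⟩
    · simpa using key _ _ h.comp_neg (by simpa using h0) (by simpa using h0') (-x)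
        ⟨by linarith, by linarith [hx.1]⟩
  have := hO.of_subset_closure (t := Icc (-1) 1) h.cont continuousOn_const Ioo_subset_Icc_self
    (by rw [closure_Ioo (by norm_num)])
  exact fun x hx => this hx

/-- The rate in the refined energy estimate with multiplier `η` (the arguments `e`, `e1`, `e2`,
`e3` are the values at `x` of `η` and of its first three derivatives); `ε = 1 / χ`. -/
noncomputable def multiplierRate (α q ε x e e1 e2 e3 : ℝ) : ℝ :=
  x * e * (1 + q - 2 * q * x ^ 2) - (1 - x ^ 2) * (1 - q * x ^ 2) * e1 +
    ε * (α * (α + 1) * (x * e + x ^ 2 * e1) - α * e1 -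
      ((1 - x ^ 2) ^ 2 * e3 - 6 * x * (1 - x ^ 2) * e2 + (6 * x ^ 2 - 2) * e1) / 4)

/-- The energy identity with a multiplier `η`. The energy
`(1 - x²)^(α+1) η ((1 - q x²) φ² + (1 - x²) φ'² / χ)` is corrected by terms of order `1 / χ`, chosen
so that the derivative is a multiple of `φ² ω_α`. -/
theorem IsSolution.initial_le_of_multiplier {α c χ q K : ℝ} (hα : 0 ≤ α) (hχ : 0 < χ)
    (hq : c ^ 2 = q * χ) {φ φ' : ℝ → ℝ} (h : IsSolution α c χ φ φ')
    (hn : ∫ x in (-1 : ℝ)..1, φ x ^ 2 * weight α x = 1) {η η1 η2 η3 : ℝ → ℝ}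
    (hη : ∀ x, HasDerivAt η (η1 x) x) (hη1 : ∀ x, HasDerivAt η1 (η2 x) x)
    (hη2 : ∀ x, HasDerivAt η2 (η3 x) x) (h0 : η 0 = 1) (h20 : 0 ≤ η2 0)
    (hK : ∀ x ∈ Icc (0 : ℝ) 1, multiplierRate α q χ⁻¹ x (η x) (η1 x) (η2 x) (η3 x) ≤ K) :
    φ 0 ^ 2 + φ' 0 ^ 2 / χ ≤ K := by
  refine h.initial_le_of_half hα hn fun u u' hu => ?_
  have hI : Icc (0 : ℝ) 1 ⊆ Icc (-1) 1 := Icc_subset_Icc (by norm_num) le_rfl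
  have cw := continuous_weight (α := α + 1) (by linarith)
  set T : ℝ → ℝ := fun x => weight (α + 1) x *
      (η x * ((1 - q * x ^ 2) * u x ^ 2 + (1 - x ^ 2) * u' x ^ 2 / χ) +
        (-((1 - x ^ 2) * η1 x + 2 * α * x * η x) * u x * u' x +
          ((1 - x ^ 2) * η2 x - 2 * x * η1 x + 2 * α * η x + 2 * α * x * η1 x) * u x ^ 2 / 2) / χ)
    with hT
  have := le_mul_integral_of_hasDerivAt hα (φ := u) (K := 2 * K) (T := T)
    (G := fun x => 2 * multiplierRate α q χ⁻¹ x (η x) (η1 x) (η2 x) (η3 x)) ?_ ?_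
    (hu.cont.mono hI) (fun x hx => ?_)
    (fun x hx => by linarith [hK x (Ioo_subset_Icc_self hx)])
  · refine le_trans ?_ this
    have hm : u 0 * u' 0 = 0 := hu.initial_mul_eq_zero hα
    have : T 0 = u 0 ^ 2 + u' 0 ^ 2 / χ + (-η1 0 * (u 0 * u' 0) +
        (η2 0 + 2 * α) * u 0 ^ 2 / 2) / χ := by
      simp only [hT, weight_zero, h0]
      ring
    rw [this, hm]
    have : 0 ≤ (-η1 0 * 0 + (η2 0 + 2 * α) * u 0 ^ 2 / 2) / χ := by
      rw [mul_zero, zero_add]; positivity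
    linarith
  · have h1 := hu.cont.mono hI
    have h2 := hu.cont'.mono hI
    have c0 : Continuous η := continuous_iff_continuousAt.2 fun x => (hη x).continuousAt
    have c1 : Continuous η1 := continuous_iff_continuousAt.2 fun x => (hη1 x).continuousAt
    have c2 : Continuous η2 := continuous_iff_continuousAt.2 fun x => (hη2 x).continuousAt
    exact cw.continuousOn.mul (by fun_prop)
  · simp [hT, weight_one (show α + 1 ≠ 0 by linarith)]
  · have hx' : x ∈ Ioo (-1 : ℝ) 1 := ⟨by linarith [hx.1], hx.2⟩
    have hw := one_sub_sq_pos hx'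
    have h1 : HasDerivAt (fun x : ℝ => 1 - q * x ^ 2) (-(q * (2 * x))) x := by
      simpa using ((hasDerivAt_pow 2 x).const_mul q).const_sub 1
    have h2 : HasDerivAt (fun x : ℝ => 1 - x ^ 2) (-(2 * x)) x := by
      simpa using (hasDerivAt_pow 2 x).const_sub 1
    have h3 := hasDerivAt_id x
    have d := (hasDerivAt_weight_add_one α hx').mul
      (((hη x).mul ((h1.mul ((hu.deriv x hx').pow 2)).add
        ((h2.mul ((hu.deriv' x hx').pow 2)).div_const χ))).add
        ((((((h2.mul (hη1 x)).add ((h3.const_mul (2 * α)).mul (hη x))).neg.mul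
          (hu.deriv x hx')).mul (hu.deriv' x hx')).add
          ((((((h2.mul (hη2 x)).sub ((h3.const_mul 2).mul (hη1 x))).add
            ((hη x).const_mul (2 * α))).add ((h3.const_mul (2 * α)).mul (hη1 x))).mul
              ((hu.deriv x hx').pow 2)).div_const 2)).div_const χ))
    refine d.congr_deriv ?_
    simp only [Pi.pow_apply, Pi.mul_apply, Pi.add_apply, Pi.neg_apply, Pi.sub_apply, id,
      multiplierRate]
    rw [weight_add_one _ hx', hq]
    field_simp
    ring

/-! ### Certified nonnegativity of integer polynomials on the unit square -/

/-- The value at `t` of the univariate polynomial with coefficient list `l`, constant term first. -/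
def evalList : List ℤ → ℝ → ℝ
  | [], _ => 0
  | a :: l, t => a + t * evalList l t

/-- The coefficient list of a sum. -/
def addList : List ℤ → List ℤ → List ℤ
  | [], m => m
  | l, [] => l
  | a :: l, b :: m => (a + b) :: addList l m

/-- The coefficient list of an integer multiple. -/
def smulList (a : ℤ) (l : List ℤ) : List ℤ := l.map (a * ·)

/-- The coefficient list of a product. -/
def mulList : List ℤ → List ℤ → List ℤ
  | [], _ => []
  | a :: l, m => addList (smulList a m) (0 :: mulList l m)

theorem evalList_addList (l m : List ℤ) (t : ℝ) :
    evalList (addList l m) t = evalList l t + evalList m t := by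
  induction l, m using addList.induct with
  | case1 m => simp [addList, evalList]
  | case2 l _ => cases l <;> simp [addList, evalList]
  | case3 a l b m ih => simp only [addList, evalList, ih]; push_cast; ring

theorem evalList_smulList (a : ℤ) (l : List ℤ) (t : ℝ) :
    evalList (smulList a l) t = a * evalList l t := by
  induction l with
  | nil => simp [smulList, evalList]
  | cons b l ih =>
    simp only [smulList, List.map_cons, evalList] at ih ⊢
    rw [ih]; push_cast; ring

theorem evalList_mulList (l m : List ℤ) (t : ℝ) :
    evalList (mulList l m) t = evalList l t * evalList m t := by
  induction l with
  | nil => simp [mulList, evalList]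
  | cons a l ih =>
    simp only [mulList, evalList_addList, evalList_smulList, evalList, ih]; push_cast; ring

/-- The coefficients of `2 ^ d p (t / 2)`, where `p` has `d + 1` coefficients. -/
def halveList : List ℤ → List ℤ
  | [] => []
  | a :: l => (2 ^ l.length * a) :: halveList l

/-- The coefficients of `p (1 + t)`. -/
def shiftList : List ℤ → List ℤ
  | [] => []
  | a :: l => addList [a] (addList (shiftList l) (0 :: shiftList l))

theorem evalList_halveList (l : List ℤ) (t : ℝ) :
    2 * evalList (halveList l) t = 2 ^ l.length * evalList l (t / 2) := by
  induction l with
  | nil => simp [halveList, evalList]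
  | cons a l ih =>
    have : (2 : ℝ) * evalList (halveList (a :: l)) t =
        2 * (2 ^ l.length * a) + t * (2 * evalList (halveList l) t) := by
      simp only [halveList, evalList]; push_cast; ring
    rw [this, ih]
    simp only [evalList, List.length_cons, pow_succ]
    ring

theorem evalList_shiftList (l : List ℤ) (t : ℝ) :
    evalList (shiftList l) t = evalList l (1 + t) := by
  induction l with
  | nil => simp [shiftList, evalList]
  | cons a l ih => simp only [shiftList, evalList_addList, evalList, ih]; push_cast; ring

/-- All partial sums of `s + l₀ + l₁ + ⋯` are nonnegative. -/
def partialSumsNonneg : ℤ → List ℤ → Bool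
  | _, [] => true
  | s, a :: l => decide (0 ≤ s + a) && partialSumsNonneg (s + a) l

/-- A sufficient test for `p ≥ 0` on `[0, 1]`: the partial sums of the coefficients are nonnegative,
possibly after at most `n` successive bisections of the interval. -/
def nonnegList : ℕ → List ℤ → Bool
  | 0, l => partialSumsNonneg 0 l
  | n + 1, l => partialSumsNonneg 0 l ||
      (nonnegList n (halveList l) && nonnegList n (shiftList (halveList l)))

theorem evalList_nonneg_of_partialSums {l : List ℤ} {s : ℤ} (hs : 0 ≤ s)
    (h : partialSumsNonneg s l = true) {t : ℝ} (ht : t ∈ Icc (0 : ℝ) 1) :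
    0 ≤ s + t * evalList l t := by
  induction l generalizing s with
  | nil => simpa [evalList] using hs
  | cons a l ih =>
    simp only [partialSumsNonneg, Bool.and_eq_true, decide_eq_true_eq] at h
    have h1 := ih h.1 h.2
    have h2 : (0 : ℝ) ≤ s := by exact_mod_cast hs
    push_cast at h1
    -- Abel summation: `s + t p ≥ t (s + p)`
    have h3 : (s : ℝ) + t * evalList (a :: l) t = (1 - t) * s + t * (s + a + t * evalList l t) := by
      simp only [evalList]; ring
    rw [h3]
    exact add_nonneg (mul_nonneg (by linarith [ht.2]) h2) (mul_nonneg ht.1 h1)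

theorem evalList_nonneg_of_partialSums_zero {l : List ℤ} (h : partialSumsNonneg 0 l = true) {t : ℝ}
    (ht : t ∈ Icc (0 : ℝ) 1) : 0 ≤ evalList l t := by
  cases l with
  | nil => simp [evalList]
  | cons a l =>
    simp only [partialSumsNonneg, Bool.and_eq_true, decide_eq_true_eq, zero_add] at h
    exact evalList_nonneg_of_partialSums h.1 h.2 ht

theorem evalList_nonneg {n : ℕ} {l : List ℤ} (h : nonnegList n l = true) {t : ℝ}
    (ht : t ∈ Icc (0 : ℝ) 1) : 0 ≤ evalList l t := by
  induction n generalizing l t with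
  | zero => exact evalList_nonneg_of_partialSums_zero h ht
  | succ n ih =>
    simp only [nonnegList, Bool.or_eq_true, Bool.and_eq_true] at h
    rcases h with h | ⟨h1, h2⟩
    · exact evalList_nonneg_of_partialSums_zero h ht
    · have key : ∀ s : ℝ, 0 ≤ evalList (halveList l) s → 0 ≤ evalList l (s / 2) := by
        intro s hs
        have := evalList_halveList l s
        have h2 : (0 : ℝ) < 2 ^ l.length := by positivity
        by_contra! hneg
        nlinarith [mul_neg_of_pos_of_neg h2 hneg]
      rcases le_total t (1 / 2) with h3 | h3
      · have := key (2 * t) (ih h1 ⟨by linarith [ht.1], by linarith⟩)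
        rwa [mul_div_cancel_left₀ _ (two_ne_zero' ℝ)] at this
      · have h4 := ih h2 (t := 2 * t - 1) ⟨by linarith, by linarith [ht.2]⟩
        rw [evalList_shiftList] at h4
        have := key _ h4
        rwa [show (1 + (2 * t - 1)) / 2 = t by ring] at this

/-- An integer polynomial in `x` and `t`, as the list of its coefficients with respect to `x`, which
are coefficient lists in `t`. -/
structure BiPoly where
  coeffs : List (List ℤ)

namespace BiPoly

/-- Horner evaluation in `x` of a list of polynomials in `t`. -/
def evalCoeffs : List (List ℤ) → ℝ → ℝ → ℝ
  | [], _, _ => 0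
  | p :: L, x, t => evalList p t + x * evalCoeffs L x t

/-- The value at `(x, t)`. -/
def eval (P : BiPoly) (x t : ℝ) : ℝ := evalCoeffs P.coeffs x t

/-- The coefficients of a sum. -/
def addCoeffs : List (List ℤ) → List (List ℤ) → List (List ℤ)
  | [], M => M
  | L, [] => L
  | p :: L, r :: M => addList p r :: addCoeffs L M

/-- The coefficients of a product. -/
def mulCoeffs : List (List ℤ) → List (List ℤ) → List (List ℤ)
  | [], _ => []
  | p :: L, M => addCoeffs (M.map (mulList p)) ([] :: mulCoeffs L M)

instance : Add BiPoly := ⟨fun P R => ⟨addCoeffs P.coeffs R.coeffs⟩⟩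
instance : Mul BiPoly := ⟨fun P R => ⟨mulCoeffs P.coeffs R.coeffs⟩⟩
instance : Sub BiPoly := ⟨fun P R => ⟨addCoeffs P.coeffs (R.coeffs.map (smulList (-1)))⟩⟩
instance (n : ℕ) : OfNat BiPoly n := ⟨⟨[[(n : ℤ)]]⟩⟩

/-- The first variable. -/
def X : BiPoly := ⟨[[], [1]]⟩

/-- The second variable. -/
def Y : BiPoly := ⟨[[0, 1]]⟩

theorem evalCoeffs_addCoeffs (L M : List (List ℤ)) (x t : ℝ) :
    evalCoeffs (addCoeffs L M) x t = evalCoeffs L x t + evalCoeffs M x t := by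
  induction L, M using addCoeffs.induct with
  | case1 M => simp [addCoeffs, evalCoeffs]
  | case2 L _ => cases L <;> simp [addCoeffs, evalCoeffs]
  | case3 p L r M ih => simp only [addCoeffs, evalCoeffs, ih, evalList_addList]; ring

theorem evalCoeffs_map_mulList (p : List ℤ) (L : List (List ℤ)) (x t : ℝ) :
    evalCoeffs (L.map (mulList p)) x t = evalList p t * evalCoeffs L x t := by
  induction L with
  | nil => simp [evalCoeffs]
  | cons r L ih => simp only [List.map_cons, evalCoeffs, ih, evalList_mulList]; ring

theorem evalCoeffs_map_smulList (a : ℤ) (L : List (List ℤ)) (x t : ℝ) :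
    evalCoeffs (L.map (smulList a)) x t = a * evalCoeffs L x t := by
  induction L with
  | nil => simp [evalCoeffs]
  | cons r L ih => simp only [List.map_cons, evalCoeffs, ih, evalList_smulList]; ring

theorem evalCoeffs_mulCoeffs (L M : List (List ℤ)) (x t : ℝ) :
    evalCoeffs (mulCoeffs L M) x t = evalCoeffs L x t * evalCoeffs M x t := by
  induction L with
  | nil => simp [mulCoeffs, evalCoeffs]
  | cons p L ih =>
    simp only [mulCoeffs, evalCoeffs_addCoeffs, evalCoeffs_map_mulList, evalCoeffs, ih, evalList]
    ring

theorem eval_add (P R : BiPoly) (x t : ℝ) : (P + R).eval x t = P.eval x t + R.eval x t :=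
  evalCoeffs_addCoeffs _ _ _ _

theorem eval_mul (P R : BiPoly) (x t : ℝ) : (P * R).eval x t = P.eval x t * R.eval x t :=
  evalCoeffs_mulCoeffs _ _ _ _

theorem eval_sub (P R : BiPoly) (x t : ℝ) : (P - R).eval x t = P.eval x t - R.eval x t := by
  refine (evalCoeffs_addCoeffs _ _ _ _).trans ?_
  rw [evalCoeffs_map_smulList]
  simp only [eval]
  push_cast
  ring

theorem eval_ofNat (n : ℕ) (x t : ℝ) : (no_index (OfNat.ofNat n) : BiPoly).eval x t = n := by
  change ((n : ℤ) : ℝ) + t * 0 + x * 0 = n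
  push_cast
  ring

theorem eval_X (x t : ℝ) : X.eval x t = x := by simp [X, eval, evalCoeffs, evalList]

theorem eval_Y (x t : ℝ) : Y.eval x t = t := by simp [Y, eval, evalCoeffs, evalList]

/-- The coefficients of `2 ^ d P (x / 2, t)`, where `P` has `d + 1` coefficients in `x`. -/
def halveCoeffs : List (List ℤ) → List (List ℤ)
  | [] => []
  | p :: L => smulList (2 ^ L.length) p :: halveCoeffs L

/-- The coefficients of `P (1 + x, t)`. -/
def shiftCoeffs : List (List ℤ) → List (List ℤ)
  | [] => []
  | p :: L => addCoeffs [p] (addCoeffs (shiftCoeffs L) ([] :: shiftCoeffs L))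

theorem evalCoeffs_halveCoeffs (L : List (List ℤ)) (x t : ℝ) :
    2 * evalCoeffs (halveCoeffs L) x t = 2 ^ L.length * evalCoeffs L (x / 2) t := by
  induction L with
  | nil => simp [halveCoeffs, evalCoeffs]
  | cons p L ih =>
    have : (2 : ℝ) * evalCoeffs (halveCoeffs (p :: L)) x t =
        2 * (2 ^ L.length * evalList p t) + x * (2 * evalCoeffs (halveCoeffs L) x t) := by
      simp only [halveCoeffs, evalCoeffs, evalList_smulList]; push_cast; ring
    rw [this, ih]
    simp only [evalCoeffs, List.length_cons, pow_succ]
    ring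

theorem evalCoeffs_shiftCoeffs (L : List (List ℤ)) (x t : ℝ) :
    evalCoeffs (shiftCoeffs L) x t = evalCoeffs L (1 + x) t := by
  induction L with
  | nil => simp [shiftCoeffs, evalCoeffs]
  | cons p L ih =>
    simp only [shiftCoeffs, evalCoeffs_addCoeffs, evalCoeffs, ih, evalList]; ring

/-- All partial sums of the coefficients with respect to `x` pass the univariate test. -/
def partialSums : List ℤ → List (List ℤ) → Bool
  | _, [] => true
  | s, p :: L => nonnegList 6 (addList s p) && partialSums (addList s p) L

/-- A sufficient test for `P ≥ 0` on `[0, 1]²`, with at most `n` bisections in `x`. -/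
def nonneg : ℕ → List (List ℤ) → Bool
  | 0, L => partialSums [] L
  | n + 1, L => partialSums [] L ||
      (nonneg n (halveCoeffs L) && nonneg n (shiftCoeffs (halveCoeffs L)))

theorem evalCoeffs_nonneg_of_partialSums {L : List (List ℤ)} {s : List ℤ} {x t : ℝ}
    (hx : x ∈ Icc (0 : ℝ) 1) (ht : t ∈ Icc (0 : ℝ) 1) (hs : 0 ≤ evalList s t)
    (h : partialSums s L = true) : 0 ≤ evalList s t + x * evalCoeffs L x t := by
  induction L generalizing s with
  | nil => simpa [evalCoeffs] using hs
  | cons p L ih =>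
    simp only [partialSums, Bool.and_eq_true] at h
    have h1 := ih (evalList_nonneg h.1 ht) h.2
    rw [evalList_addList] at h1
    have h3 : evalList s t + x * evalCoeffs (p :: L) x t =
        (1 - x) * evalList s t + x * (evalList s t + evalList p t + x * evalCoeffs L x t) := by
      simp only [evalCoeffs]; ring
    rw [h3]
    exact add_nonneg (mul_nonneg (by linarith [hx.2]) hs) (mul_nonneg hx.1 h1)

theorem evalCoeffs_nonneg_of_partialSums_nil {L : List (List ℤ)} {x t : ℝ}
    (hx : x ∈ Icc (0 : ℝ) 1) (ht : t ∈ Icc (0 : ℝ) 1) (h : partialSums [] L = true) :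
    0 ≤ evalCoeffs L x t := by
  cases L with
  | nil => simp [evalCoeffs]
  | cons p L =>
    simp only [partialSums, Bool.and_eq_true, addList] at h
    exact evalCoeffs_nonneg_of_partialSums hx ht (evalList_nonneg h.1 ht) h.2

theorem evalCoeffs_nonneg {n : ℕ} {L : List (List ℤ)} {x t : ℝ} (hx : x ∈ Icc (0 : ℝ) 1)
    (ht : t ∈ Icc (0 : ℝ) 1) (h : nonneg n L = true) : 0 ≤ evalCoeffs L x t := by
  induction n generalizing L x with
  | zero => exact evalCoeffs_nonneg_of_partialSums_nil hx ht h
  | succ n ih =>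
    simp only [nonneg, Bool.or_eq_true, Bool.and_eq_true] at h
    rcases h with h | ⟨h1, h2⟩
    · exact evalCoeffs_nonneg_of_partialSums_nil hx ht h
    · have key : ∀ s : ℝ, 0 ≤ evalCoeffs (halveCoeffs L) s t → 0 ≤ evalCoeffs L (s / 2) t := by
        intro s hs
        have := evalCoeffs_halveCoeffs L s t
        have h2 : (0 : ℝ) < 2 ^ L.length := by positivity
        by_contra! hneg
        nlinarith [mul_neg_of_pos_of_neg h2 hneg]
      rcases le_total x (1 / 2) with h3 | h3
      · have := key (2 * x) (ih ⟨by linarith [hx.1], by linarith⟩ h1)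
        rwa [mul_div_cancel_left₀ _ (two_ne_zero' ℝ)] at this
      · have h4 := ih (x := 2 * x - 1) ⟨by linarith, by linarith [hx.2]⟩ h2
        rw [evalCoeffs_shiftCoeffs] at h4
        have := key _ h4
        rwa [show (1 + (2 * x - 1)) / 2 = x by ring] at this

theorem eval_nonneg (P : BiPoly) (h : nonneg 9 P.coeffs = true) {x t : ℝ}
    (hx : x ∈ Icc (0 : ℝ) 1) (ht : t ∈ Icc (0 : ℝ) 1) : 0 ≤ P.eval x t :=
  evalCoeffs_nonneg hx ht h

/-! ### The multiplier `1 - 9x/20 + 71x²/100 + 11x⁶/20` -/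

/-- The multiplier, scaled by `100`. -/
def e : BiPoly := 100 - 45 * X + 71 * (X * X) + 55 * (X * X * X * X * X * X)

/-- The first derivative of the multiplier, scaled by `100`. -/
def e1 : BiPoly := 142 * X + 330 * (X * X * X * X * X) - 45

/-- The second derivative of the multiplier, scaled by `100`. -/
def e2 : BiPoly := 142 + 1650 * (X * X * X * X)

/-- The third derivative of the multiplier, scaled by `100`. -/
def e3 : BiPoly := 6600 * (X * X * X)

/-- The polynomial `1 - x²`. -/
def w : BiPoly := 1 - X * X

/-- The integer form of the required inequality at `ε = 0`. Here `T / 1000` is the target for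
`q ψ(0)²`, the number `N / 100` is the point of tangency `q₀` for the bound
`1 / q ≥ 2 / q₀ - q / q₀²`, and `q` is scaled by `1000`. -/
def lowerEdge (T q N : BiPoly) : BiPoly :=
  1000 * T * (20 * N - q) - N * N * (1000 * (X * e - w * e1) +
    q * (X * e * (1 - 2 * X * X) + w * X * X * e1))

/-- The integer form of the required inequality at the largest admissible `ε`, with `d = 2 α`
and with `Q` scaled by `1000`. -/
def upperEdge (d T Q q N : BiPoly) : BiPoly :=
  Q * (d + 2) * lowerEdge T q N - 250 * N * N * (Q - q) *
    (d * (d + 2) * (X * e + X * X * e1) - 2 * d * e1 -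
      (w * w * e3 - 6 * X * w * e2 + (6 * X * X - 2) * e1))

/-- The target for `q (ψ(0)² + ψ'(0)² / χ)` when `α ≤ 1 / 2`, scaled by `1000`, with `t = 2 α`. -/
def smallT : BiPoly := 447 + 125 * (Y * Y) - 25 * Y

/-- The upper bound for `1 / C_α` when `α ≤ 1 / 2`, scaled by `1000`, with `t = 2 α`. -/
def smallQ : BiPoly := 838 + 165 * Y

-- For `0 ≤ α ≤ 1 / 2`, with `t = 2 α`: the windows `[0.6, 0.82]` and `[0.82, Q]` for `q`. The upper edge
-- condition at `q = Q` is the lower edge condition.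

theorem lowerEdge_nonneg_lowerWindow_left :
    nonneg 9 (lowerEdge smallT 600 71).coeffs = true := by decide +kernel

theorem lowerEdge_nonneg_lowerWindow_right :
    nonneg 9 (lowerEdge smallT 820 71).coeffs = true := by decide +kernel

theorem upperEdge_nonneg_lowerWindow_left :
    nonneg 9 (upperEdge Y smallT smallQ 600 71).coeffs = true := by decide +kernel

theorem upperEdge_nonneg_lowerWindow_right :
    nonneg 9 (upperEdge Y smallT smallQ 820 71).coeffs = true := by decide +kernel

theorem lowerEdge_nonneg_upperWindow_left :
    nonneg 9 (lowerEdge smallT 820 90).coeffs = true := by decide +kernel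

theorem upperEdge_nonneg_upperWindow_left :
    nonneg 9 (upperEdge Y smallT smallQ 820 90).coeffs = true := by decide +kernel

theorem lowerEdge_nonneg_upperWindow_right :
    nonneg 9 (lowerEdge smallT smallQ 90).coeffs = true := by decide +kernel

-- For `1 / 2 ≤ α ≤ 1`, with `t = 2 α - 1`, `Q = 1` and the target `0.38 (1 + α)`: the window `[0.72, 1]`.

theorem lowerEdge_nonneg_medium_left :
    nonneg 9 (lowerEdge (190 * (3 + Y)) 720 86).coeffs = true := by decide +kernel

theorem lowerEdge_nonneg_medium_right :
    nonneg 9 (lowerEdge (190 * (3 + Y)) 1000 86).coeffs = true := by decide +kernel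

theorem upperEdge_nonneg_medium_left :
    nonneg 9 (upperEdge (1 + Y) (190 * (3 + Y)) 1000 720 86).coeffs = true := by decide +kernel

end BiPoly

/-! ### The refined bound for `q (ψ(0)² + ψ'(0)² / χ)` -/

/-- The multiplier; `BiPoly.e` is its integer form. -/
noncomputable def eta (x : ℝ) : ℝ := 1 - 9 / 20 * x + 71 / 100 * x ^ 2 + 11 / 20 * x ^ 6

/-- The part of the rate for `eta` that is independent of `q` and `ε`. -/
noncomputable def rateA (x : ℝ) : ℝ := x * eta x - (1 - x ^ 2) * (-9 / 20 + 71 / 50 * x + 33 / 10 * x ^ 5)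

/-- The coefficient of `q` in the rate for `eta`. -/
noncomputable def rateB (x : ℝ) : ℝ :=
  x * eta x * (1 - 2 * x ^ 2) + (1 - x ^ 2) * x ^ 2 * (-9 / 20 + 71 / 50 * x + 33 / 10 * x ^ 5)

/-- The coefficient of `ε` in the rate for `eta`. -/
noncomputable def rateE (α x : ℝ) : ℝ :=
  α * (α + 1) * (x * eta x + x ^ 2 * (-9 / 20 + 71 / 50 * x + 33 / 10 * x ^ 5)) -
    α * (-9 / 20 + 71 / 50 * x + 33 / 10 * x ^ 5) -
    ((1 - x ^ 2) ^ 2 * (66 * x ^ 3) - 6 * x * (1 - x ^ 2) * (71 / 50 + 33 / 2 * x ^ 4) +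
      (6 * x ^ 2 - 2) * (-9 / 20 + 71 / 50 * x + 33 / 10 * x ^ 5)) / 4

theorem multiplierRate_eta (α q ε x : ℝ) :
    multiplierRate α q ε x (eta x) (-9 / 20 + 71 / 50 * x + 33 / 10 * x ^ 5)
      (71 / 50 + 33 / 2 * x ^ 4) (66 * x ^ 3) = rateA x + q * rateB x + ε * rateE α x := by
  simp only [multiplierRate, rateA, rateB, rateE]
  ring

theorem eval_lowerEdge (T q N : BiPoly) (x t : ℝ) :
    (BiPoly.lowerEdge T q N).eval x t = 1000 * T.eval x t * (20 * N.eval x t - q.eval x t) -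
      N.eval x t ^ 2 * (100000 * rateA x + 100 * q.eval x t * rateB x) := by
  simp only [BiPoly.lowerEdge, BiPoly.e, BiPoly.e1, BiPoly.w, BiPoly.eval_add, BiPoly.eval_sub,
    BiPoly.eval_mul, BiPoly.eval_ofNat, BiPoly.eval_X, rateA, rateB, eta]
  norm_num
  ring

theorem eval_upperEdge (d T Q q N : BiPoly) (x t : ℝ) :
    (BiPoly.upperEdge d T Q q N).eval x t = Q.eval x t * (d.eval x t + 2) *
      (BiPoly.lowerEdge T q N).eval x t - 100000 * N.eval x t ^ 2 * (Q.eval x t - q.eval x t) *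
        rateE (d.eval x t / 2) x := by
  simp only [BiPoly.upperEdge, BiPoly.e, BiPoly.e1, BiPoly.e2, BiPoly.e3, BiPoly.w,
    BiPoly.eval_add, BiPoly.eval_sub, BiPoly.eval_mul, BiPoly.eval_ofNat, BiPoly.eval_X, rateE, eta]
  norm_num
  ring

/-- A bound for the rate on a window `[q₁, q₂]`. For a point of tangency `q₀`, the inequality
`T / q ≥ T (2 / q₀ - q / q₀²)` makes the required bound affine in `(q, ε)`, so that it only has to
be verified at the vertices of the region `q₁ ≤ q ≤ q₂`, `0 ≤ ε`, `q ≤ Q (1 - d ε)`. -/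
theorem mul_affine_le_of_vertices {T q0 q1 q2 Q d a b k q ε : ℝ} (hT : 0 ≤ T) (hq0 : 0 < q0)
    (h12 : q1 < q2) (hq1 : 0 < q1) (hQ : 0 < Q) (hd : 0 < d) (hε : 0 ≤ ε)
    (hl1 : q0 ^ 2 * (a + q1 * b) ≤ T * (2 * q0 - q1))
    (hl2 : q0 ^ 2 * (a + q2 * b) ≤ T * (2 * q0 - q2))
    (hu1 : q0 ^ 2 * (Q - q1) * k ≤ Q * d * (T * (2 * q0 - q1) - q0 ^ 2 * (a + q1 * b)))
    (hu2 : q0 ^ 2 * (Q - q2) * k ≤ Q * d * (T * (2 * q0 - q2) - q0 ^ 2 * (a + q2 * b)))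
    (hq : q ∈ Icc q1 q2) (hs : q ≤ Q * (1 - d * ε)) :
    q * (a + q * b + ε * k) ≤ T := by
  have hqq : 0 < q := hq1.trans_le hq.1
  have key : q0 ^ 2 * (a + q * b + ε * k) ≤ T * (2 * q0 - q) := by
    have hl : q0 ^ 2 * (a + q * b) ≤ T * (2 * q0 - q) := by
      have h1 := mul_le_mul_of_nonneg_left hl1 (sub_nonneg.2 hq.2)
      have h2 := mul_le_mul_of_nonneg_left hl2 (sub_nonneg.2 hq.1)
      have : 0 < q2 - q1 := sub_pos.2 h12
      nlinarith
    have hu : q0 ^ 2 * (Q - q) * k ≤ Q * d * (T * (2 * q0 - q) - q0 ^ 2 * (a + q * b)) := by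
      have h1 := mul_le_mul_of_nonneg_left hu1 (sub_nonneg.2 hq.2)
      have h2 := mul_le_mul_of_nonneg_left hu2 (sub_nonneg.2 hq.1)
      have : 0 < q2 - q1 := sub_pos.2 h12
      have h3 := add_le_add h1 h2
      refine le_of_mul_le_mul_left ?_ this
      linarith
    rcases le_total k 0 with hk | hk
    · have : q0 ^ 2 * (ε * k) ≤ 0 :=
        mul_nonpos_of_nonneg_of_nonpos (sq_nonneg _) (mul_nonpos_of_nonneg_of_nonpos hε hk)
      linarith
    · have h1 : Q * d * ε ≤ Q - q := by linarith
      have h2 : q0 ^ 2 * (Q * d * ε) * k ≤ q0 ^ 2 * (Q - q) * k := by gcongr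
      have h3 : Q * d * (q0 ^ 2 * (ε * k)) ≤
          Q * d * (T * (2 * q0 - q) - q0 ^ 2 * (a + q * b)) := by linarith
      have := le_of_mul_le_mul_left h3 (by positivity)
      linarith
  have h1 := mul_le_mul_of_nonneg_left key hqq.le
  have h2 : q * (T * (2 * q0 - q)) ≤ q0 ^ 2 * T := by nlinarith [mul_nonneg hT (sq_nonneg (q - q0))]
  refine le_of_mul_le_mul_left (a := q0 ^ 2) ?_ (by positivity)
  linarith

/-- The discriminant condition for a cubic; the extremal case has a double zero at `√(P / 3)`. -/
theorem cube_sub_nonneg {P R z : ℝ} (hP : 0 ≤ P) (hR : 0 ≤ R) (hz : 0 ≤ z)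
    (h : 4 * P ^ 3 ≤ 27 * R ^ 2) : 0 ≤ z ^ 3 - P * z + R := by
  obtain ⟨s, hs, hsP⟩ : ∃ s : ℝ, 0 ≤ s ∧ P = 3 * s ^ 2 :=
    ⟨√(P / 3), Real.sqrt_nonneg _, by rw [Real.sq_sqrt (by linarith)]; ring⟩
  subst hsP
  have h1 : 2 * s ^ 3 ≤ R := abs_le_of_sq_le_sq' (by nlinarith) hR |>.2
  have h2 : z ^ 3 - 3 * s ^ 2 * z + 2 * s ^ 3 = (z - s) ^ 2 * (z + 2 * s) := by ring
  have h3 : 0 ≤ (z - s) ^ 2 * (z + 2 * s) := by positivity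
  linarith

/-- The bound obtained from the constant multiplier, where the rate is a cubic polynomial in `x`. -/
theorem mul_multiplierRate_one_le {α q ε x A T : ℝ} (hq : 0 < q) (hx : 0 ≤ x) (hT : 0 ≤ T)
    (hA : 1 + q + ε * (α * (α + 1)) ≤ A) (hA0 : 0 ≤ A) (h : 2 * A ^ 3 * q ≤ 27 * T ^ 2) :
    q * multiplierRate α q ε x 1 0 0 0 ≤ T := by
  have h1 : q * multiplierRate α q ε x 1 0 0 0 =
      q * x * (1 + q + ε * (α * (α + 1))) - 2 * q ^ 2 * x ^ 3 := by
    simp only [multiplierRate]; ring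
  have h2 := cube_sub_nonneg (P := A / (2 * q)) (R := T / (2 * q ^ 2)) (by positivity)
    (by positivity) hx (by
      rw [div_pow, div_pow, ← sub_nonneg]
      have : 27 * (T ^ 2 / (2 * q ^ 2) ^ 2) - 4 * (A ^ 3 / (2 * q) ^ 3) =
        (27 * T ^ 2 - 2 * A ^ 3 * q) / (4 * q ^ 4) := by field_simp; ring
      rw [this]
      exact div_nonneg (by linarith) (by positivity))
  have h3 : x ^ 3 - A / (2 * q) * x + T / (2 * q ^ 2) =
      (2 * q ^ 2 * x ^ 3 - q * x * A + T) / (2 * q ^ 2) := by field_simp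
  rw [h3] at h2
  have h4 : 0 ≤ 2 * q ^ 2 * x ^ 3 - q * x * A + T := by
    have := mul_nonneg h2 (by positivity : 0 ≤ 2 * q ^ 2)
    rwa [div_mul_cancel₀ _ (by positivity)] at this
  rw [h1]
  have : q * x * (1 + q + ε * (α * (α + 1))) ≤ q * x * A := by gcongr
  linarith

/-- The target for `q (ψ(0)² + ψ'(0)² / χ)` when `α ≤ 1 / 2`. -/
noncomputable def smallTarget (α : ℝ) : ℝ := 447 / 1000 - α / 20 + α ^ 2 / 2

/-- An upper bound for `1 / C_α` when `α ≤ 1 / 2`. -/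
noncomputable def smallRatio (α : ℝ) : ℝ := 419 / 500 + 33 / 100 * α

/-- The condition `hs` is what `2 α + 2 + C_α c² ≤ χ` says about `q` and `ε = 1 / χ`. -/
theorem mul_multiplierRate_eta_le_small {α q ε x : ℝ} (hα : α ∈ Icc (0 : ℝ) (1 / 2))
    (hε : 0 ≤ ε) (hq : 3 / 5 ≤ q) (hs : q ≤ smallRatio α * (1 - (2 * α + 2) * ε))
    (hx : x ∈ Icc (0 : ℝ) 1) :
    q * (rateA x + q * rateB x + ε * rateE α x) ≤ smallTarget α := by
  have ht : 2 * α ∈ Icc (0 : ℝ) 1 := ⟨by linarith [hα.1], by linarith [hα.2]⟩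
  have hα0 := hα.1
  have hT : 0 ≤ smallTarget α := by unfold smallTarget; nlinarith [hα.1, hα.2]
  have hQ : 0 < smallRatio α := by unfold smallRatio; positivity
  have hqQ : q ≤ smallRatio α := by
    have : 0 ≤ smallRatio α * ((2 * α + 2) * ε) := by positivity
    linarith
  have l1 := BiPoly.eval_nonneg _ BiPoly.lowerEdge_nonneg_lowerWindow_left hx ht
  have l2 := BiPoly.eval_nonneg _ BiPoly.lowerEdge_nonneg_lowerWindow_right hx ht
  have l3 := BiPoly.eval_nonneg _ BiPoly.lowerEdge_nonneg_upperWindow_left hx ht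
  have l4 := BiPoly.eval_nonneg _ BiPoly.lowerEdge_nonneg_upperWindow_right hx ht
  have u1 := BiPoly.eval_nonneg _ BiPoly.upperEdge_nonneg_lowerWindow_left hx ht
  have u2 := BiPoly.eval_nonneg _ BiPoly.upperEdge_nonneg_lowerWindow_right hx ht
  have u3 := BiPoly.eval_nonneg _ BiPoly.upperEdge_nonneg_upperWindow_left hx ht
  simp only [eval_upperEdge, eval_lowerEdge, BiPoly.smallT, BiPoly.smallQ, BiPoly.eval_add,
    BiPoly.eval_sub, BiPoly.eval_mul, BiPoly.eval_ofNat, BiPoly.eval_Y] at l1 l2 l3 l4 u1 u2 u3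
  norm_num at l1 l2 l3 l4 u1 u2 u3
  rcases le_total q (41 / 50) with h | h
  · apply mul_affine_le_of_vertices (q0 := 71 / 100) (q1 := 3 / 5) (q2 := 41 / 50)
      (Q := smallRatio α) (d := 2 * α + 2) hT (by norm_num) (by norm_num) (by norm_num) hQ
      (by linarith) hε _ _ _ _ ⟨hq, h⟩ hs <;> simp only [smallTarget, smallRatio]
    · linarith
    · linarith
    · linarith
    · linarith
  · have h' : 41 / 50 < smallRatio α := by unfold smallRatio; linarith
    apply mul_affine_le_of_vertices (q0 := 9 / 10) (q1 := 41 / 50) (q2 := smallRatio α)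
      (Q := smallRatio α) (d := 2 * α + 2) hT (by norm_num) h' (by norm_num) hQ
      (by linarith) hε _ _ _ _ ⟨h, hqQ⟩ hs <;> simp only [smallTarget, smallRatio] at ⊢
    · linarith
    · linarith
    · linarith
    · rw [sub_self, mul_zero, zero_mul]
      apply mul_nonneg (by positivity)
      linarith
theorem mul_multiplierRate_eta_le_medium {α q ε x : ℝ} (hα : α ∈ Icc (1 / 2 : ℝ) 1)
    (hε : 0 ≤ ε) (hq : 18 / 25 ≤ q) (hs : q ≤ 1 - (2 * α + 2) * ε) (hx : x ∈ Icc (0 : ℝ) 1) :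
    q * (rateA x + q * rateB x + ε * rateE α x) ≤ 19 / 50 * (1 + α) := by
  have ht : 2 * α - 1 ∈ Icc (0 : ℝ) 1 := ⟨by linarith [hα.1], by linarith [hα.2]⟩
  have hα0 : 0 ≤ α := by linarith [hα.1]
  have hq1 : q ≤ 1 := by
    have : 0 ≤ (2 * α + 2) * ε := by positivity
    linarith
  have l1 := BiPoly.eval_nonneg _ BiPoly.lowerEdge_nonneg_medium_left hx ht
  have l2 := BiPoly.eval_nonneg _ BiPoly.lowerEdge_nonneg_medium_right hx ht
  have u1 := BiPoly.eval_nonneg _ BiPoly.upperEdge_nonneg_medium_left hx ht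
  simp only [eval_upperEdge, eval_lowerEdge, BiPoly.eval_add, BiPoly.eval_mul,
    BiPoly.eval_ofNat, BiPoly.eval_Y] at l1 l2 u1
  norm_num at l1 l2 u1
  apply mul_affine_le_of_vertices (q0 := 43 / 50) (q1 := 18 / 25) (q2 := 1) (Q := 1)
    (d := 2 * α + 2) (by positivity) (by norm_num) (by norm_num) (by norm_num) one_pos
    (by linarith) hε _ _ _ _ ⟨hq, hq1⟩ (by linarith)
  · linarith
  · linarith
  · linarith
  · rw [sub_self, mul_zero, zero_mul]
    apply mul_nonneg (by positivity)
    linarith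

/-- The multiplier estimate as a bound for `q (ψ(0)² + ψ'(0)² / χ)`. -/
theorem IsSolution.mul_initial_le {α c χ q T : ℝ} (hα : 0 ≤ α) (hχ : 0 < χ) (hq0 : 0 < q)
    (hq : c ^ 2 = q * χ) {φ φ' : ℝ → ℝ} (h : IsSolution α c χ φ φ')
    (hn : ∫ x in (-1 : ℝ)..1, φ x ^ 2 * weight α x = 1) {η η1 η2 η3 : ℝ → ℝ}
    (hη : ∀ x, HasDerivAt η (η1 x) x) (hη1 : ∀ x, HasDerivAt η1 (η2 x) x)
    (hη2 : ∀ x, HasDerivAt η2 (η3 x) x) (h0 : η 0 = 1) (h20 : 0 ≤ η2 0)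
    (hK : ∀ x ∈ Icc (0 : ℝ) 1,
      q * multiplierRate α q χ⁻¹ x (η x) (η1 x) (η2 x) (η3 x) ≤ T) :
    q * (φ 0 ^ 2 + φ' 0 ^ 2 / χ) ≤ T := by
  have := h.initial_le_of_multiplier hα hχ hq hn hη hη1 hη2 h0 h20 (K := T / q) fun x hx => by
    rw [le_div_iff₀' hq0]
    exact hK x hx
  rwa [le_div_iff₀' hq0] at this

theorem IsSolution.mul_initial_le_of_eta {α c χ q T : ℝ} (hα : 0 ≤ α) (hχ : 0 < χ) (hq0 : 0 < q)
    (hq : c ^ 2 = q * χ) {φ φ' : ℝ → ℝ} (h : IsSolution α c χ φ φ')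
    (hn : ∫ x in (-1 : ℝ)..1, φ x ^ 2 * weight α x = 1)
    (hK : ∀ x ∈ Icc (0 : ℝ) 1, q * (rateA x + q * rateB x + χ⁻¹ * rateE α x) ≤ T) :
    q * (φ 0 ^ 2 + φ' 0 ^ 2 / χ) ≤ T := by
  refine h.mul_initial_le hα hχ hq0 hq hn (η := eta)
    (η1 := fun x => -9 / 20 + 71 / 50 * x + 33 / 10 * x ^ 5) (η2 := fun x => 71 / 50 + 33 / 2 * x ^ 4)
    (η3 := fun x => 66 * x ^ 3) (fun x => ?_) (fun x => ?_) (fun x => ?_) (by norm_num [eta])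
    (by norm_num) fun x hx => by simpa only [multiplierRate_eta] using hK x hx
  · refine HasDerivAt.congr_deriv (((((hasDerivAt_id x).const_mul (9 / 20)).const_sub 1).add
      ((hasDerivAt_pow 2 x).const_mul (71 / 100))).add
      ((hasDerivAt_pow 6 x).const_mul (11 / 20))) ?_
    norm_num
    ring
  · refine HasDerivAt.congr_deriv ((((hasDerivAt_id x).const_mul (71 / 50)).const_add (-9 / 20)).add
      ((hasDerivAt_pow 5 x).const_mul (33 / 10))) ?_
    norm_num
    ring
  · refine HasDerivAt.congr_deriv (((hasDerivAt_pow 4 x).const_mul (33 / 2)).const_add (71 / 50)) ?_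
    norm_num
    ring

theorem IsSolution.mul_initial_le_of_one {α c χ q A T : ℝ} (hα : 0 ≤ α) (hχ : 0 < χ) (hq0 : 0 < q)
    (hq : c ^ 2 = q * χ) {φ φ' : ℝ → ℝ} (h : IsSolution α c χ φ φ')
    (hn : ∫ x in (-1 : ℝ)..1, φ x ^ 2 * weight α x = 1) (hT : 0 ≤ T)
    (hA : 1 + q + χ⁻¹ * (α * (α + 1)) ≤ A) (h2 : 2 * A ^ 3 * q ≤ 27 * T ^ 2) :
    q * (φ 0 ^ 2 + φ' 0 ^ 2 / χ) ≤ T :=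
  h.mul_initial_le hα hχ hq0 hq hn (η := fun _ => 1) (η1 := fun _ => 0) (η2 := fun _ => 0)
    (η3 := fun _ => 0) (fun x => hasDerivAt_const x _) (fun x => hasDerivAt_const x _)
    (fun x => hasDerivAt_const x _) rfl le_rfl fun _ hx =>
      mul_multiplierRate_one_le hq0 hx.1 hT hA (le_trans (by positivity) hA) h2

theorem IsSolution.mul_initial_le_small {α c χ q : ℝ} (hα : α ∈ Icc (0 : ℝ) (1 / 2)) (hχ : 0 < χ)
    (hq0 : 0 < q) (hq : c ^ 2 = q * χ) {φ φ' : ℝ → ℝ} (h : IsSolution α c χ φ φ')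
    (hn : ∫ x in (-1 : ℝ)..1, φ x ^ 2 * weight α x = 1)
    (hs : q ≤ smallRatio α * (1 - (2 * α + 2) * χ⁻¹)) (hs' : q ≤ 1 - (2 * α + 2) * χ⁻¹) :
    q * (φ 0 ^ 2 + φ' 0 ^ 2 / χ) ≤ smallTarget α := by
  obtain ⟨h0, h1⟩ := hα
  rcases le_total q (3 / 5) with h2 | h2
  · have hT : 49 / 110 ≤ smallTarget α := by
      unfold smallTarget; nlinarith [sq_nonneg (α - 1 / 20)]
    -- `1 + q + α (α + 1) / χ ≤ 1 + q + α (1 - q) / 2`, which increases with `q`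
    refine h.mul_initial_le_of_one h0 hχ hq0 hq hn (A := 8 / 5 + α / 5) (by linarith) ?_ ?_
    · nlinarith
    · have h3 : 2 * (8 / 5 + α / 5) ^ 3 * q ≤ 2 * (8 / 5 + α / 5) ^ 3 * (3 / 5) := by gcongr
      refine h3.trans ?_
      unfold smallTarget
      have h5 : 0 ≤ α ^ 2 * (1 / 2 - α) := mul_nonneg (sq_nonneg _) (by linarith)
      nlinarith [sq_nonneg (α - 1 / 5), sq_nonneg (α ^ 2 - 1 / 20 * α), mul_nonneg h0 (sub_nonneg.2 h1)]
  · exact h.mul_initial_le_of_eta h0 hχ hq0 hq hn fun x hx =>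
      mul_multiplierRate_eta_le_small ⟨h0, h1⟩ (by positivity) h2 hs hx

theorem IsSolution.mul_initial_le_medium {α c χ q : ℝ} (hα : α ∈ Icc (1 / 2 : ℝ) 1) (hχ : 0 < χ)
    (hq0 : 0 < q) (hq : c ^ 2 = q * χ) {φ φ' : ℝ → ℝ} (h : IsSolution α c χ φ φ')
    (hn : ∫ x in (-1 : ℝ)..1, φ x ^ 2 * weight α x = 1) (hs : q ≤ 1 - (2 * α + 2) * χ⁻¹) :
    q * (φ 0 ^ 2 + φ' 0 ^ 2 / χ) ≤ 19 / 50 * (1 + α) := by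
  obtain ⟨h0, h1⟩ := hα
  rcases le_total q (18 / 25) with h2 | h2
  -- `1 + q + α (α + 1) / χ ≤ 1 + q + α (1 - q) / 2`, which increases with `q`
  · refine h.mul_initial_le_of_one (by linarith) hχ hq0 hq hn (A := 43 / 25 + 7 / 50 * α)
      (by linarith) ?_ ?_
    · nlinarith
    · have h3 : 2 * (43 / 25 + 7 / 50 * α) ^ 3 * q ≤ 2 * (43 / 25 + 7 / 50 * α) ^ 3 * (18 / 25) := by
        gcongr
      refine h3.trans ?_
      nlinarith [mul_nonneg (sub_nonneg.2 h0) (sub_nonneg.2 h1),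
        mul_nonneg (mul_nonneg (sub_nonneg.2 h0) (sub_nonneg.2 h1)) (by linarith : 0 ≤ α)]
  · exact h.mul_initial_le_of_eta (by linarith) hχ hq0 hq hn fun x hx =>
      mul_multiplierRate_eta_le_medium ⟨h0, h1⟩ (by positivity) h2 hs hx

theorem IsSolution.mul_initial_le_large {α c χ q : ℝ} (hα : α ∈ Icc (1 : ℝ) 2) (hχ : 0 < χ)
    (hq0 : 0 < q) (hq : c ^ 2 = q * χ) {φ φ' : ℝ → ℝ} (h : IsSolution α c χ φ φ')
    (hn : ∫ x in (-1 : ℝ)..1, φ x ^ 2 * weight α x = 1) (hs : q ≤ 1 - (2 * α + 2) * χ⁻¹) :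
    q * (φ 0 ^ 2 + φ' 0 ^ 2 / χ) ≤ 77 / 100 := by
  obtain ⟨h0, h1⟩ := hα
  have : 0 < χ⁻¹ := by positivity
  have hq1 : q ≤ 1 := by nlinarith
  exact h.mul_initial_le_of_one (by linarith) hχ hq0 hq hn (A := 2) (by norm_num) (by nlinarith)
    (by linarith)

/-! ### The total mass of the weight -/

/-- The total mass of the weight. -/
noncomputable def mass (α : ℝ) : ℝ := ∫ x in (-1 : ℝ)..1, weight α x

theorem four_rpow (α : ℝ) : (4 : ℝ) ^ α = 2 ^ (2 * α) := by
  rw [Real.rpow_mul two_pos.le]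
  norm_num

/-- The substitution `x = 2 t - 1` gives a Beta integral, to which Legendre's duplication formula
applies. -/
theorem mass_eq {α : ℝ} (hα : 0 ≤ α) :
    mass α = √Real.pi * Real.Gamma (α + 1) / Real.Gamma (α + 3 / 2) := by
  have hB := ProbabilityTheory.beta_eq_betaIntegralReal (α + 1) (α + 1) (by linarith) (by linarith)
  have hI : Complex.betaIntegral ((α + 1 : ℝ) : ℂ) ((α + 1 : ℝ) : ℂ) =
      ((∫ t in (0 : ℝ)..1, t ^ α * (1 - t) ^ α : ℝ) : ℂ) := by
    rw [Complex.betaIntegral, ← intervalIntegral.integral_ofReal]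
    refine integral_congr fun t ht => ?_
    rw [uIcc_of_le zero_le_one] at ht
    simp only [Complex.ofReal_mul]
    rw [Complex.ofReal_cpow ht.1, Complex.ofReal_cpow (by linarith [ht.2])]
    push_cast
    simp
  rw [hI, Complex.ofReal_re] at hB
  have hsub : mass α = 2 * 4 ^ α * ∫ t in (0 : ℝ)..1, t ^ α * (1 - t) ^ α := by
    have h1 := integral_comp_mul_sub (f := weight α) (a := 0) (b := 1) (two_ne_zero' ℝ) 1
    rw [show (2 : ℝ) * 0 - 1 = -1 by norm_num, show (2 : ℝ) * 1 - 1 = 1 by norm_num,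
      smul_eq_mul] at h1
    have h2 : ∫ x in (0 : ℝ)..1, weight α (2 * x - 1) =
        ∫ x in (0 : ℝ)..1, 4 ^ α * (x ^ α * (1 - x) ^ α) := by
      refine integral_congr fun t ht => ?_
      rw [uIcc_of_le zero_le_one] at ht
      simp only [weight]
      rw [← Real.mul_rpow ht.1 (by linarith [ht.2]),
        ← Real.mul_rpow (by norm_num) (mul_nonneg ht.1 (by linarith [ht.2]))]
      congr 1
      ring
    rw [h2, intervalIntegral.integral_const_mul] at h1
    rw [mass]
    linarith
  have hd := Real.Gamma_mul_Gamma_add_half (α + 1)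
  rw [show α + 1 + 1 / 2 = α + 3 / 2 by ring] at hd
  rw [hsub, ← hB, ProbabilityTheory.beta, show α + 1 + (α + 1) = 2 * (α + 1) by ring]
  have g1 : 0 < Real.Gamma (α + 3 / 2) := Real.Gamma_pos_of_pos (by linarith)
  have g2 : 0 < Real.Gamma (2 * (α + 1)) := Real.Gamma_pos_of_pos (by linarith)
  have hp : (2 : ℝ) * 4 ^ α * 2 ^ (1 - 2 * (α + 1)) = 1 := by
    rw [four_rpow, mul_assoc, ← Real.rpow_add two_pos,
      show 2 * α + (1 - 2 * (α + 1)) = -1 by ring, Real.rpow_neg_one]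
    norm_num
  rw [mul_div_assoc', div_eq_div_iff g2.ne' g1.ne']
  calc 2 * 4 ^ α * (Real.Gamma (α + 1) * Real.Gamma (α + 1)) * Real.Gamma (α + 3 / 2)
      = 2 * 4 ^ α * Real.Gamma (α + 1) * (Real.Gamma (α + 1) * Real.Gamma (α + 3 / 2)) := by ring
    _ = (2 * 4 ^ α * 2 ^ (1 - 2 * (α + 1))) *
        (√Real.pi * Real.Gamma (α + 1) * Real.Gamma (2 * (α + 1))) := by rw [hd]; ring
    _ = _ := by rw [hp, one_mul]

theorem mass_pos {α : ℝ} (hα : 0 ≤ α) : 0 < mass α := by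
  rw [mass_eq hα]
  have g1 : 0 < Real.Gamma (α + 3 / 2) := Real.Gamma_pos_of_pos (by linarith)
  have g2 : 0 < Real.Gamma (α + 1) := Real.Gamma_pos_of_pos (by linarith)
  have := Real.pi_pos
  positivity

theorem mass_mul_mass_add_half {α : ℝ} (hα : 0 ≤ α) :
    mass α * mass (α + 1 / 2) = Real.pi / (α + 1) := by
  have g1 : 0 < Real.Gamma (α + 3 / 2) := Real.Gamma_pos_of_pos (by linarith)
  have g2 : 0 < Real.Gamma (α + 1) := Real.Gamma_pos_of_pos (by linarith)
  have h1 := Real.Gamma_add_one (s := α + 1) (by linarith)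
  have h2 := Real.mul_self_sqrt Real.pi_pos.le
  rw [mass_eq hα, mass_eq (by linarith), show α + 1 / 2 + 1 = α + 3 / 2 by ring,
    show α + 1 / 2 + 3 / 2 = α + 1 + 1 by ring, h1]
  field_simp
  linarith

/-- Convexity of `p ↦ (1 - x²)^p` between `p = 1 / 2` and `p = 1`. -/
theorem mass_add_half_le {α : ℝ} (hα : α ∈ Icc (0 : ℝ) (1 / 2)) :
    mass (α + 1 / 2) ≤ Real.pi / 2 - (Real.pi - 8 / 3) * α := by
  obtain ⟨h0, h1⟩ := hα
  have hs : mass (1 / 2) = Real.pi / 2 := by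
    rw [← integral_sqrt_one_sub_sq, mass]
    simp only [weight, Real.sqrt_eq_rpow]
  have h1' : ∫ x in (-1 : ℝ)..1, (1 - x ^ 2) = 4 / 3 := by
    rw [intervalIntegral.integral_sub (by simp) (by simp)]
    norm_num
  have : mass (α + 1 / 2) ≤
      ∫ x in (-1 : ℝ)..1, ((1 - 2 * α) * weight (1 / 2) x + 2 * α * (1 - x ^ 2)) := by
    refine integral_mono_on (by norm_num)
      ((continuous_weight (by linarith)).intervalIntegrable _ _)
      (Continuous.intervalIntegrable (((continuous_weight (by norm_num)).const_mul _).add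
        (by fun_prop)) _ _) fun x hx => ?_
    have hw := one_sub_sq_nonneg hx
    have := Real.geom_mean_le_arith_mean2_weighted (by linarith : 0 ≤ 1 - 2 * α)
      (by linarith : 0 ≤ 2 * α) (weight_nonneg (1 / 2) hx) hw (by ring)
    refine le_of_eq_of_le ?_ this
    rw [weight, weight, ← Real.rpow_mul hw, ← Real.rpow_add_of_nonneg hw (by linarith) (by linarith)]
    congr 1
    ring
  refine this.trans_eq ?_
  rw [intervalIntegral.integral_add
    (((continuous_weight (by norm_num)).const_mul _).intervalIntegrable _ _)
    (Continuous.intervalIntegrable (by fun_prop) _ _), intervalIntegral.integral_const_mul,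
    intervalIntegral.integral_const_mul, h1']
  change (1 - 2 * α) * mass (1 / 2) + _ = _
  rw [hs]
  ring

/-! ### The square of the leading coefficients of the Jacobi polynomials -/

/-- The square of the off-diagonal entry of the Jacobi matrix of the weight. -/
noncomputable def jacobiSq (α : ℝ) (k : ℕ) : ℝ :=
  k * (k + 2 * α) / ((2 * k + 2 * α - 1) * (2 * k + 2 * α + 1))

/-- The square of the leading coefficient of the orthonormal polynomial of degree `k`, divided by
`4 ^ k`. -/
noncomputable def leadingSq (α : ℝ) (k : ℕ) : ℝ :=
  1 / (mass α * ∏ i ∈ Finset.range k, (4 * jacobiSq α (i + 1)))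

theorem jacobiSq_succ (α : ℝ) (k : ℕ) :
    jacobiSq α (k + 1) = (k + 1) * (k + 1 + 2 * α) / ((2 * k + 2 * α + 1) * (2 * k + 2 * α + 3)) := by
  simp only [jacobiSq]
  push_cast
  congr 1
  ring

theorem jacobiSq_succ_pos {α : ℝ} (hα : 0 ≤ α) (k : ℕ) : 0 < jacobiSq α (k + 1) := by
  rw [jacobiSq_succ]
  positivity

theorem leadingSq_succ {α : ℝ} (k : ℕ) :
    leadingSq α (k + 1) = leadingSq α k / (4 * jacobiSq α (k + 1)) := by
  rw [leadingSq, leadingSq, Finset.prod_range_succ, ← mul_assoc, div_div]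

theorem leadingSq_pos {α : ℝ} (hα : 0 ≤ α) (k : ℕ) : 0 < leadingSq α k := by
  have := mass_pos hα
  have : 0 < ∏ i ∈ Finset.range k, (4 * jacobiSq α (i + 1)) :=
    Finset.prod_pos fun i _ => mul_pos (by norm_num) (jacobiSq_succ_pos hα i)
  unfold leadingSq
  positivity

/-- For `α ≤ 1 / 2` the sequence decreases from `k = 1` on. -/
theorem leadingSq_le_small {α : ℝ} (hα : α ∈ Icc (0 : ℝ) (1 / 2)) (k : ℕ) :
    leadingSq α (k + 1) ≤ (2 * α + 3) / (4 * mass α) := by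
  obtain ⟨h0, h1⟩ := hα
  have hm := mass_pos h0
  induction k with
  | zero =>
    rw [leadingSq_succ, jacobiSq_succ, leadingSq]
    simp only [Finset.range_zero, Finset.prod_empty, Nat.cast_zero]
    apply le_of_eq
    field_simp
    ring
  | succ k ih =>
    rw [leadingSq_succ]
    refine le_trans (div_le_self (leadingSq_pos h0 _).le ?_) ih
    rw [jacobiSq_succ, mul_div_assoc', le_div_iff₀ (by positivity)]
    push_cast
    nlinarith

theorem leadingSq_eq {α : ℝ} (hα : 0 ≤ α) (k : ℕ) :
    leadingSq α k = 4 ^ α / Real.pi * (Real.Gamma (k + α + 1 / 2) * Real.Gamma (k + α + 3 / 2) /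
      (Real.Gamma (k + 1) * Real.Gamma (k + 2 * α + 1))) := by
  induction k with
  | zero =>
    have hd := Real.Gamma_mul_Gamma_add_half (α + 1 / 2)
    rw [show α + 1 / 2 + 1 / 2 = α + 1 by ring] at hd
    have g1 : 0 < Real.Gamma (α + 3 / 2) := Real.Gamma_pos_of_pos (by linarith)
    have g2 : 0 < Real.Gamma (α + 1) := Real.Gamma_pos_of_pos (by linarith)
    have g3 : 0 < Real.Gamma (2 * α + 1) := Real.Gamma_pos_of_pos (by linarith)
    have hp : (4 : ℝ) ^ α * 2 ^ (1 - 2 * (α + 1 / 2)) = 1 := by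
      rw [four_rpow, ← Real.rpow_add two_pos, show 2 * α + (1 - 2 * (α + 1 / 2)) = 0 by ring,
        Real.rpow_zero]
    have hpi := Real.pi_pos
    have h2 := Real.mul_self_sqrt hpi.le
    simp only [leadingSq, Finset.range_zero, Finset.prod_empty, Nat.cast_zero, zero_add,
      Real.Gamma_one, mass_eq hα, one_mul, mul_one]
    rw [show 2 * (α + 1 / 2) = 2 * α + 1 by ring] at hd hp
    rw [one_div_div, div_mul_div_comm, div_eq_div_iff (by positivity) (by positivity)]
    calc Real.Gamma (α + 3 / 2) * (Real.pi * Real.Gamma (2 * α + 1))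
        = (4 ^ α * 2 ^ (1 - (2 * α + 1))) *
            (Real.Gamma (α + 3 / 2) * (√Real.pi * √Real.pi * Real.Gamma (2 * α + 1))) := by
          rw [hp, h2, one_mul]
      _ = 4 ^ α * Real.Gamma (α + 3 / 2) * √Real.pi *
            (Real.Gamma (2 * α + 1) * 2 ^ (1 - (2 * α + 1)) * √Real.pi) := by ring
      _ = _ := by rw [← hd]; ring
  | succ k ih =>
    rw [leadingSq_succ, ih, jacobiSq_succ]
    have e1 := Real.Gamma_add_one (s := k + α + 1 / 2) (by positivity)
    have e2 := Real.Gamma_add_one (s := k + α + 3 / 2) (by positivity)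
    have e3 := Real.Gamma_add_one (s := k + 1) (by positivity)
    have e4 := Real.Gamma_add_one (s := k + 2 * α + 1) (by positivity)
    push_cast
    rw [show (k : ℝ) + 1 + α + 1 / 2 = k + α + 1 / 2 + 1 by ring,
      show (k : ℝ) + 1 + α + 3 / 2 = k + α + 3 / 2 + 1 by ring,
      show (k : ℝ) + 1 + 2 * α + 1 = k + 2 * α + 1 + 1 by ring, e1, e2, e3, e4]
    have g1 : 0 < Real.Gamma (k + α + 3 / 2) := Real.Gamma_pos_of_pos (by positivity)
    have g2 : 0 < Real.Gamma (k + 1) := Real.Gamma_pos_of_pos (by positivity)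
    have g3 : 0 < Real.Gamma (k + 2 * α + 1) := Real.Gamma_pos_of_pos (by positivity)
    have hk : (0 : ℝ) ≤ k := by positivity
    have d1 : (0 : ℝ) < k + 1 + 2 * α := by positivity
    have d2 : (0 : ℝ) < k + 2 * α + 1 := by positivity
    have d3 : (0 : ℝ) < 2 * k + 2 * α + 1 := by positivity
    have d4 : (0 : ℝ) < 2 * k + 2 * α + 3 := by positivity
    have hpi := Real.pi_pos
    field_simp
    ring

/-- For `α ≥ 1 / 2` the sequence increases to its limit `4 ^ α / π`; the bound is the log-convexity
of the Gamma function. -/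
theorem leadingSq_le {α : ℝ} (hα : 1 / 2 ≤ α) (k : ℕ) : leadingSq α k ≤ 4 ^ α / Real.pi := by
  have hk : (0 : ℝ) ≤ k := by positivity
  rw [leadingSq_eq (by linarith)]
  refine mul_le_of_le_one_right (by have := Real.pi_pos; positivity) ?_
  have g1 : 0 < Real.Gamma (k + α + 1 / 2) := Real.Gamma_pos_of_pos (by positivity)
  have g4 : 0 < Real.Gamma (k + α + 3 / 2) := Real.Gamma_pos_of_pos (by positivity)
  have g2 : 0 < Real.Gamma (k + 1) := Real.Gamma_pos_of_pos (by positivity)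
  have g3 : 0 < Real.Gamma (k + 2 * α + 1) := Real.Gamma_pos_of_pos (by positivity)
  rw [div_le_one (by positivity)]
  rw [← Real.log_le_log_iff (by positivity) (by positivity), Real.log_mul g1.ne' g4.ne',
    Real.log_mul g2.ne' g3.ne']
  have hc := Real.convexOn_log_Gamma
  have hα0 : 0 < α := by linarith
  have m1 : (k + 1 : ℝ) ∈ Ioi (0 : ℝ) := by simp only [mem_Ioi]; positivity
  have m2 : (k + 2 * α + 1 : ℝ) ∈ Ioi (0 : ℝ) := by simp only [mem_Ioi]; positivity
  -- both inner points are convex combinations of the two outer points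
  have ha : 0 ≤ (α + 1 / 2) / (2 * α) := by positivity
  have hb : 0 ≤ (α - 1 / 2) / (2 * α) := div_nonneg (by linarith) (by positivity)
  have hab : (α + 1 / 2) / (2 * α) + (α - 1 / 2) / (2 * α) = 1 := by field_simp; ring
  have c1 := hc.2 m1 m2 ha hb hab
  have c2 := hc.2 m2 m1 ha hb hab
  simp only [smul_eq_mul, Function.comp_apply] at c1 c2
  rw [show (α + 1 / 2) / (2 * α) * (k + 1) + (α - 1 / 2) / (2 * α) * (k + 2 * α + 1) =
    k + α + 1 / 2 by field_simp; ring] at c1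
  rw [show (α + 1 / 2) / (2 * α) * (k + 2 * α + 1) + (α - 1 / 2) / (2 * α) * (k + 1) =
    k + α + 3 / 2 by field_simp; ring] at c2
  refine (add_le_add c1 c2).trans_eq ?_
  rw [show ∀ a b x y : ℝ, a * x + b * y + (a * y + b * x) = (a + b) * (x + y) by intros; ring, hab,
    one_mul]

/-! ### The constants `C_α` and `C'_α` -/

theorem one_le_constC {α : ℝ} (hα : 0 ≤ α) : 1 ≤ constC α := by
  have h1 : 1 / 4 ≤ constM α := le_max_left _ _
  have h2 : 1 / 2 ≤ constN α := le_trans (le_add_of_nonneg_right (by positivity)) (le_max_right _ _)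
  unfold constC
  linarith

/-- The bound `1 / C_α ≤ 0.838 + 0.33 α`, from the second term in `M_α` and the first one in `N_α`. -/
theorem one_le_constC_mul_smallRatio {α : ℝ} (hα : α ∈ Icc (0 : ℝ) (1 / 2)) :
    1 ≤ constC α * smallRatio α := by
  obtain ⟨h0, h1⟩ := hα
  have hQ : 0 < smallRatio α := by unfold smallRatio; positivity
  have hN : 3 / (2 * α + 5) ≤ constN α := le_max_left _ _
  have hM : (1 / smallRatio α - 3 / (2 * α + 5)) / 2 ≤ constM α := by
    refine le_trans ?_ (le_max_right _ _)
    apply Real.le_sqrt_of_sq_le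
    have : (1 / smallRatio α - 3 / (2 * α + 5)) / 2 =
        (1243 / 500 + 101 / 100 * α) / (2 * smallRatio α * (2 * α + 5)) := by
      field_simp
      unfold smallRatio
      ring
    rw [this, div_pow, div_le_div_iff₀ (by positivity) (by positivity), smallRatio]
    have h5 : 0 ≤ α * (1 / 2 - α) := mul_nonneg h0 (by linarith)
    have h6 : 0 ≤ α ^ 2 * (1 / 2 - α) := mul_nonneg (sq_nonneg _) (by linarith)
    have : (1243 / 500 + 101 / 100 * α) ^ 2 * (2 * α + 3) ^ 2 ≤
        4 * (419 / 500 + 33 / 100 * α) ^ 2 * (2 * α + 5) * (2 * (2 * α + 2)) := by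
      nlinarith [mul_nonneg h0 h6, mul_nonneg h5 h5]
    calc _ = (1243 / 500 + 101 / 100 * α) ^ 2 * (2 * α + 3) ^ 2 * (2 * α + 5) := by ring
      _ ≤ 4 * (419 / 500 + 33 / 100 * α) ^ 2 * (2 * α + 5) * (2 * (2 * α + 2)) * (2 * α + 5) := by
        gcongr
      _ = _ := by ring
  have : 1 / smallRatio α ≤ constC α := by unfold constC; linarith
  rwa [div_le_iff₀ hQ] at this

/-- The logarithm of `t ^ t e ^ (-2 t)`. -/
noncomputable def expo (t : ℝ) : ℝ := t * Real.log t - 2 * t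

theorem constC'_sq {α : ℝ} (hα : 0 ≤ α) : constC' α ^ 2 =
    4 ^ α * (3 / 2 : ℝ) ^ (3 / 2 : ℝ) * Real.exp (expo (3 / 2 + 2 * α)) * (1 + α) := by
  have ht : 0 < 3 / 2 + 2 * α := by positivity
  rw [constC', mul_pow, div_pow, mul_pow, mul_pow, Real.sq_sqrt (by positivity), four_rpow, expo,
    Real.exp_sub, mul_comm (3 / 2 + 2 * α) (Real.log _), ← Real.rpow_def_of_pos ht, ← Real.exp_nat_mul]
  simp only [← Real.rpow_natCast]
  rw [← Real.rpow_mul (by norm_num), ← Real.rpow_mul (by norm_num), ← Real.rpow_mul ht.le]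
  push_cast
  rw [show α * 2 = 2 * α by ring, show (3 / 4 : ℝ) * 2 = 3 / 2 by norm_num,
    show (3 / 4 + α) * 2 = 3 / 2 + 2 * α by ring, show 2 * (2 * α + 3 / 2) = 2 * (3 / 2 + 2 * α) by ring]
  ring

theorem constC'_nonneg {α : ℝ} (hα : 0 ≤ α) : 0 ≤ constC' α := by
  unfold constC'
  positivity

/-- The tangent to the convex function `expo` at `s`. -/
theorem expo_ge {s t : ℝ} (hs : 0 < s) (ht : 0 < t) : t * (Real.log s - 1) - s ≤ expo t := by
  have h := Real.log_le_sub_one_of_pos (div_pos hs ht)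
  rw [Real.log_div hs.ne' ht.ne'] at h
  have h2 := mul_le_mul_of_nonneg_left h ht.le
  have h3 : t * (s / t - 1) = s - t := by field_simp
  rw [h3] at h2
  unfold expo
  linarith

theorem rpow_three_halves_ge : (18371 / 10000 : ℝ) ≤ (3 / 2 : ℝ) ^ (3 / 2 : ℝ) := by
  have h1 : ((3 / 2 : ℝ) ^ (3 / 2 : ℝ)) ^ 2 = 27 / 8 := by
    rw [← Real.rpow_natCast, ← Real.rpow_mul (by norm_num)]
    norm_num
  refine le_of_sq_le_sq ?_ (by positivity)
  rw [h1]
  norm_num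

/-- A rational lower bound for `exp (-n / m)` from one for `exp (-1)`. -/
theorem le_exp_of_pow {x r : ℝ} {m n : ℕ} (hm : m ≠ 0) (hx : m * x = -n)
    (h : r ^ m ≤ 0.36787944116 ^ n) : r ≤ Real.exp x := by
  refine le_of_pow_le_pow_left₀ hm (Real.exp_pos _).le ?_
  rw [← Real.exp_nat_mul, hx, show (-(n : ℝ)) = n * (-1) by ring, Real.exp_nat_mul]
  exact h.trans (pow_le_pow_left₀ (by norm_num) Real.exp_neg_one_gt_d9.le _)

/-- The case `α ≥ 1 / 2` reduces to a lower bound `D` for `t ^ t e ^ (-2 t)`, `t = 2 α + 3 / 2`. -/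
theorem mul_le_constC'_sq {α T D : ℝ} (hα : 0 ≤ α) (hD0 : 0 ≤ D)
    (hD : D ≤ Real.exp (expo (3 / 2 + 2 * α)))
    (hT : T ≤ 3.1415 * 1.8371 * D * (1 + α)) : 4 ^ α / Real.pi * T ≤ constC' α ^ 2 := by
  have hpi := Real.pi_pos
  rw [constC'_sq hα, div_mul_eq_mul_div, div_le_iff₀ hpi]
  have h1 := rpow_three_halves_ge
  have : (3.1415 : ℝ) * 1.8371 * D * (1 + α) ≤ Real.pi * (3 / 2 : ℝ) ^ (3 / 2 : ℝ) *
      Real.exp (expo (3 / 2 + 2 * α)) * (1 + α) := by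
    gcongr
    · exact Real.pi_gt_d4.le
    · norm_num at h1 ⊢; exact h1
  calc 4 ^ α * T ≤ 4 ^ α * (Real.pi * (3 / 2 : ℝ) ^ (3 / 2 : ℝ) *
      Real.exp (expo (3 / 2 + 2 * α)) * (1 + α)) := by gcongr; linarith
    _ = _ := by ring

/-- The target for `1 / 2 ≤ α ≤ 1`. The minimum of `t ^ t e ^ (-2 t)` is `exp (-e)`, attained at `e`. -/
theorem medium_le_constC'_sq {α : ℝ} (hα : 0 ≤ α) :
    4 ^ α / Real.pi * (19 / 50 * (1 + α)) ≤ constC' α ^ 2 := by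
  refine mul_le_constC'_sq hα (D := 0.06585) (by norm_num) ?_ (by nlinarith)
  have h1 := expo_ge (Real.exp_pos 1) (t := 3 / 2 + 2 * α) (by positivity)
  rw [Real.log_exp, sub_self, mul_zero, zero_sub] at h1
  have h2 := Real.exp_one_lt_d9
  refine le_trans ?_ (Real.exp_le_exp.2 (le_trans (by linarith : (-68 / 25 : ℝ) ≤ _) h1))
  exact le_exp_of_pow (m := 25) (n := 68) (by norm_num) (by norm_num) (by norm_num)

/-- The target for `1 ≤ α ≤ 2`. -/
theorem large_le_constC'_sq {α : ℝ} (hα : 1 ≤ α) :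
    4 ^ α / Real.pi * (77 / 100) ≤ constC' α ^ 2 := by
  refine mul_le_constC'_sq (by linarith) (D := 0.069) (by norm_num) ?_ (by linarith)
  have h1 := expo_ge (s := 7 / 2) (t := 3 / 2 + 2 * α) (by norm_num) (by positivity)
  have h2 : 1.24 ≤ Real.log (7 / 2) := by
    have h3 : Real.log 12 ≤ Real.log ((7 / 2) ^ 2) := Real.log_le_log (by norm_num) (by norm_num)
    rw [Real.log_pow, show (12 : ℝ) = 2 ^ 2 * 3 by norm_num,
      Real.log_mul (by norm_num) (by norm_num), Real.log_pow] at h3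
    have := Real.log_two_gt_d9
    have := Real.log_three_gt_d9
    push_cast at h3
    linarith
  refine le_trans ?_ (Real.exp_le_exp.2 (le_trans (by nlinarith : (-8 / 3 : ℝ) ≤ _) h1))
  exact le_exp_of_pow (m := 3) (n := 8) (by norm_num) (by norm_num) (by norm_num)

/-- The target for `α ≥ 2`. -/
theorem huge_le_constC'_sq {α : ℝ} (hα : 2 ≤ α) :
    4 ^ α / Real.pi * (1 + α) ≤ constC' α ^ 2 := by
  refine mul_le_constC'_sq (by linarith) (D := 0.1735) (by norm_num) ?_ (by linarith)
  have h1 := expo_ge (s := 11 / 2) (t := 3 / 2 + 2 * α) (by norm_num) (by positivity)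
  have h2 : 1.7 ≤ Real.log (11 / 2) := by
    have h3 : Real.log 30 ≤ Real.log ((11 / 2) ^ 2) := Real.log_le_log (by norm_num) (by norm_num)
    rw [Real.log_pow, show (30 : ℝ) = 2 * 3 * 5 by norm_num,
      Real.log_mul (by norm_num) (by norm_num), Real.log_mul (by norm_num) (by norm_num)] at h3
    have := Real.log_two_gt_d9
    have := Real.log_three_gt_d9
    have := Real.log_five_gt_d9
    push_cast at h3
    linarith
  refine le_trans ?_ (Real.exp_le_exp.2 (le_trans (by nlinarith : (-7 / 4 : ℝ) ≤ _) h1))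
  exact le_exp_of_pow (m := 4) (n := 7) (by norm_num) (by norm_num) (by norm_num)

/-- The inequality `small_le_constC'_sq` after clearing denominators, with `s = 2 α`. -/
theorem small_polynomial_nonneg {s : ℝ} (hs : s ∈ Icc (0 : ℝ) 1) :
    0 ≤ 7200000000 - 78082755000 * s + 307367320961 * s ^ 2 - 166899361026 * s ^ 3 +
      63669737329 * s ^ 4 + 10302500000 * s ^ 5 + 4721875000 * s ^ 6 := by
  have h : nonnegList 9 [7200000000, -78082755000, 307367320961, -166899361026, 63669737329,
    10302500000, 4721875000] = true := by decide +kernel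
  have := evalList_nonneg h hs
  simp only [evalList] at this
  push_cast at this
  linarith

/-- The target for `α ≤ 1 / 2`. Here `1 / mass α` is bounded through `mass (α + 1 / 2)`, and the
exponential in `C'_α²` by its quadratic Taylor polynomial, after extracting the value at `α = 0`. -/
theorem small_le_constC'_sq {α : ℝ} (hα : α ∈ Icc (0 : ℝ) (1 / 2)) :
    (2 * α + 3) / (4 * mass α) * smallTarget α ≤ constC' α ^ 2 := by
  obtain ⟨h0, h1⟩ := hα
  have hpi := Real.pi_pos
  have hT : 0 ≤ smallTarget α := by unfold smallTarget; nlinarith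
  have hm := mass_pos h0
  set Y : ℝ := (21972 / 10000 - 4) * α + 2 * α * (3 + 4 * α) / (3 + 2 * α) with hY
  have hYeq : Y * (3 + 2 * α) = -(18028 / 10000) * α * (3 + 2 * α) + 2 * α * (3 + 4 * α) := by
    rw [hY]; field_simp; ring
  have hY0 : 0 ≤ Y := by
    have : 0 ≤ Y * (3 + 2 * α) := by rw [hYeq]; nlinarith
    exact nonneg_of_mul_nonneg_left this (by linarith)
  -- the reciprocal of the mass
  have hinv : 1 / mass α ≤ (α + 1) * (1 / 2 - 1511 / 10000 * α) := by
    have e1 := mass_mul_mass_add_half h0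
    have e2 := mass_add_half_le ⟨h0, h1⟩
    have e3 : 1 / mass α = mass (α + 1 / 2) * (α + 1) / Real.pi := by
      rw [div_eq_div_iff hm.ne' hpi.ne', ← mul_right_comm, mul_comm (mass (α + 1 / 2)), e1]
      field_simp
    rw [e3, div_le_iff₀ hpi]
    have e4 := Real.pi_gt_d4
    have e5 : Real.pi / 2 - (Real.pi - 8 / 3) * α ≤ (1 / 2 - 1511 / 10000 * α) * Real.pi := by
      norm_num at e4
      nlinarith
    nlinarith [mul_le_mul_of_nonneg_right (e2.trans e5) (by linarith : 0 ≤ α + 1)]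
  -- the exponential factor
  have hexp : 6721 / 40000 * (1 + Y + Y ^ 2 / 2) ≤
      4 ^ α * (3 / 2 : ℝ) ^ (3 / 2 : ℝ) * Real.exp (expo (3 / 2 + 2 * α)) := by
    have l2 := Real.log_two_gt_d9
    have l3 := Real.log_three_gt_d9
    have hlog32 : Real.log (3 / 2) = Real.log 3 - Real.log 2 :=
      Real.log_div (by norm_num) (by norm_num)
    have hlog : Real.log (3 / 2 + 2 * α) =
        Real.log 3 - Real.log 2 + Real.log (1 + 4 * α / 3) := by
      rw [← hlog32, ← Real.log_mul (by norm_num) (by positivity)]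
      congr 1
      ring
    have hu := Real.le_log_one_add_of_nonneg (x := 4 * α / 3) (by positivity)
    have hu2 := mul_le_mul_of_nonneg_left hu (by positivity : 0 ≤ 3 / 2 + 2 * α)
    have hu3 : (3 / 2 + 2 * α) * (2 * (4 * α / 3) / (4 * α / 3 + 2)) =
        2 * α * (3 + 4 * α) / (3 + 2 * α) := by field_simp; ring
    rw [hu3] at hu2
    have hall : (4 : ℝ) ^ α * (3 / 2 : ℝ) ^ (3 / 2 : ℝ) * Real.exp (expo (3 / 2 + 2 * α)) =
        Real.exp (3 * Real.log (3 / 2)) * Real.exp (-3) *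
          Real.exp (2 * α * Real.log 3 - 4 * α + (3 / 2 + 2 * α) * Real.log (1 + 4 * α / 3)) := by
      rw [Real.rpow_def_of_pos (by norm_num : (0 : ℝ) < 4),
        Real.rpow_def_of_pos (by norm_num : (0 : ℝ) < 3 / 2), ← Real.exp_add, ← Real.exp_add,
        ← Real.exp_add, ← Real.exp_add, expo, hlog, Real.log_four_eq, hlog32]
      congr 1
      ring
    have hthree : Real.exp (3 * Real.log (3 / 2)) = 27 / 8 := by
      rw [mul_comm, Real.exp_mul, Real.exp_log (by norm_num)]
      norm_num
    have he3 : (0.049787 : ℝ) ≤ Real.exp (-3) :=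
      le_exp_of_pow (m := 1) (n := 3) (by norm_num) (by norm_num) (by norm_num)
    rw [hall, hthree]
    have hq := Real.quadratic_le_exp_of_nonneg hY0
    have hle : Real.exp Y ≤ Real.exp
        (2 * α * Real.log 3 - 4 * α + (3 / 2 + 2 * α) * Real.log (1 + 4 * α / 3)) := by
      apply Real.exp_le_exp.2
      rw [hY]
      norm_num at l3
      nlinarith
    calc 6721 / 40000 * (1 + Y + Y ^ 2 / 2) ≤ 27 / 8 * 0.049787 * (1 + Y + Y ^ 2 / 2) := by
          gcongr
          norm_num
      _ ≤ _ := by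
          gcongr
          exact hq.trans hle
  rw [constC'_sq h0]
  refine le_trans ?_ (mul_le_mul_of_nonneg_right hexp (by linarith : 0 ≤ 1 + α))
  have hpoly := small_polynomial_nonneg (s := 2 * α) ⟨by linarith, by linarith⟩
  have hmain : (2 * α + 3) * (1 / 2 - 1511 / 10000 * α) * smallTarget α ≤
      6721 / 10000 * (1 + Y + Y ^ 2 / 2) := by
    refine le_of_mul_le_mul_right ?_ (by positivity : 0 < (3 + 2 * α) ^ 2)
    have : 6721 / 10000 * (1 + Y + Y ^ 2 / 2) * (3 + 2 * α) ^ 2 =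
        6721 / 10000 * ((3 + 2 * α) ^ 2 + (3 + 2 * α) * (Y * (3 + 2 * α)) +
          (Y * (3 + 2 * α)) ^ 2 / 2) := by ring
    rw [this, hYeq, smallTarget]
    linarith
  calc (2 * α + 3) / (4 * mass α) * smallTarget α
      = (2 * α + 3) * smallTarget α / 4 * (1 / mass α) := by field_simp
    _ ≤ (2 * α + 3) * smallTarget α / 4 * ((α + 1) * (1 / 2 - 1511 / 10000 * α)) := by gcongr
    _ = (2 * α + 3) * (1 / 2 - 1511 / 10000 * α) * smallTarget α * ((1 + α) / 4) := by ring
    _ ≤ 6721 / 10000 * (1 + Y + Y ^ 2 / 2) * ((1 + α) / 4) := by gcongr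
    _ = _ := by ring

/-- The estimate behind the constant `C'_α`. The hypothesis is the condition on `k` for `k = 1`. -/
theorem IsSolution.leadingSq_mul_le {α c χ q : ℝ} (hα : 0 ≤ α) (hχ : 0 < χ) (hq0 : 0 < q)
    (hq : c ^ 2 = q * χ) {φ φ' : ℝ → ℝ} (h : IsSolution α c χ φ φ')
    (hn : ∫ x in (-1 : ℝ)..1, φ x ^ 2 * weight α x = 1)
    (hs : 2 * α + 2 + constC α * c ^ 2 ≤ χ) (k : ℕ) :
    leadingSq α (k + 1) * (q * (φ 0 ^ 2 + φ' 0 ^ 2 / χ)) ≤ constC' α ^ 2 := by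
  have hC := one_le_constC hα
  have hCq : constC α * q ≤ 1 - (2 * α + 2) * χ⁻¹ := by
    rw [hq] at hs
    have := mul_le_mul_of_nonneg_right hs (inv_pos.2 hχ).le
    rw [mul_inv_cancel₀ hχ.ne', add_mul, mul_assoc, mul_assoc q, mul_inv_cancel₀ hχ.ne'] at this
    linarith
  have hs' : q ≤ 1 - (2 * α + 2) * χ⁻¹ := by nlinarith
  have hZ : 0 ≤ q * (φ 0 ^ 2 + φ' 0 ^ 2 / χ) := by positivity
  have hq1 : q ≤ 1 := by
    have : 0 ≤ (2 * α + 2) * χ⁻¹ := by positivity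
    linarith
  rcases le_total α (1 / 2) with h1 | h1
  · refine le_trans ?_ (small_le_constC'_sq ⟨hα, h1⟩)
    have hm := mass_pos hα
    have hQ : 0 ≤ smallRatio α := by unfold smallRatio; positivity
    have hCQ := one_le_constC_mul_smallRatio ⟨hα, h1⟩
    gcongr
    · exact leadingSq_le_small ⟨hα, h1⟩ k
    · refine h.mul_initial_le_small ⟨hα, h1⟩ hχ hq0 hq hn ?_ hs'
      nlinarith [mul_le_mul_of_nonneg_left hCq hQ]
  · have hl := leadingSq_le h1 (k + 1)
    have hp : 0 ≤ 4 ^ α / Real.pi := (leadingSq_pos hα _).le.trans hl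
    rcases le_total α 1 with h2 | h2
    · refine le_trans ?_ (medium_le_constC'_sq hα)
      exact mul_le_mul hl (h.mul_initial_le_medium ⟨h1, h2⟩ hχ hq0 hq hn hs') hZ hp
    · rcases le_total α 2 with h3 | h3
      · refine le_trans ?_ (large_le_constC'_sq h2)
        exact mul_le_mul hl (h.mul_initial_le_large ⟨h2, h3⟩ hχ hq0 hq hn hs') hZ hp
      · refine le_trans ?_ (huge_le_constC'_sq h3)
        refine mul_le_mul hl ?_ hZ hp
        have h4 := h.initial_le hα hχ hq hq0.le hq1 hn
        have h5 : 0 ≤ φ 0 ^ 2 + φ' 0 ^ 2 / χ := by positivity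
        nlinarith

/-! ### The finite Fourier transform -/

/-- Differentiation under the integral sign. -/
theorem hasDerivAt_integral_mul {g : ℝ → ℝ} (hg : ContinuousOn g (Icc (-1) 1))
    {K K' : ℝ → ℝ → ℝ} (hK : ∀ x y, HasDerivAt (fun x => K x y) (K' x y) x)
    (cK : ∀ x, Continuous (K x)) (cK' : ∀ x, Continuous (K' x)) {B : ℝ}
    (hB : ∀ x, ∀ y ∈ Icc (-1 : ℝ) 1, |K' x y| ≤ B) (x : ℝ) :
    HasDerivAt (fun x => ∫ y in (-1 : ℝ)..1, K x y * g y) (∫ y in (-1 : ℝ)..1, K' x y * g y) x := by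
  have hsub : uIoc (-1 : ℝ) 1 ⊆ Icc (-1) 1 := by
    rw [uIoc_of_le (by norm_num)]
    exact Ioc_subset_Icc_self
  have hint : ∀ k : ℝ → ℝ, Continuous k →
      IntervalIntegrable (fun y => k y * g y) volume (-1) 1 := fun k hk => by
    apply ContinuousOn.intervalIntegrable
    rw [uIcc_of_le (by norm_num)]
    exact hk.continuousOn.mul hg
  refine (intervalIntegral.hasDerivAt_integral_of_dominated_loc_of_deriv_le (F := fun x y => K x y * g y)
    (F' := fun x y => K' x y * g y) (bound := fun y => B * |g y|) (s := univ)
    (μ := volume) (a := -1) (b := 1) (x₀ := x)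
    univ_mem (Eventually.of_forall fun z => IntervalIntegrable.aestronglyMeasurable_restrict_uIoc (hint _ (cK z)))
    (hint _ (cK x)) (IntervalIntegrable.aestronglyMeasurable_restrict_uIoc (hint _ (cK' x))) ?_ ?_ ?_).2
  · refine Eventually.of_forall fun y hy z _ => ?_
    rw [Real.norm_eq_abs, abs_mul]
    exact mul_le_mul_of_nonneg_right (hB z y (hsub hy)) (abs_nonneg _)
  · apply ContinuousOn.intervalIntegrable
    rw [uIcc_of_le (by norm_num)]
    exact continuousOn_const.mul hg.abs
  · exact Eventually.of_forall fun y _ z _ => (hK z y).mul_const _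

/-- The transform of `ψ` with the kernel `cos (c x y + θ)`. The phases `θ = 0` and `θ = -π / 2` give
the real and the imaginary part of the finite Fourier transform. -/
noncomputable def phaseTransform (α c θ : ℝ) (ψ : ℝ → ℝ) (x : ℝ) : ℝ :=
  ∫ y in (-1 : ℝ)..1, Real.cos (c * x * y + θ) * (ψ y * weight α y)

/-- The derivative of `phaseTransform`. -/
noncomputable def phaseTransform' (α c θ : ℝ) (ψ : ℝ → ℝ) (x : ℝ) : ℝ :=
  ∫ y in (-1 : ℝ)..1, -(c * y * Real.sin (c * x * y + θ)) * (ψ y * weight α y)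

theorem hasDerivAt_phase (c θ x y : ℝ) :
    HasDerivAt (fun x : ℝ => c * x * y + θ) (c * y) x := by
  simpa using (((hasDerivAt_id x).const_mul c).mul_const y).add_const θ

theorem hasDerivAt_phaseTransform {α : ℝ} (hα : 0 ≤ α) (c θ : ℝ) {ψ : ℝ → ℝ}
    (hψ : ContinuousOn ψ (Icc (-1) 1)) (x : ℝ) :
    HasDerivAt (phaseTransform α c θ ψ) (phaseTransform' α c θ ψ x) x := by
  refine hasDerivAt_integral_mul (hψ.mul (continuous_weight hα).continuousOn)
    (K := fun x y => Real.cos (c * x * y + θ)) (K' := fun x y => -(c * y * Real.sin (c * x * y + θ)))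
    (B := |c|) (fun x y => (hasDerivAt_phase c θ x y).cos.congr_deriv (by ring))
    (fun x => by fun_prop) (fun x => by fun_prop) (fun x y hy => ?_) x
  rw [abs_neg, abs_mul, abs_mul]
  have h1 := Real.abs_sin_le_one (c * x * y + θ)
  have h2 : |y| ≤ 1 := abs_le.2 hy
  calc |c| * |y| * |Real.sin (c * x * y + θ)| ≤ |c| * 1 * 1 := by gcongr
    _ = |c| := by ring

theorem hasDerivAt_phaseTransform' {α : ℝ} (hα : 0 ≤ α) (c θ : ℝ) {ψ : ℝ → ℝ}
    (hψ : ContinuousOn ψ (Icc (-1) 1)) (x : ℝ) :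
    HasDerivAt (phaseTransform' α c θ ψ)
      (∫ y in (-1 : ℝ)..1, -(c ^ 2 * y ^ 2 * Real.cos (c * x * y + θ)) * (ψ y * weight α y)) x := by
  refine hasDerivAt_integral_mul (hψ.mul (continuous_weight hα).continuousOn)
    (K := fun x y => -(c * y * Real.sin (c * x * y + θ)))
    (K' := fun x y => -(c ^ 2 * y ^ 2 * Real.cos (c * x * y + θ)))
    (B := c ^ 2)
    (fun x y => (((hasDerivAt_phase c θ x y).sin.const_mul (c * y)).neg).congr_deriv (by ring))
    (fun x => by fun_prop) (fun x => by fun_prop) (fun x y hy => ?_) x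
  rw [abs_neg, abs_mul, abs_mul, abs_pow, abs_pow, sq_abs]
  have h1 := Real.abs_cos_le_one (c * x * y + θ)
  have h2 : |y| ≤ 1 := abs_le.2 hy
  calc c ^ 2 * |y| ^ 2 * |Real.cos (c * x * y + θ)| ≤ c ^ 2 * 1 ^ 2 * 1 := by gcongr
    _ = c ^ 2 := by ring

/-- The kernel `cos (c x y + θ)` is annihilated by the difference of the operators `L_c` in `x` and
in `y`, so the transform of a solution is a solution. -/
theorem IsSolution.isSolution_phaseTransform {α c χ : ℝ} (hα : 0 ≤ α) {ψ ψ' : ℝ → ℝ}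
    (h : IsSolution α c χ ψ ψ') (θ : ℝ) :
    IsSolution α c χ (phaseTransform α c θ ψ) (phaseTransform' α c θ ψ) := by
  have h1 := hasDerivAt_phaseTransform hα c θ h.cont
  have h2 := hasDerivAt_phaseTransform' hα c θ h.cont
  refine ⟨fun x _ => (h1 x).continuousAt.continuousWithinAt,
    fun x _ => (h2 x).continuousAt.continuousWithinAt, fun x _ => h1 x, fun x hx => ?_⟩
  refine (h2 x).congr_deriv ?_
  rw [eq_div_iff (one_sub_sq_pos hx).ne']
  have hph : ∀ y : ℝ, HasDerivAt (fun y : ℝ => c * x * y + θ) (c * x) y := fun y => by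
    simpa using ((hasDerivAt_id y).const_mul (c * x)).add_const θ
  have key := h.integral_adjoint hα (f := fun y => Real.cos (c * x * y + θ))
    (f1 := fun y => -(c * x * Real.sin (c * x * y + θ)))
    (f2 := fun y => -(c ^ 2 * x ^ 2 * Real.cos (c * x * y + θ)))
    (fun y => (hph y).cos.congr_deriv (by ring))
    (fun y => (((hph y).sin.const_mul (c * x)).neg).congr_deriv (by ring)) (by fun_prop)
  have hint : ∀ k : ℝ → ℝ, Continuous k →
      IntervalIntegrable (fun y => k y * (ψ y * weight α y)) volume (-1) 1 := fun k hk => by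
    apply ContinuousOn.intervalIntegrable
    rw [uIcc_of_le (by norm_num)]
    exact hk.continuousOn.mul (h.cont.mul (continuous_weight hα).continuousOn)
  have i1 := hint (fun y => -(c ^ 2 * y ^ 2 * Real.cos (c * x * y + θ))) (by fun_prop)
  have i2 := hint (fun y => -(c * y * Real.sin (c * x * y + θ))) (by fun_prop)
  have i3 := hint (fun y => Real.cos (c * x * y + θ)) (by fun_prop)
  rw [← sub_eq_zero, ← key]
  simp only [phaseTransform, phaseTransform']
  rw [← intervalIntegral.integral_const_mul, ← intervalIntegral.integral_const_mul,
    ← intervalIntegral.integral_mul_const, ← intervalIntegral.integral_sub (i2.const_mul _)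
      (i3.const_mul _), ← intervalIntegral.integral_sub (i1.mul_const _)
      ((i2.const_mul _).sub (i3.const_mul _))]
  refine integral_congr fun y _ => ?_
  ring

theorem IsSolution.deriv_zero_ne_zero {α c χ q : ℝ} (hα : 0 ≤ α) (hχ : 0 < χ)
    (hq : c ^ 2 = q * χ) (hq0 : 0 ≤ q) (hq1 : q ≤ 1) {φ φ' : ℝ → ℝ} (h : IsSolution α c χ φ φ')
    (hn : ∫ x in (-1 : ℝ)..1, φ x ^ 2 * weight α x = 1) (h0 : φ 0 = 0) : φ' 0 ≠ 0 := by
  intro h0'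
  have hz := h.eq_zero hα hχ hq hq0 hq1 h0 h0'
  have : ∫ x in (-1 : ℝ)..1, φ x ^ 2 * weight α x = ∫ x in (-1 : ℝ)..1, (0 : ℝ) := by
    refine integral_congr fun x hx => ?_
    rw [uIcc_of_le (by norm_num)] at hx
    simp [hz x hx]
  rw [this] at hn
  simp at hn

/-- The regular solutions form a one-dimensional space. -/
theorem IsSolution.eq_const_mul {α c χ q : ℝ} (hα : 0 ≤ α) (hχ : 0 < χ) (hq : c ^ 2 = q * χ)
    (hq0 : 0 ≤ q) (hq1 : q ≤ 1) {φ φ' u u' : ℝ → ℝ} (h : IsSolution α c χ φ φ')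
    (hn : ∫ x in (-1 : ℝ)..1, φ x ^ 2 * weight α x = 1) (hu : IsSolution α c χ u u') :
    ∃ m : ℝ, u' 0 = m * φ' 0 ∧ ∀ x ∈ Icc (-1 : ℝ) 1, u x = m * φ x := by
  have hw := h.wronskian_zero hα hu
  obtain ⟨m, h1, h2⟩ : ∃ m : ℝ, u 0 = m * φ 0 ∧ u' 0 = m * φ' 0 := by
    by_cases h0 : φ 0 = 0
    · have h0' := h.deriv_zero_ne_zero hα hχ hq hq0 hq1 hn h0
      refine ⟨u' 0 / φ' 0, ?_, by field_simp⟩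
      rw [h0, mul_zero] at hw ⊢
      exact (mul_eq_zero.1 hw).resolve_right h0'
    · refine ⟨u 0 / φ 0, by field_simp, ?_⟩
      field_simp
      linarith
  refine ⟨m, h2, fun x hx => ?_⟩
  have := (h.sub_const_mul hu m).eq_zero hα hχ hq hq0 hq1 (sub_eq_zero.2 h1) (sub_eq_zero.2 h2) x hx
  linarith

theorem finiteFourier_eq {α : ℝ} (hα : 0 ≤ α) (c : ℝ) {ψ : ℝ → ℝ}
    (hψ : ContinuousOn ψ (Icc (-1) 1)) (x : ℝ) :
    finiteFourier α c ψ x =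
      phaseTransform α c 0 ψ x + Complex.I * phaseTransform α c (-(Real.pi / 2)) ψ x := by
  have hint : ∀ k : ℝ → ℝ, Continuous k →
      IntervalIntegrable (fun y => ((k y * (ψ y * weight α y) : ℝ) : ℂ)) volume (-1) 1 :=
    fun k hk => by
      apply ContinuousOn.intervalIntegrable
      rw [uIcc_of_le (by norm_num)]
      exact Complex.continuous_ofReal.comp_continuousOn
        (hk.continuousOn.mul (hψ.mul (continuous_weight hα).continuousOn))
  rw [phaseTransform, phaseTransform, ← intervalIntegral.integral_ofReal,
    ← intervalIntegral.integral_ofReal, ← intervalIntegral.integral_const_mul,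
    ← intervalIntegral.integral_add (hint _ (by fun_prop)) ((hint _ (by fun_prop)).const_mul _)]
  refine integral_congr fun y _ => ?_
  simp only [← sub_eq_add_neg, Real.cos_sub_pi_div_two, add_zero]
  have : Complex.I * c * x * y = ((c * x * y : ℝ) : ℂ) * Complex.I := by push_cast; ring
  rw [this, Complex.exp_mul_I, ← Complex.ofReal_cos, ← Complex.ofReal_sin]
  push_cast
  ring

/-- The eigenvalue of the finite Fourier transform, with its relation to the first two moments,
which are the values at the origin of the transform and of its derivative. -/
theorem IsSolution.exists_eigenvalue {α c χ q : ℝ} (hα : 0 ≤ α) (hχ : 0 < χ) (hq : c ^ 2 = q * χ)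
    (hq0 : 0 ≤ q) (hq1 : q ≤ 1) {ψ ψ' : ℝ → ℝ} (h : IsSolution α c χ ψ ψ')
    (hn : ∫ x in (-1 : ℝ)..1, ψ x ^ 2 * weight α x = 1) :
    ∃ μ : ℂ, IsFourierEigenvalue α c ψ μ ∧ |moment α ψ 0| = |ψ 0| * ‖μ‖ ∧
      |c * moment α ψ 1| = |ψ' 0| * ‖μ‖ ∧ (moment α ψ 0 = 0 ∨ c * moment α ψ 1 = 0) := by
  obtain ⟨a, ha', ha⟩ := h.eq_const_mul hα hχ hq hq0 hq1 hn (h.isSolution_phaseTransform hα 0)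
  obtain ⟨b, hb', hb⟩ := h.eq_const_mul hα hχ hq hq0 hq1 hn (h.isSolution_phaseTransform hα (-(Real.pi / 2)))
  have h0 : (0 : ℝ) ∈ Icc (-1 : ℝ) 1 := by constructor <;> norm_num
  have a0 := ha 0 h0
  have b0 := hb 0 h0
  have e1 : phaseTransform α c 0 ψ 0 = moment α ψ 0 := by simp [phaseTransform, moment]
  have e2 : phaseTransform' α c 0 ψ 0 = 0 := by simp [phaseTransform']
  have e3 : phaseTransform α c (-(Real.pi / 2)) ψ 0 = 0 := by simp [phaseTransform]
  have e4 : phaseTransform' α c (-(Real.pi / 2)) ψ 0 = c * moment α ψ 1 := by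
    rw [phaseTransform', moment, ← intervalIntegral.integral_const_mul]
    refine integral_congr fun y _ => ?_
    simp
    ring
  rw [e1] at a0
  rw [e2] at ha'
  rw [e3] at b0
  rw [e4] at hb'
  refine ⟨a + Complex.I * b, fun x hx => ?_, ?_⟩
  · rw [finiteFourier_eq hα c h.cont, ha x hx, hb x hx]
    push_cast
    ring
  · by_cases hz : ψ 0 = 0
    · have hz' := h.deriv_zero_ne_zero hα hχ hq hq0 hq1 hn hz
      have ha0 : a = 0 := (mul_eq_zero.1 ha'.symm).resolve_right hz'
      rw [hz, mul_zero] at a0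
      subst ha0
      rw [a0, hb', hz]
      simp [mul_comm]
    · have hz' : ψ' 0 = 0 := (mul_eq_zero.1 (h.initial_mul_eq_zero hα)).resolve_left hz
      have hb0 : b = 0 := (mul_eq_zero.1 b0.symm).resolve_right hz
      subst hb0
      rw [a0, hb', hz']
      simp [mul_comm]

/-! ### The moments -/

/-- The linear functional `p ↦ ∫ p ψ ω_α`. -/
noncomputable def pairing (α : ℝ) (ψ p : ℝ → ℝ) : ℝ := ∫ x in (-1 : ℝ)..1, p x * ψ x * weight α x

theorem intervalIntegrable_pairing {α : ℝ} (hα : 0 ≤ α) {ψ p : ℝ → ℝ}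
    (hψ : ContinuousOn ψ (Icc (-1) 1)) (hp : Continuous p) :
    IntervalIntegrable (fun x => p x * ψ x * weight α x) volume (-1) 1 := by
  apply ContinuousOn.intervalIntegrable
  rw [uIcc_of_le (by norm_num)]
  exact (hp.continuousOn.mul hψ).mul (continuous_weight hα).continuousOn

theorem pairing_add {α : ℝ} (hα : 0 ≤ α) {ψ p r : ℝ → ℝ} (hψ : ContinuousOn ψ (Icc (-1) 1))
    (hp : Continuous p) (hr : Continuous r) :
    pairing α ψ (fun x => p x + r x) = pairing α ψ p + pairing α ψ r := by
  rw [pairing, pairing, pairing, ← intervalIntegral.integral_add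
    (intervalIntegrable_pairing hα hψ hp) (intervalIntegrable_pairing hα hψ hr)]
  exact integral_congr fun x _ => by ring

theorem pairing_const_mul (α a : ℝ) (ψ p : ℝ → ℝ) :
    pairing α ψ (fun x => a * p x) = a * pairing α ψ p := by
  rw [pairing, pairing, ← intervalIntegral.integral_const_mul]
  exact integral_congr fun x _ => by ring

theorem pairing_pow (α : ℝ) (ψ : ℝ → ℝ) (j : ℕ) : pairing α ψ (fun x => x ^ j) = moment α ψ j := rfl

/-- The three term recursion for the moments, from the self-adjointness of `L_c`. -/
theorem IsSolution.moment_add_two {α c χ : ℝ} (hα : 0 ≤ α) {ψ ψ' : ℝ → ℝ}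
    (h : IsSolution α c χ ψ ψ') (j : ℕ) :
    c ^ 2 * moment α ψ (j + 2) =
      (χ - j * (j + 2 * α + 1)) * moment α ψ j + j * (j - 1) * moment α ψ (j - 2) := by
  have key := h.integral_adjoint hα (f := fun x => x ^ j) (f1 := fun x => j * x ^ (j - 1))
    (f2 := fun x => j * ((j - 1 : ℕ) * x ^ (j - 1 - 1))) (fun x => hasDerivAt_pow j x)
    (fun x => (hasDerivAt_pow (j - 1) x).const_mul _) (by fun_prop)
  have hp : ∀ (i : ℕ), Continuous fun x : ℝ => x ^ i := fun i => by fun_prop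
  have : pairing α ψ (fun x => (χ - j * (j + 2 * α + 1)) * x ^ j +
      (j * (j - 1) * x ^ (j - 2) + -c ^ 2 * x ^ (j + 2))) = 0 := by
    rw [← key, pairing]
    refine integral_congr fun x _ => ?_
    congr 2
    rcases j with _ | _ | j
    · simp; ring
    · simp; ring
    · simp only [Nat.add_one_sub_one]
      push_cast
      ring
  rw [pairing_add hα h.cont (by fun_prop) (by fun_prop),
    pairing_add hα h.cont (by fun_prop) (by fun_prop), pairing_const_mul, pairing_const_mul,
    pairing_const_mul, pairing_pow, pairing_pow, pairing_pow] at this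
  linarith

/-- Moments of index `j` with `j (j + 2 α + 1) ≤ χ` have the sign of the first two, and `q ^ (j / 2)`
times the moment is dominated by the corresponding bound for the first two. Here `r = √q`. -/
theorem moment_bounds {α c χ r B : ℝ} (hα : 0 ≤ α) (hχ : 0 < χ) (hr0 : 0 < r) (hr1 : r ≤ 1)
    (hq : c ^ 2 = r ^ 2 * χ) {m : ℕ → ℝ}
    (hm : ∀ j : ℕ, c ^ 2 * m (j + 2) = (χ - j * (j + 2 * α + 1)) * m j + j * (j - 1) * m (j - 2))
    (h0 : 0 ≤ m 0) (h1 : 0 ≤ m 1) (h0B : m 0 ≤ B) (h1B : r * m 1 ≤ B) (j : ℕ)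
    (hj : (j : ℝ) * (j + 2 * α + 1) ≤ χ) : 0 ≤ m j ∧ r ^ j * m j ≤ B := by
  have hB : 0 ≤ B := h0.trans h0B
  induction j using Nat.strong_induction_on with
  | _ j ih =>
    match j, hj with
    | 0, _ => exact ⟨h0, by simpa using h0B⟩
    | 1, _ => exact ⟨h1, by simpa using h1B⟩
    | j + 2, hj =>
      push_cast at hj
      have hj0 : (0 : ℝ) ≤ j := by positivity
      have hjχ : (j : ℝ) * (j + 2 * α + 1) ≤ χ := by nlinarith
      obtain ⟨a1, a2⟩ := ih j (by omega) hjχ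
      have hc : 0 < c ^ 2 := by rw [hq]; positivity
      have hrec := hm j
      -- the last term of the recursion, which is absent for `j < 2`
      obtain ⟨b1, b2⟩ : 0 ≤ (j : ℝ) * (j - 1) * m (j - 2) ∧
          r ^ j * ((j : ℝ) * (j - 1) * m (j - 2)) ≤ (j : ℝ) * (j + 2 * α + 1) * B := by
        match j, ih, hjχ with
        | 0, _, _ => simp
        | 1, _, _ =>
          simp only [Nat.cast_one, sub_self, mul_zero, zero_mul, le_refl, true_and]
          positivity
        | i + 2, ih, hjχ =>
          have hi0 : (0 : ℝ) ≤ i := by positivity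
          push_cast at hjχ ⊢
          obtain ⟨c1, c2⟩ := ih i (by omega) (by nlinarith)
          have hp : (0 : ℝ) ≤ (i + 2) * (i + 2 - 1) := by
            have : (0 : ℝ) ≤ i + 2 - 1 := by linarith
            positivity
          refine ⟨mul_nonneg hp c1, ?_⟩
          have hr2 : r ^ 2 ≤ 1 := pow_le_one₀ hr0.le hr1
          have c3 : 0 ≤ r ^ i * m i := by positivity
          calc r ^ (i + 2) * ((i + 2) * (i + 2 - 1) * m i)
              = (i + 2) * (i + 2 - 1) * (r ^ 2 * (r ^ i * m i)) := by ring
            _ ≤ (i + 2) * (i + 2 - 1) * (1 * B) := by gcongr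
            _ ≤ (i + 2) * (i + 2 + 2 * α + 1) * B := by
              rw [one_mul]
              gcongr
              linarith
      refine ⟨?_, ?_⟩
      · refine nonneg_of_mul_nonneg_right (a := c ^ 2) ?_ hc
        rw [hrec]
        have := mul_nonneg (sub_nonneg.2 hjχ) a1
        linarith
      · refine le_of_mul_le_mul_left ?_ hχ
        have e : χ * (r ^ (j + 2) * m (j + 2)) = r ^ j * (c ^ 2 * m (j + 2)) := by rw [hq]; ring
        rw [e, hrec]
        have := mul_le_mul_of_nonneg_left a2 (sub_nonneg.2 hjχ)
        linarith

/-! ### Jacobi polynomials -/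

open Polynomial in
/-- The Jacobi polynomial of degree `k` for the weight `ω_α`, normalized to have the value `1` at
`1`. -/
noncomputable def gegenbauer (α : ℝ) : ℕ → ℝ[X]
  | 0 => 1
  | 1 => X
  | k + 2 => C ((2 * k + 2 * α + 3) / (k + 2 * α + 2)) * X * gegenbauer α (k + 1) -
      C ((k + 1) / (k + 2 * α + 2)) * gegenbauer α k

theorem gegenbauer_rec {α : ℝ} (hα : 0 ≤ α) (k : ℕ) (x : ℝ) :
    (k + 2 * α + 1) * (gegenbauer α (k + 1)).eval x =
      (2 * k + 2 * α + 1) * x * (gegenbauer α k).eval x - k * (gegenbauer α (k - 1)).eval x := by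
  rcases k with _ | k
  · simp [gegenbauer]
  · have : (k : ℝ) + 2 * α + 2 ≠ 0 := by positivity
    simp only [gegenbauer, Polynomial.eval_sub, Polynomial.eval_mul, Polynomial.eval_C,
      Polynomial.eval_X, Nat.add_sub_cancel]
    push_cast
    rw [show (k : ℝ) + 1 + 2 * α + 1 = k + 2 * α + 2 by ring]
    field_simp
    ring

/-- The derivative of the recursion. -/
theorem gegenbauer_deriv_rec {α : ℝ} (hα : 0 ≤ α) (k : ℕ) (x : ℝ) :
    (k + 2 * α + 2) * (gegenbauer α (k + 2)).derivative.eval x =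
      (2 * k + 2 * α + 3) * ((gegenbauer α (k + 1)).eval x +
        x * (gegenbauer α (k + 1)).derivative.eval x) -
      (k + 1) * (gegenbauer α k).derivative.eval x := by
  have : (k : ℝ) + 2 * α + 2 ≠ 0 := by positivity
  simp only [gegenbauer, Polynomial.derivative_sub, Polynomial.derivative_mul,
    Polynomial.derivative_C, Polynomial.derivative_X, Polynomial.eval_sub, Polynomial.eval_add,
    Polynomial.eval_mul, Polynomial.eval_C, Polynomial.eval_X, Polynomial.eval_zero,
    Polynomial.eval_one]
  field_simp
  ring

/-- The classical first order relation `(1 - x²) R_k' = k (R_{k-1} - x R_k)`. -/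
theorem gegenbauer_deriv {α : ℝ} (hα : 0 ≤ α) (k : ℕ) (x : ℝ) :
    (1 - x ^ 2) * (gegenbauer α k).derivative.eval x =
      k * ((gegenbauer α (k - 1)).eval x - x * (gegenbauer α k).eval x) := by
  suffices h : ∀ k : ℕ, (1 - x ^ 2) * (gegenbauer α k).derivative.eval x =
      k * ((gegenbauer α (k - 1)).eval x - x * (gegenbauer α k).eval x) ∧
      (1 - x ^ 2) * (gegenbauer α (k + 1)).derivative.eval x =
      (k + 1) * ((gegenbauer α k).eval x - x * (gegenbauer α (k + 1)).eval x) from (h k).1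
  intro k
  induction k with
  | zero => simp [gegenbauer]; ring
  | succ k ih =>
    obtain ⟨h1, h2⟩ := ih
    refine ⟨by simpa using h2, ?_⟩
    have hne : (k : ℝ) + 2 * α + 2 ≠ 0 := by positivity
    have r1 := gegenbauer_rec hα k x
    have r2 := gegenbauer_rec hα (k + 1) x
    have r3 := gegenbauer_deriv_rec hα k x
    rw [Nat.add_sub_cancel] at r2
    push_cast at r2 ⊢
    refine mul_left_cancel₀ hne ?_
    linear_combination (1 - x ^ 2) * r3 + (2 * k + 2 * α + 3) * x * h2 - (k + 1) * h1 -
      (k + 1) * r1 + (k + 2) * x * r2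

/-- The differential equation of the Jacobi polynomials. -/
theorem gegenbauer_ode {α : ℝ} (hα : 0 ≤ α) (k : ℕ) (x : ℝ) :
    (1 - x ^ 2) * (gegenbauer α k).derivative.derivative.eval x -
      (2 * α + 2) * x * (gegenbauer α k).derivative.eval x +
      k * (k + 2 * α + 1) * (gegenbauer α k).eval x = 0 := by
  rcases k with _ | k
  · simp [gegenbauer]
  have hA : (1 - Polynomial.X ^ 2) * (gegenbauer α (k + 1)).derivative =
      Polynomial.C (k + 1 : ℝ) * (gegenbauer α k - Polynomial.X * gegenbauer α (k + 1)) := by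
    refine Polynomial.funext fun y => ?_
    simpa using gegenbauer_deriv hα (k + 1) y
  have hA' := congrArg Polynomial.derivative hA
  have hW : (1 - Polynomial.X ^ 2 : Polynomial ℝ) ≠ 0 := by
    intro h
    have := congrArg (Polynomial.eval 0) h
    simp at this
  have hQ : (1 - Polynomial.X ^ 2 : Polynomial ℝ) *
      ((1 - Polynomial.X ^ 2) * (gegenbauer α (k + 1)).derivative.derivative -
      Polynomial.C (2 * α + 2) * Polynomial.X * (gegenbauer α (k + 1)).derivative +
      Polynomial.C ((k + 1) * (k + 1 + 2 * α + 1)) * gegenbauer α (k + 1)) = 0 := by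
    refine Polynomial.funext fun y => ?_
    have e1 := congrArg (Polynomial.eval y) hA'
    have e2 := gegenbauer_deriv hα (k + 1) y
    have e3 := gegenbauer_deriv hα k y
    have e4 := gegenbauer_rec hα k y
    simp at e1 e2
    simp only [Polynomial.eval_mul, Polynomial.eval_sub, Polynomial.eval_add, Polynomial.eval_one,
      Polynomial.eval_pow, Polynomial.eval_X, Polynomial.eval_C, Polynomial.eval_zero]
    linear_combination (1 - y ^ 2) * e1 + (k + 1) * e3 + (-(k + 1) * y - 2 * α * y) * e2 +
      (k + 1) * e4
  have := congrArg (Polynomial.eval x) ((mul_eq_zero.1 hQ).resolve_left hW)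
  simpa using this

theorem gegenbauer_isSolution {α : ℝ} (hα : 0 ≤ α) (k : ℕ) :
    IsSolution α 0 (k * (k + 2 * α + 1)) (fun x => (gegenbauer α k).eval x)
      (fun x => (gegenbauer α k).derivative.eval x) := by
  refine ⟨(Polynomial.continuous _).continuousOn, (Polynomial.continuous _).continuousOn,
    fun x _ => Polynomial.hasDerivAt _ x, fun x hx => ?_⟩
  refine (Polynomial.hasDerivAt _ x).congr_deriv ?_
  rw [eq_div_iff (one_sub_sq_pos hx).ne']
  linear_combination gegenbauer_ode hα k x

theorem pairing_congr {α : ℝ} {ψ p r : ℝ → ℝ} (h : ∀ x, p x = r x) :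
    pairing α ψ p = pairing α ψ r := by rw [funext h]

/-- The pairing with the action of `L_c` on a Jacobi polynomial. -/
theorem IsSolution.pairing_sq_mul_gegenbauer {α c χ : ℝ} (hα : 0 ≤ α) {ψ ψ' : ℝ → ℝ}
    (h : IsSolution α c χ ψ ψ') (k : ℕ) :
    c ^ 2 * pairing α ψ (fun x => x ^ 2 * (gegenbauer α k).eval x) =
      (χ - k * (k + 2 * α + 1)) * pairing α ψ (fun x => (gegenbauer α k).eval x) := by
  have key := h.integral_adjoint hα (f := fun x => (gegenbauer α k).eval x)
    (fun x => Polynomial.hasDerivAt _ x) (fun x => Polynomial.hasDerivAt _ x)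
    (Polynomial.continuous _)
  have cg := (gegenbauer α k).continuous
  have : pairing α ψ (fun x => (χ - k * (k + 2 * α + 1)) * (gegenbauer α k).eval x +
      -c ^ 2 * (x ^ 2 * (gegenbauer α k).eval x)) = 0 := by
    rw [← key, pairing]
    refine integral_congr fun x _ => ?_
    congr 2
    linear_combination -gegenbauer_ode hα k x
  rw [pairing_add hα h.cont (by fun_prop) (by fun_prop), pairing_const_mul, pairing_const_mul] at this
  linarith

/-- Orthogonality: the two polynomials solve the equation with `c = 0` for different eigenvalues. -/
theorem integral_gegenbauer_mul {α : ℝ} (hα : 0 ≤ α) {j k : ℕ} (hjk : j < k) :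
    pairing α (fun x => (gegenbauer α j).eval x) (fun x => (gegenbauer α k).eval x) = 0 := by
  have := (gegenbauer_isSolution hα j).pairing_sq_mul_gegenbauer hα k
  have hj : (j : ℝ) < k := by exact_mod_cast hjk
  have hj0 : (0 : ℝ) ≤ j := by positivity
  have hne : (j : ℝ) * (j + 2 * α + 1) - k * (k + 2 * α + 1) ≠ 0 := by nlinarith
  rw [zero_pow two_ne_zero, zero_mul] at this
  exact (mul_eq_zero.1 this.symm).resolve_left hne

/-- The square of the norm of the polynomial `gegenbauer α k`. -/
noncomputable def normSq (α : ℝ) (k : ℕ) : ℝ :=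
  pairing α (fun x => (gegenbauer α k).eval x) (fun x => (gegenbauer α k).eval x)

theorem normSq_zero (α : ℝ) : normSq α 0 = mass α := by
  simp [normSq, pairing, gegenbauer, mass]

theorem pairing_comm (α : ℝ) (p r : ℝ → ℝ) : pairing α p r = pairing α r p :=
  integral_congr fun x _ => by ring

/-- The recursion is paired with the neighbouring polynomials, and the integral of `x R_k R_{k+1}` is
eliminated. -/
theorem normSq_succ {α : ℝ} (hα : 0 ≤ α) (k : ℕ) :
    (k + 2 * α + 1) * (2 * k + 2 * α + 3) * normSq α (k + 1) =
      (2 * k + 2 * α + 1) * (k + 1) * normSq α k := by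
  have c0 : ∀ j, Continuous fun x => (gegenbauer α j).eval x := fun j => (gegenbauer α j).continuous
  have c1 := fun j => (c0 j).continuousOn (s := Icc (-1 : ℝ) 1)
  have ck := c0 k
  have ck1 := c0 (k + 1)
  have ck2 := c0 (k + 2)
  have ckm := c0 (k - 1)
  set G := fun j => fun x : ℝ => (gegenbauer α j).eval x with hG
  have e1 : (k + 2 * α + 1) * pairing α (G (k + 1)) (G (k + 1)) =
      (2 * k + 2 * α + 1) * pairing α (G (k + 1)) (fun x => x * G k x) := by
    rw [← pairing_const_mul, pairing_congr (r := fun x => (2 * k + 2 * α + 1) * (x * G k x) +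
      -k * G (k - 1) x) fun x => by have := gegenbauer_rec hα k x; simp only [hG]; linarith,
      pairing_add hα (c1 _) (by fun_prop) (by fun_prop), pairing_const_mul, pairing_const_mul,
      pairing_comm α (G (k + 1)) (G (k - 1)), integral_gegenbauer_mul hα (by omega : k - 1 < k + 1)]
    ring
  have e2 : (2 * k + 2 * α + 3) * pairing α (G (k + 1)) (fun x => x * G k x) =
      (k + 1) * pairing α (G k) (G k) := by
    have : pairing α (G (k + 1)) (fun x => x * G k x) =
        pairing α (G k) (fun x => x * G (k + 1) x) := integral_congr fun x _ => by ring
    rw [this, ← pairing_const_mul, pairing_congr (r := fun x => (k + 2 * α + 2) * G (k + 2) x +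
      (k + 1) * G k x) fun x => by
        have := gegenbauer_rec hα (k + 1) x
        push_cast at this
        simp only [hG]
        linarith,
      pairing_add hα (c1 _) (by fun_prop) (by fun_prop), pairing_const_mul, pairing_const_mul,
      integral_gegenbauer_mul hα (by omega : k < k + 2)]
    ring
  unfold normSq
  linear_combination (2 * k + 2 * α + 3) * e1 + (2 * k + 2 * α + 1) * e2

theorem normSq_pos {α : ℝ} (hα : 0 ≤ α) (k : ℕ) : 0 < normSq α k := by
  induction k with
  | zero => rw [normSq_zero]; exact mass_pos hα
  | succ k ih =>
    have h1 := normSq_succ hα k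
    have : 0 < (2 * k + 2 * α + 1) * (k + 1) * normSq α k := by positivity
    rw [← h1] at this
    exact pos_of_mul_pos_right this (by positivity)

/-- The ratio between the classical normalization of the Jacobi polynomials and the one by the value
at `1`. -/
noncomputable def jacobiAtOne (α : ℝ) : ℕ → ℝ
  | 0 => 1
  | k + 1 => jacobiAtOne α k * ((k + 1 + α) / (k + 1))

theorem jacobiAtOne_pos {α : ℝ} (hα : 0 ≤ α) (k : ℕ) : 0 < jacobiAtOne α k := by
  induction k with
  | zero => exact one_pos
  | succ k ih => rw [jacobiAtOne]; positivity

/-- The recursion in the definition of `jacobi` and that of `gegenbauer` differ by the factors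
`jacobiAtOne`. -/
theorem jacobi_eq {α : ℝ} (hα : 0 ≤ α) (k : ℕ) (x : ℝ) :
    jacobi α k x = jacobiAtOne α k * (gegenbauer α k).eval x := by
  suffices h : ∀ k : ℕ, jacobi α k x = jacobiAtOne α k * (gegenbauer α k).eval x ∧
      jacobi α (k + 1) x = jacobiAtOne α (k + 1) * (gegenbauer α (k + 1)).eval x from (h k).1
  intro k
  induction k with
  | zero =>
    simp [jacobi, jacobiAtOne, gegenbauer, add_comm]
  | succ k ih =>
    refine ⟨ih.2, ?_⟩
    rw [jacobi, ih.1, ih.2]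
    simp only [jacobiAtOne, gegenbauer, Polynomial.eval_sub, Polynomial.eval_mul, Polynomial.eval_C,
      Polynomial.eval_X]
    have h1 : (k : ℝ) + 2 * α + 2 ≠ 0 := by positivity
    have h2 : (k : ℝ) + 1 + 2 * α + 1 ≠ 0 := by positivity
    have h3 : 2 * ((k : ℝ) + 1) + 2 * α ≠ 0 := by positivity
    push_cast
    field_simp
    ring

theorem jacobiNormalized_eq {α : ℝ} (hα : 0 ≤ α) (k : ℕ) (x : ℝ) :
    jacobiNormalized α k x = (gegenbauer α k).eval x / √(normSq α k) := by
  have h1 := jacobiAtOne_pos hα k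
  have : ∫ y in (-1 : ℝ)..1, jacobi α k y ^ 2 * weight α y = jacobiAtOne α k ^ 2 * normSq α k := by
    rw [normSq, pairing, ← intervalIntegral.integral_const_mul]
    refine integral_congr fun y _ => ?_
    simp only [jacobi_eq hα]
    ring
  rw [jacobiNormalized, this, jacobi_eq hα, Real.sqrt_mul (sq_nonneg _), Real.sqrt_sq h1.le,
    mul_div_mul_left _ _ h1.ne']

theorem continuous_jacobiNormalized {α : ℝ} (hα : 0 ≤ α) (k : ℕ) :
    Continuous (jacobiNormalized α k) := by
  rw [funext (jacobiNormalized_eq hα k)]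
  exact (gegenbauer α k).continuous.div_const _

/-- Multiplication by `x` acts on the orthonormal polynomials by the Jacobi matrix. -/
theorem mul_jacobiNormalized {α : ℝ} (hα : 0 ≤ α) (k : ℕ) (x : ℝ) :
    x * jacobiNormalized α k x = √(jacobiSq α (k + 1)) * jacobiNormalized α (k + 1) x +
      √(jacobiSq α k) * jacobiNormalized α (k - 1) x := by
  have hJ : ∀ k : ℕ, √(jacobiSq α (k + 1)) * ((2 * k + 2 * α + 1) * √(normSq α k)) =
      (k + 2 * α + 1) * √(normSq α (k + 1)) ∧ √(jacobiSq α (k + 1)) *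
        ((2 * k + 2 * α + 3) * √(normSq α (k + 1))) = (k + 1) * √(normSq α k) := by
    intro k
    have h := normSq_succ hα k
    have p1 := normSq_pos hα k
    have p2 := normSq_pos hα (k + 1)
    have hj := jacobiSq_succ_pos hα k
    have hD : jacobiSq α (k + 1) * ((2 * k + 2 * α + 1) * (2 * k + 2 * α + 3)) =
        (k + 1) * (k + 1 + 2 * α) := by
      rw [jacobiSq_succ, div_mul_cancel₀ _ (by positivity)]
    have n1 : (2 : ℝ) * k + 2 * α + 1 ≠ 0 := by positivity
    have n3 : (2 : ℝ) * k + 2 * α + 3 ≠ 0 := by positivity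
    constructor
    · rw [← sq_eq_sq₀ (by positivity) (by positivity)]
      simp only [mul_pow]
      rw [Real.sq_sqrt hj.le, Real.sq_sqrt p1.le, Real.sq_sqrt p2.le]
      refine mul_left_cancel₀ n3 ?_
      linear_combination (2 * k + 2 * α + 1) * normSq α k * hD - (k + 2 * α + 1) * h
    · rw [← sq_eq_sq₀ (by positivity) (by positivity)]
      simp only [mul_pow]
      rw [Real.sq_sqrt hj.le, Real.sq_sqrt p1.le, Real.sq_sqrt p2.le]
      refine mul_left_cancel₀ n1 ?_
      linear_combination (2 * k + 2 * α + 3) * normSq α (k + 1) * hD + (k + 1) * h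
  have s0 : ∀ j, √(normSq α j) ≠ 0 := fun j => (Real.sqrt_pos.2 (normSq_pos hα j)).ne'
  have hn : (2 : ℝ) * k + 2 * α + 1 ≠ 0 := by positivity
  have a1 : √(jacobiSq α (k + 1)) / √(normSq α (k + 1)) =
      (k + 2 * α + 1) / ((2 * k + 2 * α + 1) * √(normSq α k)) := by
    rw [div_eq_div_iff (s0 _) (mul_ne_zero hn (s0 _))]
    exact (hJ k).1
  have a2 : √(jacobiSq α k) / √(normSq α (k - 1)) =
      k / ((2 * k + 2 * α + 1) * √(normSq α k)) := by
    rcases k with _ | k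
    · simp [jacobiSq]
    · rw [div_eq_div_iff (s0 _) (mul_ne_zero hn (s0 _))]
      have := (hJ k).2
      rw [Nat.add_sub_cancel]
      push_cast
      linarith
  simp only [jacobiNormalized_eq hα]
  have hr := gegenbauer_rec hα k x
  calc x * ((gegenbauer α k).eval x / √(normSq α k)) =
      ((k + 2 * α + 1) * (gegenbauer α (k + 1)).eval x + k * (gegenbauer α (k - 1)).eval x) /
        ((2 * k + 2 * α + 1) * √(normSq α k)) := by
        rw [hr, mul_div_assoc', div_eq_div_iff (s0 _) (mul_ne_zero hn (s0 _))]
        ring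
    _ = (k + 2 * α + 1) / ((2 * k + 2 * α + 1) * √(normSq α k)) * (gegenbauer α (k + 1)).eval x +
        k / ((2 * k + 2 * α + 1) * √(normSq α k)) * (gegenbauer α (k - 1)).eval x := by ring
    _ = _ := by rw [← a1, ← a2]; ring

/-! ### The entries of the Jacobi matrix -/

theorem four_mul_jacobiSq {α : ℝ} (hα : 0 ≤ α) (k : ℕ) : 4 * jacobiSq α (k + 1) =
    1 + (1 - 4 * α ^ 2) / ((2 * k + 2 * α + 1) * (2 * k + 2 * α + 3)) := by
  rw [jacobiSq_succ]
  field_simp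
  ring

theorem jacobiSq_le_of_half_le {α : ℝ} (hα : 1 / 2 ≤ α) (k : ℕ) : jacobiSq α k ≤ 1 / 4 := by
  rcases k with _ | k
  · simp [jacobiSq]
  · have h := four_mul_jacobiSq (by linarith : 0 ≤ α) k
    have h0 : 0 ≤ α := by linarith
    have : (1 - 4 * α ^ 2) / ((2 * k + 2 * α + 1) * (2 * k + 2 * α + 3)) ≤ 0 :=
      div_nonpos_of_nonpos_of_nonneg (by nlinarith) (by positivity)
    linarith

theorem jacobiSq_anti {α : ℝ} (hα : α ∈ Icc (0 : ℝ) (1 / 2)) {j k : ℕ} (h : j ≤ k) :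
    jacobiSq α (k + 1) ≤ jacobiSq α (j + 1) := by
  obtain ⟨h0, h1⟩ := hα
  have e1 := four_mul_jacobiSq h0 j
  have e2 := four_mul_jacobiSq h0 k
  have hjk : (j : ℝ) ≤ k := by exact_mod_cast h
  have : (1 - 4 * α ^ 2) / ((2 * k + 2 * α + 1) * (2 * k + 2 * α + 3)) ≤
      (1 - 4 * α ^ 2) / ((2 * j + 2 * α + 1) * (2 * j + 2 * α + 3)) := by
    have : 0 ≤ 1 - 4 * α ^ 2 := by nlinarith
    gcongr
  linarith

theorem jacobiSq_one {α : ℝ} (hα : 0 ≤ α) : jacobiSq α 1 = 1 / (2 * α + 3) := by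
  have := jacobiSq_succ α 0
  rw [zero_add] at this
  rw [this]
  push_cast
  field_simp
  ring

theorem jacobiSq_two (α : ℝ) : jacobiSq α 2 = 2 * (2 * α + 2) / ((2 * α + 3) * (2 * α + 5)) := by
  have := jacobiSq_succ α 1
  rw [show 1 + 1 = 2 from rfl] at this
  rw [this]
  push_cast
  congr 1 <;> ring

theorem jacobiSq_nonneg {α : ℝ} (hα : 0 ≤ α) (k : ℕ) : 0 ≤ jacobiSq α k := by
  rcases k with _ | k
  · simp [jacobiSq]
  · exact (jacobiSq_succ_pos hα k).le

/-- For `α ≥ 1 / 2` all entries are at most `1 / 2`; for `α ≤ 1 / 2` they decrease, so the first product is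
the largest. -/
theorem sqrt_jacobiSq_mul_le {α : ℝ} (hα : 0 ≤ α) (k : ℕ) :
    √(jacobiSq α k) * √(jacobiSq α (k + 1)) ≤ constM α := by
  rw [← Real.sqrt_mul (jacobiSq_nonneg hα k)]
  have n1 := jacobiSq_nonneg hα k
  have n2 := jacobiSq_nonneg hα (k + 1)
  rcases le_total (1 / 2) α with h | h
  · refine le_trans (Real.sqrt_le_left (by norm_num) |>.2 ?_) (le_max_left _ _)
    have := jacobiSq_le_of_half_le h k
    have := jacobiSq_le_of_half_le h (k + 1)
    nlinarith
  · refine le_trans (Real.sqrt_le_sqrt ?_) (le_max_right _ _)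
    have e : 2 * (2 * α + 2) / ((2 * α + 5) * (2 * α + 3) ^ 2) = jacobiSq α 1 * jacobiSq α 2 := by
      rw [jacobiSq_one hα, jacobiSq_two]
      field_simp
    rw [e]
    rcases k with _ | k
    · have : jacobiSq α 0 = 0 := by simp [jacobiSq]
      rw [this, zero_mul]
      exact mul_nonneg (jacobiSq_nonneg hα _) (jacobiSq_nonneg hα _)
    · exact mul_le_mul (jacobiSq_anti ⟨hα, h⟩ (Nat.zero_le k))
        (jacobiSq_anti ⟨hα, h⟩ (by omega : 1 ≤ k + 1)) n2 (jacobiSq_nonneg hα _)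

theorem jacobiSq_add_le {α : ℝ} (hα : 0 ≤ α) (k : ℕ) :
    jacobiSq α k + jacobiSq α (k + 1) ≤ constN α := by
  have h3 : jacobiSq α 1 + jacobiSq α 2 = 3 / (2 * α + 5) := by
    rw [jacobiSq_one hα, jacobiSq_two]
    field_simp
    ring
  rcases le_total (1 / 2) α with h | h
  · have h1 := jacobiSq_le_of_half_le h k
    have h2 := jacobiSq_le_of_half_le h (k + 1)
    refine le_trans ?_ (le_max_right _ _)
    have : 0 ≤ |4 * α ^ 2 - 1| / ((2 * α + 3) * (2 * α + 7)) := by positivity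
    linarith
  · refine le_trans ?_ (le_max_left _ _)
    rw [← h3]
    rcases k with _ | k
    · have h0 : jacobiSq α 0 = 0 := by simp [jacobiSq]
      have := jacobiSq_nonneg hα 2
      rw [h0]
      linarith
    · exact add_le_add (jacobiSq_anti ⟨hα, h⟩ (Nat.zero_le k))
        (jacobiSq_anti ⟨hα, h⟩ (by omega : 1 ≤ k + 1))

/-! ### The expansion coefficients -/

theorem coeff_eq_pairing (α : ℝ) (ψ : ℝ → ℝ) (k : ℕ) :
    coeff α ψ k = pairing α ψ (jacobiNormalized α k) := rfl

theorem coeff_eq_pairing_gegenbauer {α : ℝ} (hα : 0 ≤ α) (ψ : ℝ → ℝ) (k : ℕ) :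
    coeff α ψ k = 1 / √(normSq α k) * pairing α ψ (fun x => (gegenbauer α k).eval x) := by
  rw [coeff_eq_pairing, ← pairing_const_mul]
  exact pairing_congr fun x => by rw [jacobiNormalized_eq hα]; ring

theorem coeff_zero {α : ℝ} (hα : 0 ≤ α) (ψ : ℝ → ℝ) :
    coeff α ψ 0 = moment α ψ 0 / √(mass α) := by
  rw [coeff_eq_pairing_gegenbauer hα, normSq_zero, ← pairing_pow,
    pairing_congr (r := fun x => x ^ 0) fun x => by simp [gegenbauer]]
  ring

theorem coeff_one {α : ℝ} (hα : 0 ≤ α) (ψ : ℝ → ℝ) :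
    coeff α ψ 1 = moment α ψ 1 / √(normSq α 1) := by
  rw [coeff_eq_pairing_gegenbauer hα, ← pairing_pow,
    pairing_congr (r := fun x => x ^ 1) fun x => by simp [gegenbauer]]
  ring

theorem sq_mul_jacobiNormalized {α : ℝ} (hα : 0 ≤ α) (k : ℕ) (x : ℝ) :
    x ^ 2 * jacobiNormalized α k x =
      √(jacobiSq α (k + 1)) * √(jacobiSq α (k + 2)) * jacobiNormalized α (k + 2) x +
        ((jacobiSq α k + jacobiSq α (k + 1)) * jacobiNormalized α k x +
          √(jacobiSq α k) * √(jacobiSq α (k - 1)) * jacobiNormalized α (k - 2) x) := by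
  have h1 := mul_jacobiNormalized hα k x
  have h2 := mul_jacobiNormalized hα (k + 1) x
  have h3 : √(jacobiSq α k) * (x * jacobiNormalized α (k - 1) x) = √(jacobiSq α k) *
      (√(jacobiSq α k) * jacobiNormalized α k x +
        √(jacobiSq α (k - 1)) * jacobiNormalized α (k - 2) x) := by
    rcases k with _ | k
    · simp [jacobiSq]
    · rw [Nat.add_sub_cancel, mul_jacobiNormalized hα k x]
      rfl
  have s1 := Real.mul_self_sqrt (jacobiSq_nonneg hα k)
  have s2 := Real.mul_self_sqrt (jacobiSq_nonneg hα (k + 1))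
  rw [Nat.add_sub_cancel] at h2
  linear_combination x * h1 + √(jacobiSq α (k + 1)) * h2 + h3 + jacobiNormalized α k x * (s1 + s2)

/-- The three term recursion for the coefficients: `L_c` is a five-diagonal matrix in the
orthonormal basis of Jacobi polynomials. -/
theorem IsSolution.coeff_add_two {α c χ : ℝ} (hα : 0 ≤ α) {ψ ψ' : ℝ → ℝ}
    (h : IsSolution α c χ ψ ψ') (k : ℕ) :
    c ^ 2 * (√(jacobiSq α (k + 1)) * √(jacobiSq α (k + 2)) * coeff α ψ (k + 2) +
      ((jacobiSq α k + jacobiSq α (k + 1)) * coeff α ψ k +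
        √(jacobiSq α k) * √(jacobiSq α (k - 1)) * coeff α ψ (k - 2))) =
      (χ - k * (k + 2 * α + 1)) * coeff α ψ k := by
  have c0 := fun j => continuous_jacobiNormalized hα j
  have c1 := c0 k
  have c2 := c0 (k + 2)
  have c3 := c0 (k - 2)
  have e1 : pairing α ψ (fun x => x ^ 2 * jacobiNormalized α k x) =
      1 / √(normSq α k) * pairing α ψ (fun x => x ^ 2 * (gegenbauer α k).eval x) := by
    rw [← pairing_const_mul]
    exact pairing_congr fun x => by rw [jacobiNormalized_eq hα]; ring
  have e2 := h.pairing_sq_mul_gegenbauer hα k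
  have e3 := coeff_eq_pairing_gegenbauer hα ψ k
  rw [pairing_congr (sq_mul_jacobiNormalized hα k),
    pairing_add hα h.cont (by fun_prop) (by fun_prop),
    pairing_add hα h.cont (by fun_prop) (by fun_prop), pairing_const_mul, pairing_const_mul,
    pairing_const_mul, ← coeff_eq_pairing, ← coeff_eq_pairing, ← coeff_eq_pairing] at e1
  rw [e1, e3]
  linear_combination 1 / √(normSq α k) * e2

/-- The coefficients `β_k` with `k (k + 2 α + 1) + C_α c² ≤ χ` have the sign of `β_0` and `β_1`: each
of the two subsequences of fixed parity is increasing. -/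
theorem coeff_nonneg {α c χ : ℝ} (hα : 0 ≤ α) (hc : 0 < c) {b : ℕ → ℝ}
    (hb : ∀ k : ℕ, c ^ 2 * (√(jacobiSq α (k + 1)) * √(jacobiSq α (k + 2)) * b (k + 2) +
      ((jacobiSq α k + jacobiSq α (k + 1)) * b k + √(jacobiSq α k) * √(jacobiSq α (k - 1)) * b (k - 2))) =
      (χ - k * (k + 2 * α + 1)) * b k) (h0 : 0 ≤ b 0) (h1 : 0 ≤ b 1) (k : ℕ)
    (hk : (k : ℝ) * (k + 2 * α + 1) + constC α * c ^ 2 ≤ χ) : 0 ≤ b k := by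
  have hM : 0 ≤ constM α := le_trans (by norm_num) (le_max_left _ _)
  have hJ0 : √(jacobiSq α 0) = 0 := by simp [jacobiSq]
  suffices h : ∀ k : ℕ, (k : ℝ) * (k + 2 * α + 1) + constC α * c ^ 2 ≤ χ →
      0 ≤ b k ∧ √(jacobiSq α k) * √(jacobiSq α (k - 1)) * b (k - 2) ≤ constM α * b k from (h k hk).1
  intro k
  induction k using Nat.strong_induction_on with
  | _ k ih =>
    intro hk
    match k, ih, hk with
    | 0, _, _ => exact ⟨h0, by rw [hJ0, zero_mul, zero_mul]; positivity⟩
    | 1, _, _ => exact ⟨h1, by rw [Nat.sub_self, hJ0, mul_zero, zero_mul]; positivity⟩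
    | k + 2, ih, hk =>
      have hk0 : (0 : ℝ) ≤ k := by positivity
      push_cast at hk
      have hk' : (k : ℝ) * (k + 2 * α + 1) + constC α * c ^ 2 ≤ χ := by nlinarith
      obtain ⟨p1, p2⟩ := ih k (by omega) hk'
      have hrec := hb k
      have hN := jacobiSq_add_le hα k
      have hMJ := sqrt_jacobiSq_mul_le hα (k + 1)
      have hpos : 0 < √(jacobiSq α (k + 1)) * √(jacobiSq α (k + 2)) :=
        mul_pos (Real.sqrt_pos.2 (jacobiSq_succ_pos hα _)) (Real.sqrt_pos.2 (jacobiSq_succ_pos hα _))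
      have hc2 : 0 < c ^ 2 := by positivity
      have hmono : b k ≤ b (k + 2) := by
        refine le_of_mul_le_mul_left ?_ (mul_pos hc2 hpos)
        have q1 : c ^ 2 * (2 * constM α + constN α) * b k ≤ (χ - k * (k + 2 * α + 1)) * b k := by
          refine mul_le_mul_of_nonneg_right ?_ p1
          unfold constC at hk'
          linarith
        have q2 : c ^ 2 * ((jacobiSq α k + jacobiSq α (k + 1)) * b k) ≤
            c ^ 2 * (constN α * b k) := by gcongr
        have q3 := mul_le_mul_of_nonneg_left p2 hc2.le
        have q4 : c ^ 2 * (√(jacobiSq α (k + 1)) * √(jacobiSq α (k + 2))) * b k ≤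
            c ^ 2 * constM α * b k := by gcongr
        linarith
      refine ⟨p1.trans hmono, ?_⟩
      simp only [Nat.add_sub_cancel]
      rw [mul_comm (√_), show k + 2 - 1 = k + 1 from rfl]
      calc _ ≤ constM α * b k := by gcongr
        _ ≤ _ := by gcongr

/-- A coefficient is dominated by the moment of the same index as long as all coefficients up to
this index have the sign `σ`: expand `x ^ i P̃_j` by the Jacobi matrix, whose entries are
nonnegative, and discard all terms except for the one of highest degree. -/
theorem prod_mul_coeff_le {α σ : ℝ} (hα : 0 ≤ α) {ψ : ℝ → ℝ} (hψ : ContinuousOn ψ (Icc (-1) 1))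
    (i j : ℕ) (h : ∀ l ≤ i + j, 0 ≤ σ * coeff α ψ l) :
    (∏ l ∈ Finset.range i, √(jacobiSq α (j + l + 1))) * (σ * coeff α ψ (j + i)) ≤
      σ * pairing α ψ (fun x => x ^ i * jacobiNormalized α j x) := by
  induction i generalizing j with
  | zero =>
    rw [Finset.prod_range_zero, one_mul, add_zero, coeff_eq_pairing]
    simp only [pow_zero, one_mul]
    exact le_rfl
  | succ i ih =>
    have c1 := continuous_jacobiNormalized hα (j + 1)
    have c2 := continuous_jacobiNormalized hα (j - 1)
    rw [pairing_congr (r := fun x => √(jacobiSq α (j + 1)) *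
      (x ^ i * jacobiNormalized α (j + 1) x) + √(jacobiSq α j) *
      (x ^ i * jacobiNormalized α (j - 1) x)) fun x => by
        linear_combination x ^ i * mul_jacobiNormalized hα j x,
      pairing_add hα hψ (by fun_prop) (by fun_prop), pairing_const_mul, pairing_const_mul,
      Finset.prod_range_succ']
    have h1 := ih (j + 1) fun l hl => h l (by omega)
    have h2 : 0 ≤ √(jacobiSq α j) *
        (σ * pairing α ψ fun x => x ^ i * jacobiNormalized α (j - 1) x) := by
      refine mul_nonneg (Real.sqrt_nonneg _) (le_trans ?_ (ih (j - 1) fun l hl => h l (by omega)))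
      exact mul_nonneg (Finset.prod_nonneg fun _ _ => Real.sqrt_nonneg _) (h _ (by omega))
    have h3 := mul_le_mul_of_nonneg_left h1 (Real.sqrt_nonneg (jacobiSq α (j + 1)))
    rw [show j + (i + 1) = j + 1 + i by ring]
    simp only [show ∀ l, j + (l + 1) + 1 = j + 1 + l + 1 from fun l => by ring, add_zero]
    linarith

/-- The case `j = 0` of `prod_mul_coeff_le`, squared. -/
theorem coeff_sq_le {α σ : ℝ} (hα : 0 ≤ α) {ψ : ℝ → ℝ} (hψ : ContinuousOn ψ (Icc (-1) 1))
    (hσ : σ ^ 2 = 1) (k : ℕ) (h : ∀ l ≤ k, 0 ≤ σ * coeff α ψ l) :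
    coeff α ψ k ^ 2 ≤ leadingSq α k * (4 ^ k * moment α ψ k ^ 2) := by
  have h1 := prod_mul_coeff_le hα hψ k 0 h
  have hm := mass_pos hα
  have e : pairing α ψ (fun x => x ^ k * jacobiNormalized α 0 x) = moment α ψ k / √(mass α) := by
    rw [pairing_congr (r := fun x => 1 / √(mass α) * x ^ k) fun x => by
      rw [jacobiNormalized_eq hα, normSq_zero]; simp [gegenbauer]; ring, pairing_const_mul,
      pairing_pow]
    ring
  rw [e, zero_add] at h1
  simp only [zero_add] at h1
  have h0 : 0 ≤ (∏ l ∈ Finset.range k, √(jacobiSq α (l + 1))) * (σ * coeff α ψ k) :=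
    mul_nonneg (Finset.prod_nonneg fun _ _ => Real.sqrt_nonneg _) (h k le_rfl)
  have h2 := pow_le_pow_left₀ h0 h1 2
  have hp : (∏ l ∈ Finset.range k, √(jacobiSq α (l + 1))) ^ 2 =
      ∏ l ∈ Finset.range k, jacobiSq α (l + 1) := by
    rw [← Finset.prod_pow]
    exact Finset.prod_congr rfl fun l _ => Real.sq_sqrt (jacobiSq_succ_pos hα l).le
  have hpos : 0 < ∏ l ∈ Finset.range k, jacobiSq α (l + 1) :=
    Finset.prod_pos fun l _ => jacobiSq_succ_pos hα l
  rw [mul_pow, mul_pow, mul_pow, div_pow, hσ, one_mul, one_mul, Real.sq_sqrt hm.le, hp,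
    le_div_iff₀ hm] at h2
  rw [leadingSq, Finset.prod_mul_distrib, Finset.prod_const, Finset.card_range]
  have : 1 / (mass α * (4 ^ k * ∏ l ∈ Finset.range k, jacobiSq α (l + 1))) *
      (4 ^ k * moment α ψ k ^ 2) =
      moment α ψ k ^ 2 / ((∏ l ∈ Finset.range k, jacobiSq α (l + 1)) * mass α) := by
    field_simp
  rw [this, le_div_iff₀ (by positivity)]
  linarith

end GPSWF

theorem mainTheorem2 (α c : ℝ) (hα : 0 ≤ α) (hc : 0 < c) (n : ℕ) (hn : 1 ≤ n)
    (χ : ℝ) (ψ : ℝ → ℝ) (hψ : GPSWF.IsGPSWF α c n χ ψ) (hq : c ^ 2 / χ ≤ 1) :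
    ∃ μ : ℂ, GPSWF.IsFourierEigenvalue α c ψ μ ∧
      (∀ k : ℕ, 1 ≤ k →
        (k : ℝ) * ((k : ℝ) + 2 * α + 1) + GPSWF.constC α * c ^ 2 ≤ χ →
        |GPSWF.coeff α ψ 0| ≤
            Real.sqrt (Real.Gamma (α + 3 / 2) / (Real.sqrt Real.pi * Real.Gamma (α + 1))) *
              Real.sqrt (1 + α) * ‖μ‖ ∧
          |GPSWF.coeff α ψ k| ≤ GPSWF.constC' α * (2 / (c ^ 2 / χ)) ^ k * ‖μ‖) ∧
      ∃ σ : ℝ, (σ = 1 ∨ σ = -1) ∧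
        (∀ j : ℕ, (j : ℝ) * ((j : ℝ) + 2 * α + 1) + GPSWF.constC α * c ^ 2 ≤ χ →
          0 ≤ σ * GPSWF.coeff α ψ j) ∧
        (∀ j : ℕ, (j : ℝ) * ((j : ℝ) + 2 * α + 1) ≤ χ →
          0 ≤ σ * GPSWF.moment α ψ j ∧
            σ * GPSWF.moment α ψ j ≤
              Real.sqrt (1 + α) * (1 / (c ^ 2 / χ)) ^ j * ‖μ‖) := by
  obtain ⟨hsol, hnorm, -⟩ := hψ
  have h := hsol.isSolution
  set ψ' := derivWithin ψ (Set.Icc (-1) 1)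
  have hχ := h.eigenvalue_pos hα hc hnorm
  set q := c ^ 2 / χ with hqdef
  have hq0 : 0 < q := by positivity
  have hcq : c ^ 2 = q * χ := by rw [hqdef]; field_simp
  obtain ⟨μ, hμ, hm0, hm1, hpar⟩ := h.exists_eigenvalue hα hχ hcq hq0.le hq hnorm
  obtain ⟨r, hr0, hr⟩ : ∃ r : ℝ, 0 < r ∧ r ^ 2 = q := ⟨√q, Real.sqrt_pos.2 hq0, Real.sq_sqrt hq0.le⟩
  have hr1 : r ≤ 1 := by nlinarith
  set Z := ψ 0 ^ 2 + ψ' 0 ^ 2 / χ with hZ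
  have hZ0 : 0 ≤ Z := by positivity
  have hZ1 : Z ≤ 1 + α := h.initial_le hα hχ hcq hq0.le hq hnorm
  have hpar' : GPSWF.moment α ψ 0 = 0 ∨ GPSWF.moment α ψ 1 = 0 :=
    hpar.imp_right fun h => (mul_eq_zero.1 h).resolve_left hc.ne'
  -- one of the first two moments vanishes, and the other one determines the sign
  obtain ⟨σ, hσ, hσ0, hσ1⟩ : ∃ σ : ℝ, (σ = 1 ∨ σ = -1) ∧ σ * GPSWF.moment α ψ 0 =
      |GPSWF.moment α ψ 0| ∧ σ * GPSWF.moment α ψ 1 = |GPSWF.moment α ψ 1| := by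
    rcases hpar' with h0 | h0 <;> rw [h0]
    · rcases le_total 0 (GPSWF.moment α ψ 1) with h1 | h1
      · exact ⟨1, Or.inl rfl, by simp, by rw [abs_of_nonneg h1, one_mul]⟩
      · exact ⟨-1, Or.inr rfl, by simp, by rw [abs_of_nonpos h1]; ring⟩
    · rcases le_total 0 (GPSWF.moment α ψ 0) with h1 | h1
      · exact ⟨1, Or.inl rfl, by rw [abs_of_nonneg h1, one_mul], by simp⟩
      · exact ⟨-1, Or.inr rfl, by rw [abs_of_nonpos h1]; ring, by simp⟩
  have hσsq : σ ^ 2 = 1 := by rcases hσ with rfl | rfl <;> norm_num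
  have hB0 : |GPSWF.moment α ψ 0| ≤ √Z * ‖μ‖ := by
    rw [hm0]
    gcongr
    exact Real.abs_le_sqrt (by rw [hZ]; linarith [show 0 ≤ ψ' 0 ^ 2 / χ by positivity])
  have hB1 : r * |GPSWF.moment α ψ 1| ≤ √Z * ‖μ‖ := by
    have hcr : c = r * √χ := by
      rw [← sq_eq_sq₀ hc.le (by positivity), mul_pow, Real.sq_sqrt hχ.le, hr, hcq]
    have e1 : √χ * (r * |GPSWF.moment α ψ 1|) = |ψ' 0| * ‖μ‖ := by
      rw [← hm1, abs_mul, abs_of_pos hc, hcr]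
      ring
    have e2 : |ψ' 0| ≤ √χ * √Z := by
      rw [← Real.sqrt_mul hχ.le]
      refine Real.abs_le_sqrt ?_
      rw [hZ, mul_add, mul_div_cancel₀ _ hχ.ne']
      linarith [show 0 ≤ χ * ψ 0 ^ 2 by positivity]
    refine le_of_mul_le_mul_left ?_ (Real.sqrt_pos.2 hχ)
    rw [e1, ← mul_assoc]
    gcongr
  have hmom : ∀ j : ℕ, (j : ℝ) * ((j : ℝ) + 2 * α + 1) ≤ χ →
      0 ≤ σ * GPSWF.moment α ψ j ∧ r ^ j * (σ * GPSWF.moment α ψ j) ≤ √Z * ‖μ‖ := by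
    refine GPSWF.moment_bounds (c := c) (m := fun j => σ * GPSWF.moment α ψ j) hα hχ hr0 hr1
      (by rw [hr, hcq]) (fun j => ?_) ?_ ?_ ?_ ?_
    · linear_combination σ * h.moment_add_two hα j
    · rw [hσ0]; positivity
    · rw [hσ1]; positivity
    · rw [hσ0]; exact hB0
    · rw [hσ1]; exact hB1
  have hcoef : ∀ j : ℕ, (j : ℝ) * ((j : ℝ) + 2 * α + 1) + GPSWF.constC α * c ^ 2 ≤ χ →
      0 ≤ σ * GPSWF.coeff α ψ j := by
    refine GPSWF.coeff_nonneg (b := fun j => σ * GPSWF.coeff α ψ j) hα hc (fun j => ?_) ?_ ?_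
    · linear_combination σ * h.coeff_add_two hα j
    · rw [GPSWF.coeff_zero hα, mul_div_assoc', hσ0]; positivity
    · rw [GPSWF.coeff_one hα, mul_div_assoc', hσ1]; positivity
  refine ⟨μ, hμ, fun k hk hkχ => ⟨?_, ?_⟩, σ, hσ, hcoef, fun j hj => ⟨(hmom j hj).1, ?_⟩⟩
  · have e : Real.Gamma (α + 3 / 2) / (√Real.pi * Real.Gamma (α + 1)) = (GPSWF.mass α)⁻¹ := by
      rw [GPSWF.mass_eq hα, inv_div]
    have : |GPSWF.moment α ψ 0| ≤ √(1 + α) * ‖μ‖ :=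
      hB0.trans (by gcongr)
    rw [GPSWF.coeff_zero hα, e, abs_div, abs_of_nonneg (Real.sqrt_nonneg _), Real.sqrt_inv,
      div_eq_inv_mul, mul_assoc]
    gcongr
  · obtain ⟨k, rfl⟩ : ∃ i, k = i + 1 := ⟨k - 1, by omega⟩
    have hC := GPSWF.one_le_constC hα
    have hk0 : (0 : ℝ) ≤ k := by positivity
    have hs : 2 * α + 2 + GPSWF.constC α * c ^ 2 ≤ χ := by
      push_cast at hkχ
      nlinarith
    have hkχ' : ((k + 1 : ℕ) : ℝ) * (((k + 1 : ℕ) : ℝ) + 2 * α + 1) ≤ χ := by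
      have : 0 ≤ GPSWF.constC α * c ^ 2 := by positivity
      linarith
    have h1 := GPSWF.coeff_sq_le hα h.cont hσsq (k + 1) fun l hl => hcoef l (by
      have : (l : ℝ) ≤ (k + 1 : ℕ) := by exact_mod_cast hl
      refine le_trans ?_ hkχ
      gcongr)
    have h2 := h.leadingSq_mul_le hα hχ hq0 hcq hnorm hs k
    have hl := GPSWF.leadingSq_pos hα (k + 1)
    obtain ⟨p1, p2⟩ := hmom (k + 1) hkχ'
    have h3 : q ^ (k + 1) * GPSWF.moment α ψ (k + 1) ^ 2 ≤ Z * ‖μ‖ ^ 2 := by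
      have := pow_le_pow_left₀ (mul_nonneg (by positivity) p1) p2 2
      rw [mul_pow, mul_pow, mul_pow, hσsq, Real.sq_sqrt hZ0, ← pow_mul, mul_comm (k + 1) 2,
        pow_mul, hr, one_mul] at this
      exact this
    have hC' := GPSWF.constC'_nonneg hα
    refine abs_le_of_sq_le_sq ?_ (by positivity)
    rw [mul_pow, mul_pow, ← pow_mul, mul_comm (k + 1) 2, pow_mul, div_pow]
    have hqk : q ^ (k + 1) ≤ q := by
      rw [pow_succ]
      exact mul_le_of_le_one_left hq0.le (pow_le_one₀ hq0.le hq)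
    have h4 : GPSWF.leadingSq α (k + 1) * (q ^ (k + 1) * Z) ≤ GPSWF.constC' α ^ 2 := by
      refine le_trans ?_ h2
      gcongr
    have h5 : 0 < q ^ (k + 1) := by positivity
    refine h1.trans ?_
    rw [div_pow, ← pow_mul, mul_comm 2 (k + 1), pow_mul, mul_div_assoc', div_mul_eq_mul_div,
      le_div_iff₀ (by positivity)]
    calc GPSWF.leadingSq α (k + 1) * (4 ^ (k + 1) * GPSWF.moment α ψ (k + 1) ^ 2) *
          (q ^ 2) ^ (k + 1) = GPSWF.leadingSq α (k + 1) * 4 ^ (k + 1) * q ^ (k + 1) *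
          (q ^ (k + 1) * GPSWF.moment α ψ (k + 1) ^ 2) := by ring
      _ ≤ GPSWF.leadingSq α (k + 1) * 4 ^ (k + 1) * q ^ (k + 1) * (Z * ‖μ‖ ^ 2) := by gcongr
      _ = GPSWF.leadingSq α (k + 1) * (q ^ (k + 1) * Z) * 4 ^ (k + 1) * ‖μ‖ ^ 2 := by ring
      _ ≤ GPSWF.constC' α ^ 2 * 4 ^ (k + 1) * ‖μ‖ ^ 2 := by gcongr
      _ = _ := by rw [← pow_mul, mul_comm (k + 1) 2, pow_mul]; norm_num
  · have hrj : 0 < r ^ j := by positivity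
    have h1 : σ * GPSWF.moment α ψ j ≤ √Z * ‖μ‖ / r ^ j := by
      rw [le_div_iff₀' hrj]
      exact (hmom j hj).2
    refine h1.trans ?_
    have h2 : 1 / r ^ j ≤ (1 / q) ^ j := by
      rw [one_div_pow]
      apply one_div_le_one_div_of_le (by positivity)
      rw [← hr, ← pow_mul]
      exact pow_le_pow_of_le_one hr0.le hr1 (by omega)
    calc √Z * ‖μ‖ / r ^ j = √Z * (1 / r ^ j) * ‖μ‖ := by ring
      _ ≤ √(1 + α) * (1 / q) ^ j * ‖μ‖ := by gcongr
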